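/- Let $\psi: G\times M\to M$ be a smooth, free and proper left action of a connected Abelian Lie group $G$ (Lie algebra $\mathfrak g$) on a manifold $M$, so that $\pi:M\to M/G$ is a principal fibre bundle; write $\tilde\xi$ for the fundamental vector field of $\xi\in\mathfrak g$. Fix a principal connection with $\mathfrak g$-valued form $\omega$. Let $L:TM\to\mathbb R$ be a smooth Lagrangian, invariant under the tangent action of $G$ and regular (its fibre Hessian $g$ is everywhere non-singular), such that in addition the bilinear form $(\xi,\eta)\mapsto g(\tilde\xi,\tilde\eta)$ on $\mathfrak g$ is non-singular at every point of $TM$. Let $p:TM\to\mathfrak g^*$, $\langle p,\xi\rangle=\tilde\xi^{V}(L)$ ($\tilde\xi^V$ the vertical lift), be the momentum map, let $\mu\in\mathfrak g^*$, and let $N_\mu=p^{-1}(\mu)$. Let $\mathcal R=L-\langle p,\omega\rangle$ be the Routhian. For coordinates $(x^i)$ on $M/G$ let $X_i$ be the horizontal lift of $\partial/\partial x^i$ and let $B_{ij}=\omega([X_i,X_j])\in\mathfrak g$ be the curvature; for a basis $(E_a)$ of $\mathfrak g$ write $B_{ij}=B^a_{ij}E_a$ and $\pi_a=\langle\mu,E_a\rangle$.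 Then: 1. $L$ has a unique Euler–Lagrange field $\Gamma$ (the smooth second-order differential equation field on $TM$ with $\Gamma(\partial L/\partial u^\alpha)-\partial L/\partial x^\alpha=0$ in all natural coordinates). It is $G$-invariant and tangent to $N_\mu$. The level set $N_\mu$ is regular (the differentials of the components of $p$ are linearly independent along it) and is invariant under all of $G$. 2. $N_\mu/G$ is a smooth manifold, with $N_\mu\to N_\mu/G$ a smooth submersion, and $T\pi$ induces a map $\varphi:N_\mu/G\to T(M/G)$ which is a local diffeomorphism; so the natural coordinates $(x^i,v^i)$ of $T(M/G)$ are local coordinates on $N_\mu/G$. If for every $u\in T_mM$, $m\in M$, the momentum equation $p(u+\tilde\xi(m))=\mu$ has exactly one solution $\xi\in\mathfrak g$, then $\varphi$ is a diffeomorphism of $N_\mu/G$ onto $T(M/G)$. 3. The restriction of $\Gamma$ to $N_\mu$ reduces to a smooth vector field $\check\Gamma$ on $N_\mu/G$, and so does every field on $N_\mu$ which differs from it by a vertical field (in particular its horizontal part with respect to any principal connection on $N_\mu\to N_\mu/G$). Under the identification $\varphi$, $\check\Gamma$ is a second-order differential equation field, $$\check\Gamma=v^i\frac{\partial}{\partial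 x^i}+\Gamma^i(x,v)\frac{\partial}{\partial v^i}.$$ 4. The restriction of $\mathcal R$ to $N_\mu$ descends to a smooth function on $N_\mu/G$, also denoted $\mathcal R$. A curve in $N_\mu/G$ defined on an open interval is an integral curve of $\check\Gamma$ if and only if it is differentiable, $v^i=\dot x^i$ along it, and in the coordinates $(x^i,v^i)$ induced by every chart of $M/G$ it satisfies Routh's equations $$\frac{d}{dt}\left(\frac{\partial\mathcal R}{\partial v^i}\right)-\frac{\partial\mathcal R}{\partial x^i}=-B^a_{ij}\,\pi_a\,\dot x^j .$$ -/

import Mathlib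

open Set Filter Topology
open scoped Manifold ContDiff

noncomputable section

namespace Routh

/-! ### Coordinates on tangent bundles, derivatives in coordinates -/

section Coordinates

variable {F : Type*} [NormedAddCommGroup F] [NormedSpace ℝ F]
  {N : Type*} [TopologicalSpace N] [ChartedSpace F N]

/-- The natural coordinates `(x, v)` on the tangent bundle induced by the coordinates `x = e` on
the base. -/
def natCoord (e : OpenPartialHomeomorph N F) (w : TangentBundle 𝓘(ℝ, F) N) : F × F :=
  (e w.proj, mfderiv 𝓘(ℝ, F) 𝓘(ℝ, F) e w.proj w.2)

end Coordinates

section CoordDeriv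

variable {F : Type*} [NormedAddCommGroup F] [NormedSpace ℝ F]
  {H : Type*} [TopologicalSpace H] {I : ModelWithCorners ℝ F H}
  {N : Type*} [TopologicalSpace N] [ChartedSpace H N]
  {V : Type*} [NormedAddCommGroup V] [NormedSpace ℝ V]

/-- The derivative `Z(f)` of `f` at `z` along the tangent vector `Z`. -/
def dirDeriv (I : ModelWithCorners ℝ F H) (f : N → ℝ) (z : N) (Z : TangentSpace I z) : ℝ :=
  mfderiv I 𝓘(ℝ, ℝ) f z Z

/-- The partial derivative of `f` at `z` in the coordinate direction `a`, with respect to local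
coordinates `κ` (with values in a vector space `V`) on `N`: the coordinate vector field at `z` is
the inverse image of `a` under the derivative of `κ`. -/
def coordDeriv (I : ModelWithCorners ℝ F H) (κ : N → V) (f : N → ℝ) (a : V) (z : N) : ℝ :=
  dirDeriv I f z ((mfderiv I 𝓘(ℝ, V) κ z).inverse a)

end CoordDeriv

/-! ### Lagrangians and Euler-Lagrange fields -/

section Lagrangian

variable {E : Type*} [NormedAddCommGroup E] [NormedSpace ℝ E]
  {M : Type*} [TopologicalSpace M] [ChartedSpace E M]

/-- The fibre derivative of `L` at `w ∈ TM`: `u ↦ uⱽ(L)` at `w`. -/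
def fibreDeriv (L : TangentBundle 𝓘(ℝ, E) M → ℝ) (w : TangentBundle 𝓘(ℝ, E) M) :
    TangentSpace 𝓘(ℝ, E) w.proj →L[ℝ] ℝ :=
  fderiv ℝ (fun u : E => L ⟨w.proj, u⟩) w.2

/-- The Hessian `g(u, v) = uⱽ(vⱽ(L))` of `L` at `w ∈ TM`. -/
def hessian (L : TangentBundle 𝓘(ℝ, E) M → ℝ) (w : TangentBundle 𝓘(ℝ, E) M)
    (u v : TangentSpace 𝓘(ℝ, E) w.proj) : ℝ :=
  fderiv ℝ (fun y : E => fderiv ℝ (fun u : E => L ⟨w.proj, u⟩) y) w.2 u v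

/-- A regular Lagrangian: the Hessian is everywhere non-singular. -/
def IsRegular (L : TangentBundle 𝓘(ℝ, E) M → ℝ) : Prop :=
  ∀ (w : TangentBundle 𝓘(ℝ, E) M) (u : TangentSpace 𝓘(ℝ, E) w.proj),
    (∀ v, hessian L w u v = 0) → u = 0

variable [IsManifold 𝓘(ℝ, E) ∞ M]

/-- `Γ` is the Euler-Lagrange field of `L`: a smooth second-order differential equation field on
`TM` with `Γ(∂L/∂u^α) - ∂L/∂x^α = 0` in the natural coordinates of every chart of `M`. -/
structure IsEulerLagrangeField (L : TangentBundle 𝓘(ℝ, E) M → ℝ)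
    (Γ : ∀ w : TangentBundle 𝓘(ℝ, E) M, TangentSpace 𝓘(ℝ, E).tangent w) : Prop where
  smooth : ContMDiff 𝓘(ℝ, E).tangent 𝓘(ℝ, E).tangent.tangent ∞
    (fun w => (⟨w, Γ w⟩ : TangentBundle 𝓘(ℝ, E).tangent (TangentBundle 𝓘(ℝ, E) M)))
  second_order : ∀ w, mfderiv 𝓘(ℝ, E).tangent 𝓘(ℝ, E)
    (fun w' : TangentBundle 𝓘(ℝ, E) M => w'.proj) w (Γ w) = w.2
  euler_lagrange : ∀ e ∈ IsManifold.maximalAtlas 𝓘(ℝ, E) ∞ M,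
    ∀ w : TangentBundle 𝓘(ℝ, E) M, w.proj ∈ e.source → ∀ k : E,
      dirDeriv 𝓘(ℝ, E).tangent
        (coordDeriv 𝓘(ℝ, E).tangent (natCoord e) L ((0, k) : E × E)) w (Γ w)
      - coordDeriv 𝓘(ℝ, E).tangent (natCoord e) L ((k, 0) : E × E) w = 0

end Lagrangian

/-! ### Group actions, momentum, principal connections -/

section Action

variable {E : Type*} [NormedAddCommGroup E] [NormedSpace ℝ E]
  {EG : Type*} [NormedAddCommGroup EG] [NormedSpace ℝ EG]
  {M : Type*} [TopologicalSpace M] [ChartedSpace E M]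
  {G : Type*} [TopologicalSpace G] [ChartedSpace EG G] [Group G] [MulAction G M]

/-- The tangent action `w ↦ Tψ_g(w)` of `g` on `TM`. -/
def tangentAct (g : G) (w : TangentBundle 𝓘(ℝ, E) M) : TangentBundle 𝓘(ℝ, E) M :=
  tangentMap 𝓘(ℝ, E) 𝓘(ℝ, E) (fun m : M => g • m) w

variable (EG G) in
/-- The value at `m` of the fundamental vector field of `ξ` on `M`: the derivative of
`g ↦ g • m` at the identity in the direction `ξ`. -/
def fundamental (m : M) : GroupLieAlgebra 𝓘(ℝ, EG) G →L[ℝ] TangentSpace 𝓘(ℝ, E) m :=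
  mfderiv 𝓘(ℝ, EG) 𝓘(ℝ, E) (fun g : G => g • m) 1

variable (EG G) in
/-- The value at `w` of the fundamental vector field of `ξ` for the tangent action on `TM` (the
complete lift of the fundamental vector field on `M`). -/
def fundamentalT [IsManifold 𝓘(ℝ, E) ∞ M] (w : TangentBundle 𝓘(ℝ, E) M) :
    GroupLieAlgebra 𝓘(ℝ, EG) G →L[ℝ] TangentSpace 𝓘(ℝ, E).tangent w :=
  mfderiv 𝓘(ℝ, EG) 𝓘(ℝ, E).tangent (fun g : G => tangentAct g w) 1

variable (EG G) in
/-- The momentum map `TM → 𝔤*`, with components `p_a(w) = (Ẽ_a)ⱽ(L)` at `w`. -/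
def momentum (L : TangentBundle 𝓘(ℝ, E) M → ℝ) (w : TangentBundle 𝓘(ℝ, E) M) :
    GroupLieAlgebra 𝓘(ℝ, EG) G →L[ℝ] ℝ :=
  (fibreDeriv L w).comp (fundamental EG G w.proj)

variable (EG G) in
/-- Non-singularity of the matrix `g_ab = g(Ẽ_a, Ẽ_b)` everywhere on `TM`. -/
def IsGroupRegular (L : TangentBundle 𝓘(ℝ, E) M → ℝ) : Prop :=
  ∀ (w : TangentBundle 𝓘(ℝ, E) M) (ξ : GroupLieAlgebra 𝓘(ℝ, EG) G),
    (∀ η, hessian L w (fundamental EG G w.proj ξ) (fundamental EG G w.proj η) = 0) → ξ = 0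

/-- The level set `N_μ` of momentum. -/
def levelSet (L : TangentBundle 𝓘(ℝ, E) M → ℝ) (μ : GroupLieAlgebra 𝓘(ℝ, EG) G →L[ℝ] ℝ) :
    Set (TangentBundle 𝓘(ℝ, E) M) :=
  {w | momentum EG G L w = μ}

/-- The orbit space `N_μ / G` for the tangent action, with the quotient topology. (For a smooth
action the relation is an equivalence relation.) -/
abbrev LevelQuotient (L : TangentBundle 𝓘(ℝ, E) M → ℝ)
    (μ : GroupLieAlgebra 𝓘(ℝ, EG) G →L[ℝ] ℝ) : Type _ :=
  Quot (fun w w' : levelSet L μ => ∃ g : G, tangentAct g w.1 = w'.1)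

/-- The projection `N_μ → N_μ / G`. -/
def levelProj (L : TangentBundle 𝓘(ℝ, E) M → ℝ) (μ : GroupLieAlgebra 𝓘(ℝ, EG) G →L[ℝ] ℝ)
    (w : levelSet L μ) : LevelQuotient L μ :=
  Quot.mk _ w

variable (E EG M G) in
/-- A principal connection: a smooth left splitting `TM → M × 𝔤` of the inclusion
`(m, ξ) ↦ ξ̃(m)` of the vertical bundle, such that the associated `(1,1)` tensor field
(the projection of `TM` on the vertical bundle) is invariant under `G`. -/
structure PrincipalConnection [IsManifold 𝓘(ℝ, E) ∞ M] where
  /-- The connection form. -/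
  form : ∀ m : M, TangentSpace 𝓘(ℝ, E) m →L[ℝ] GroupLieAlgebra 𝓘(ℝ, EG) G
  smooth : ContMDiff (M' := EG) 𝓘(ℝ, E).tangent 𝓘(ℝ, EG) ∞
    (fun w : TangentBundle 𝓘(ℝ, E) M => form w.proj w.2)
  splits : ∀ (m : M) (ξ : GroupLieAlgebra 𝓘(ℝ, EG) G), form m (fundamental EG G m ξ) = ξ
  invariant : ∀ (g : G) (m : M) (u : TangentSpace 𝓘(ℝ, E) m),
    fundamental EG G (g • m)
        (form (g • m) (mfderiv 𝓘(ℝ, E) 𝓘(ℝ, E) (fun m' : M => g • m') m u))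
      = mfderiv 𝓘(ℝ, E) 𝓘(ℝ, E) (fun m' : M => g • m') m (fundamental EG G m (form m u))

/-- The Routhian `L - v^a p_a`, where `v^a` are the components of the `𝔤`-valued connection form
evaluated on the velocity. -/
def routhian [IsManifold 𝓘(ℝ, E) ∞ M] (A : PrincipalConnection E EG M G)
    (L : TangentBundle 𝓘(ℝ, E) M → ℝ) (w : TangentBundle 𝓘(ℝ, E) M) : ℝ :=
  L w - momentum EG G L w (A.form w.proj w.2)

variable (G M) in
/-- The projection `M → M / G`. -/
def orbitProj (m : M) : MulAction.orbitRel.Quotient G M :=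
  Quotient.mk _ m

end Action

/-! ### The principal bundle `M → M / G` and curvature -/

section Bundle

variable {E : Type*} [NormedAddCommGroup E] [NormedSpace ℝ E]
  {EG : Type*} [NormedAddCommGroup EG] [NormedSpace ℝ EG] {n : ℕ}
  {M : Type*} [TopologicalSpace M] [ChartedSpace E M]
  {G : Type*} [TopologicalSpace G] [ChartedSpace EG G] [Group G] [MulAction G M]
  [ChartedSpace (EuclideanSpace ℝ (Fin n)) (MulAction.orbitRel.Quotient G M)]

variable (E EG n M G) in
/-- `M → M / G` is a (smooth) principal fibre bundle with group `G`: over a neighbourhood `U` of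
every point of `M / G` there is a diffeomorphism of `U × G` with the part of `M` over `U`, under
which the projection is the projection on the first factor and the action is
`g • (x, h) = (x, g h)`. -/
def IsPrincipalBundle : Prop :=
  ∀ x : MulAction.orbitRel.Quotient G M,
    ∃ (U : Set (MulAction.orbitRel.Quotient G M))
      (Ψ : OpenPartialHomeomorph (MulAction.orbitRel.Quotient G M × G) M),
      x ∈ U ∧ IsOpen U ∧ Ψ.source = U ×ˢ univ ∧ Ψ.target = orbitProj M G ⁻¹' U ∧
      ContMDiffOn ((𝓡 n).prod 𝓘(ℝ, EG)) 𝓘(ℝ, E) ∞ Ψ Ψ.source ∧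
      ContMDiffOn 𝓘(ℝ, E) ((𝓡 n).prod 𝓘(ℝ, EG)) ∞ Ψ.symm Ψ.target ∧
      (∀ y ∈ U, ∀ h : G, orbitProj M G (Ψ (y, h)) = y) ∧
      (∀ y ∈ U, ∀ g h : G, Ψ (y, g * h) = g • Ψ (y, h))

variable [IsManifold 𝓘(ℝ, E) ∞ M]

/-- The horizontal lift to `m` of a tangent vector of `M / G`: the vector `u ∈ T_m M` that is
horizontal and projects onto `v`. -/
def horizontalLift (A : PrincipalConnection E EG M G) (m : M)
    (v : TangentSpace (𝓡 n) (orbitProj M G m)) : TangentSpace 𝓘(ℝ, E) m :=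
  Classical.epsilon fun u : TangentSpace 𝓘(ℝ, E) m =>
    mfderiv 𝓘(ℝ, E) (𝓡 n) (orbitProj M G) m u = v ∧ A.form m u = 0

/-- The vector field `X_i` over the domain of a chart `e` of `M / G`: the horizontal lift of the
coordinate field `∂/∂x^i`. -/
def horizontalField (A : PrincipalConnection E EG M G)
    (e : OpenPartialHomeomorph (MulAction.orbitRel.Quotient G M) (EuclideanSpace ℝ (Fin n)))
    (i : Fin n) (m : M) : TangentSpace 𝓘(ℝ, E) m :=
  horizontalLift A m
    ((mfderiv (𝓡 n) (𝓡 n) e (orbitProj M G m)).inverse (EuclideanSpace.single i (1 : ℝ)))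

/-- The components of the curvature, as elements of `𝔤`: `[X_i, X_j] = R^a_ij Ẽ_a`. -/
def curvature (A : PrincipalConnection E EG M G)
    (e : OpenPartialHomeomorph (MulAction.orbitRel.Quotient G M) (EuclideanSpace ℝ (Fin n)))
    (i j : Fin n) (m : M) : GroupLieAlgebra 𝓘(ℝ, EG) G :=
  A.form m (VectorField.mlieBracket 𝓘(ℝ, E) (horizontalField A e i) (horizontalField A e j) m)

end Bundle

/-! ### The reduced space and the reduced equations -/

section Reduced

variable {E : Type*} [NormedAddCommGroup E] [NormedSpace ℝ E]
  {EG : Type*} [NormedAddCommGroup EG] [NormedSpace ℝ EG] {n : ℕ}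
  {M : Type*} [TopologicalSpace M] [ChartedSpace E M] [IsManifold 𝓘(ℝ, E) ∞ M]
  {G : Type*} [TopologicalSpace G] [ChartedSpace EG G] [Group G] [MulAction G M]
  (L : TangentBundle 𝓘(ℝ, E) M → ℝ) (μ : GroupLieAlgebra 𝓘(ℝ, EG) G →L[ℝ] ℝ)

/-- The given smooth structure on `N_μ / G` is the quotient structure: the projection
`N_μ → N_μ / G` is smooth (locally the restriction of a smooth map on `TM`) and is a submersion
(through each point of `N_μ` there is a smooth local section). There is at most one such smooth
structure. -/
structure IsQuotientManifold
    [ChartedSpace (ModelProd (EuclideanSpace ℝ (Fin n)) (EuclideanSpace ℝ (Fin n)))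
      (LevelQuotient L μ)] : Prop where
  smooth : ∀ w : levelSet L μ, ∃ (U : Set (TangentBundle 𝓘(ℝ, E) M))
    (F : TangentBundle 𝓘(ℝ, E) M → LevelQuotient L μ), IsOpen U ∧ w.1 ∈ U ∧
      ContMDiffOn 𝓘(ℝ, E).tangent (𝓡 n).tangent ∞ F U ∧
      ∀ w' : levelSet L μ, w'.1 ∈ U → F w'.1 = levelProj L μ w'
  submersion : ∀ w : levelSet L μ, ∃ (O : Set (LevelQuotient L μ))
    (σ : LevelQuotient L μ → TangentBundle 𝓘(ℝ, E) M), IsOpen O ∧ levelProj L μ w ∈ O ∧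
      ContMDiffOn (𝓡 n).tangent 𝓘(ℝ, E).tangent ∞ σ O ∧ σ (levelProj L μ w) = w.1 ∧
      ∀ z ∈ O, ∃ h : σ z ∈ levelSet L μ, levelProj L μ ⟨σ z, h⟩ = z

/-- The vector field `Z` on `N_μ` (tangent to `N_μ`) and the vector field `Y` on `N_μ / G` are
related by the projection `q : N_μ → N_μ / G`, i.e. `Tq(Z(w)) = Y(q(w))` for `w ∈ N_μ`; here `Tq`
is computed with any local extension `F` of `q` to `TM`. -/
def ReducesTo
    [ChartedSpace (ModelProd (EuclideanSpace ℝ (Fin n)) (EuclideanSpace ℝ (Fin n)))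
      (LevelQuotient L μ)]
    (Z : ∀ w : TangentBundle 𝓘(ℝ, E) M, TangentSpace 𝓘(ℝ, E).tangent w)
    (Y : ∀ z : LevelQuotient L μ, TangentSpace (𝓡 n).tangent z) : Prop :=
  ∀ (w : levelSet L μ) (F : TangentBundle 𝓘(ℝ, E) M → LevelQuotient L μ),
    MDifferentiableAt 𝓘(ℝ, E).tangent (𝓡 n).tangent F w.1 →
    (∀ᶠ w' in 𝓝 w, F w'.1 = levelProj L μ w') →
    mfderiv 𝓘(ℝ, E).tangent (𝓡 n).tangent F w.1 (Z w.1) = Y (F w.1)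

variable [ChartedSpace (EuclideanSpace ℝ (Fin n)) (MulAction.orbitRel.Quotient G M)]
  [ChartedSpace (ModelProd (EuclideanSpace ℝ (Fin n)) (EuclideanSpace ℝ (Fin n)))
      (LevelQuotient L μ)]

/-- The curve `c` in `N_μ / G` is, on `s`, a solution of Routh's equations, where `N_μ / G` is
identified with `T(M/G)` through `φ`, i.e. `(x, v) = natCoord e ∘ φ` are used as coordinates for
every chart `e` of `M / G`, and `R` is the reduced Routhian: `c` is differentiable, `v = dx/dt`
along `c`, and `d/dt(∂R/∂v^i) - ∂R/∂x^i = - π_a B^a_ij dx^j/dt`. -/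
structure IsRouthSolution (A : PrincipalConnection E EG M G)
    (φ : LevelQuotient L μ → TangentBundle (𝓡 n) (MulAction.orbitRel.Quotient G M))
    (R : LevelQuotient L μ → ℝ) (c : ℝ → LevelQuotient L μ) (s : Set ℝ) : Prop where
  differentiable : ∀ t ∈ s, MDifferentiableAt 𝓘(ℝ, ℝ) (𝓡 n).tangent c t
  velocity : ∀ t ∈ s, HasMFDerivAt 𝓘(ℝ, ℝ) (𝓡 n) (fun τ => (φ (c τ)).proj) t
    ((1 : ℝ →L[ℝ] ℝ).smulRight (φ (c t)).2)
  routh : ∀ t ∈ s, ∀ e ∈ IsManifold.maximalAtlas (𝓡 n) ∞ (MulAction.orbitRel.Quotient G M),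
    (φ (c t)).proj ∈ e.source → ∀ (i : Fin n) (m : M), orbitProj M G m = (φ (c t)).proj →
      ∃ a : ℝ,
        HasDerivAt (fun τ => coordDeriv (𝓡 n).tangent (fun z => natCoord e (φ z)) R
          (0, EuclideanSpace.single i (1 : ℝ)) (c τ)) a t ∧
        a - coordDeriv (𝓡 n).tangent (fun z => natCoord e (φ z)) R
            (EuclideanSpace.single i (1 : ℝ), 0) (c t)
          = - ∑ j : Fin n, μ (curvature A e i j m) * (natCoord e (φ (c t))).2 j

end Reduced

end Routh

end

noncomputable section

namespace Routh

/-! ### Partial diffeomorphisms and local coordinates -/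

section PartialDiffeo

variable {F : Type*} [NormedAddCommGroup F] [NormedSpace ℝ F]
  {H : Type*} [TopologicalSpace H] {I : ModelWithCorners ℝ F H}
  {N : Type*} [TopologicalSpace N] [ChartedSpace H N]
  {F' : Type*} [NormedAddCommGroup F'] [NormedSpace ℝ F']
  {H' : Type*} [TopologicalSpace H'] {J : ModelWithCorners ℝ F' H'}
  {N' : Type*} [TopologicalSpace N'] [ChartedSpace H' N']
  {F'' : Type*} [NormedAddCommGroup F''] [NormedSpace ℝ F'']
  {H'' : Type*} [TopologicalSpace H''] {K : ModelWithCorners ℝ F'' H''}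
  {N'' : Type*} [TopologicalSpace N''] [ChartedSpace H'' N'']
  {V : Type*} [NormedAddCommGroup V] [NormedSpace ℝ V]

/-! A commutative Lie group is locally a vector group, so the bundle `M → M / G` has charts `(x, θ)`
in which the projection forgets `θ` and the group translates `θ`. An invariant Lagrangian then does
not depend on `θ`: these coordinates are cyclic. The Euler-Lagrange equations in the directions `θ`
say that the momentum is conserved; those in the directions `x` become Routh's equations. The
logarithm comes from `exists_local_log` (the Maurer-Cartan form is closed because the group
commutes, hence exact on a ball), the charts from `exists_isAdapted`, and `IsAdapted.isFlatSystem`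
turns `L` and the connection into data on a vector space.

The Euler-Lagrange field: the equations are linear in the acceleration with the fibre Hessian as
matrix, so a regular `L` determines the acceleration in each chart; `elExpr_comp_flatTangent` shows
that the equations do not depend on the chart.

The quotient: non-singularity of `g` on the fundamental fields lets `p = μ` be solved locally for
the vertical velocity (`IsFlatSystem.exists_sliceDiffeo`). Near each of its points `N_μ` is
therefore described by `(x, θ, v)`, and `N_μ / G` by `(x, v)`. This gives local sections of `N_μ →
T(M/G)` that meet every nearby orbit (`RouthChart.eventually_sec`), so `φ` is a local homeomorphism,
and the smooth structure of `N_μ / G` is pulled back along it. No manifold structure is put on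
`N_μ`: maps on it are handled through local extensions to `TM`, tangent vectors through curves.

Routh's equations: let `q(x, v)` be such a section and `Ω` the connection form. When `(x, v)`
varies, the vertical velocity of `q` varies in a way that is not explicit. It contributes `μ` of
that variation through `L`, because `p = μ`, and the same through `⟨p, ω⟩`, because `ω` reproduces
vertical vectors. The two cancel in the Routhian (`IsSlice.fderiv_flatRouthian`), whose derivatives
are thus horizontal derivatives of `L` minus derivatives of `μ ∘ Ω`. Inserting the Euler-Lagrange
equations leaves the antisymmetrised derivative of `Ω` paired with `μ`, and by `curvature_eq` this
is the curvature term. No term quadratic in `Ω` appears, since the group is commutative.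

Conversely, Routh's equations determine the reduced acceleration because the reduced Routhian is
regular (`IsSlice.eq_zero_of_fderiv_fderiv`): a null vector of its fibre Hessian lifts, through the
section, to a null vector of `g`. -/

/-- An open partial homeomorphism that is smooth in both directions. -/
structure IsPartialDiffeo (I : ModelWithCorners ℝ F H) (J : ModelWithCorners ℝ F' H')
    (κ : OpenPartialHomeomorph N N') : Prop where
  smooth : ContMDiffOn I J ∞ κ κ.source
  smooth_symm : ContMDiffOn J I ∞ κ.symm κ.target

namespace IsPartialDiffeo

variable {κ : OpenPartialHomeomorph N N'}

theorem symm (h : IsPartialDiffeo I J κ) : IsPartialDiffeo J I κ.symm :=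
  ⟨h.smooth_symm, by simpa using h.smooth⟩

theorem trans {κ' : OpenPartialHomeomorph N' N''} (h : IsPartialDiffeo I J κ)
    (h' : IsPartialDiffeo J K κ') : IsPartialDiffeo I K (κ.trans κ') := by
  constructor
  · exact h'.smooth.comp (h.smooth.mono inter_subset_left) inter_subset_right
  · exact h.smooth_symm.comp (h'.smooth_symm.mono inter_subset_left) inter_subset_right

theorem restrOpen (h : IsPartialDiffeo I J κ) (s : Set N) (hs : IsOpen s) :
    IsPartialDiffeo I J (κ.restrOpen s hs) :=
  ⟨h.smooth.mono fun _ hx => hx.1, h.smooth_symm.mono fun _ hx => hx.1⟩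

theorem contMDiffAt (h : IsPartialDiffeo I J κ) {z : N} (hz : z ∈ κ.source) :
    ContMDiffAt I J ∞ κ z :=
  h.smooth.contMDiffAt (κ.open_source.mem_nhds hz)

theorem contMDiffAt_symm (h : IsPartialDiffeo I J κ) {z : N'} (hz : z ∈ κ.target) :
    ContMDiffAt J I ∞ κ.symm z :=
  h.smooth_symm.contMDiffAt (κ.open_target.mem_nhds hz)

theorem mdifferentiableAt (h : IsPartialDiffeo I J κ) {z : N} (hz : z ∈ κ.source) :
    MDifferentiableAt I J κ z :=
  (h.contMDiffAt hz).mdifferentiableAt (by simp)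

theorem mdifferentiableAt_symm (h : IsPartialDiffeo I J κ) {z : N'} (hz : z ∈ κ.target) :
    MDifferentiableAt J I κ.symm z :=
  (h.contMDiffAt_symm hz).mdifferentiableAt (by simp)

theorem mdifferentiable (h : IsPartialDiffeo I J κ) : κ.MDifferentiable I J :=
  ⟨h.smooth.mdifferentiableOn (by simp), h.smooth_symm.mdifferentiableOn (by simp)⟩

theorem symm_mfderiv_mfderiv (h : IsPartialDiffeo I J κ) {z : N} (hz : z ∈ κ.source)
    (Z : TangentSpace I z) : mfderiv J I κ.symm (κ z) (mfderiv I J κ z Z) = Z :=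
  (h.mdifferentiable.mfderiv hz).left_inv Z

theorem mfderiv_symm_mfderiv (h : IsPartialDiffeo I J κ) {z : N} (hz : z ∈ κ.source)
    (Z : TangentSpace J (κ z)) : mfderiv I J κ z (mfderiv J I κ.symm (κ z) Z) = Z :=
  (h.mdifferentiable.mfderiv hz).right_inv Z

theorem inverse_mfderiv (h : IsPartialDiffeo I J κ) {z : N} (hz : z ∈ κ.source) :
    (mfderiv I J κ z).inverse = mfderiv J I κ.symm (κ z) := by
  have : mfderiv I J κ z = (h.mdifferentiable.mfderiv hz : TangentSpace I z →L[ℝ] _) := rfl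
  rw [this, ContinuousLinearMap.inverse_equiv]
  rfl

theorem mfderiv_injective (h : IsPartialDiffeo I J κ) {z : N} (hz : z ∈ κ.source) :
    Function.Injective (mfderiv I J κ z) := h.mdifferentiable.mfderiv_injective hz

end IsPartialDiffeo

variable {κ : OpenPartialHomeomorph N V}

namespace IsPartialDiffeo

/-- This is the chain rule for `f = (f ∘ κ.symm) ∘ κ`. It is the device by which every computation
on a manifold below becomes a computation with `fderiv` on the model space. -/
theorem mfderiv_apply_eq (h : IsPartialDiffeo I 𝓘(ℝ, V) κ) {z : N} (hz : z ∈ κ.source)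
    {W : Type*} [NormedAddCommGroup W] [NormedSpace ℝ W] {f : N → W}
    (hf : MDifferentiableAt I 𝓘(ℝ, W) f z) (Z : TangentSpace I z) :
    (mfderiv I 𝓘(ℝ, W) f z Z : W) = fderiv ℝ (f ∘ κ.symm) (κ z) (mfderiv I 𝓘(ℝ, V) κ z Z) := by
  have hs : κ.symm (κ z) = z := κ.left_inv hz
  have h1 : mfderiv 𝓘(ℝ, V) 𝓘(ℝ, W) (f ∘ κ.symm) (κ z)
      = (mfderiv I 𝓘(ℝ, W) f (κ.symm (κ z))).comp (mfderiv 𝓘(ℝ, V) I κ.symm (κ z)) :=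
    mfderiv_comp _ (by rwa [hs]) (h.mdifferentiableAt_symm (κ.map_source hz))
  rw [← mfderiv_eq_fderiv, h1]
  have h2 := h.symm_mfderiv_mfderiv hz Z
  show _ = (mfderiv I 𝓘(ℝ, W) f (κ.symm (κ z)))
    (mfderiv 𝓘(ℝ, V) I κ.symm (κ z) (mfderiv I 𝓘(ℝ, V) κ z Z))
  rw [h2, hs]

theorem dirDeriv_eq (h : IsPartialDiffeo I 𝓘(ℝ, V) κ) {z : N} (hz : z ∈ κ.source) {f : N → ℝ}
    (hf : MDifferentiableAt I 𝓘(ℝ, ℝ) f z) (Z : TangentSpace I z) :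
    dirDeriv I f z Z = fderiv ℝ (f ∘ κ.symm) (κ z) (mfderiv I 𝓘(ℝ, V) κ z Z) :=
  h.mfderiv_apply_eq hz hf Z

theorem coordDeriv_eq (h : IsPartialDiffeo I 𝓘(ℝ, V) κ) {z : N} (hz : z ∈ κ.source) {f : N → ℝ}
    (hf : MDifferentiableAt I 𝓘(ℝ, ℝ) f z) (a : V) :
    coordDeriv I κ f a z = fderiv ℝ (f ∘ κ.symm) (κ z) a := by
  rw [coordDeriv, h.inverse_mfderiv hz, h.dirDeriv_eq hz hf]
  exact congrArg (fderiv ℝ (f ∘ κ.symm) (κ z)) (h.mfderiv_symm_mfderiv hz a)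

theorem contDiffAt_comp_symm (h : IsPartialDiffeo I 𝓘(ℝ, V) κ) {z : N} (hz : z ∈ κ.source)
    {W : Type*} [NormedAddCommGroup W] [NormedSpace ℝ W] {f : N → W}
    (hf : ContMDiffAt I 𝓘(ℝ, W) ∞ f z) : ContDiffAt ℝ ∞ (f ∘ κ.symm) (κ z) := by
  rw [← contMDiffAt_iff_contDiffAt]
  refine ContMDiffAt.comp (κ z) ?_ (h.contMDiffAt_symm (κ.map_source hz))
  rwa [κ.left_inv hz]

theorem eventually_coordDeriv_eq (h : IsPartialDiffeo I 𝓘(ℝ, V) κ) {z : N} (hz : z ∈ κ.source)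
    {f : N → ℝ} (hf : ∀ᶠ z' in 𝓝 z, MDifferentiableAt I 𝓘(ℝ, ℝ) f z') (a : V) :
    ∀ᶠ z' in 𝓝 z, coordDeriv I κ f a z' = fderiv ℝ (f ∘ κ.symm) (κ z') a := by
  filter_upwards [hf, κ.open_source.mem_nhds hz] with z' hf' hz'
  exact h.coordDeriv_eq hz' hf' a

end IsPartialDiffeo

/-- Smoothness of order `∞` at a point provides a neighbourhood for each finite order, possibly
depending on the order; the passage to nearby points is therefore made at order one. -/
theorem eventually_mdifferentiableAt_of_contMDiffAt [IsManifold I ∞ N] [IsManifold J ∞ N']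
    {f : N → N'} {z : N} (hf : ContMDiffAt I J ∞ f z) :
    ∀ᶠ z' in 𝓝 z, MDifferentiableAt I J f z' := by
  have : ContMDiffAt I J 1 f z := hf.of_le (by simp)
  have := IsManifold.of_le (I := I) (M := N) (m := 1) (n := ∞) (by simp)
  have := IsManifold.of_le (I := J) (M := N') (m := 1) (n := ∞) (by simp)
  filter_upwards [(contMDiffAt_iff_contMDiffAt_nhds (by simp)).1 ‹ContMDiffAt I J 1 f z›]
    with z' hz' using hz'.mdifferentiableAt (by simp)

theorem contDiffAt_fderiv_apply {W W' : Type*} [NormedAddCommGroup W] [NormedSpace ℝ W]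
    [NormedAddCommGroup W'] [NormedSpace ℝ W'] {f : W → W'} {p : W} (hf : ContDiffAt ℝ ∞ f p)
    (a : W) : ContDiffAt ℝ ∞ (fun q => fderiv ℝ f q a) p :=
  (hf.fderiv_right (m := ∞) (by simp)).clm_apply contDiffAt_const

namespace IsPartialDiffeo

theorem contMDiffAt_of_comp_symm (h : IsPartialDiffeo I 𝓘(ℝ, V) κ) {z : N} (hz : z ∈ κ.source)
    {f : N → N'} (hf : ContMDiffAt 𝓘(ℝ, V) J ∞ (f ∘ κ.symm) (κ z)) : ContMDiffAt I J ∞ f z := by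
  refine (ContMDiffAt.comp z hf (h.contMDiffAt hz)).congr_of_eventuallyEq ?_
  filter_upwards [κ.open_source.mem_nhds hz] with z' hz'
  simp [κ.left_inv hz']

theorem contMDiffAt_coordDeriv [IsManifold I ∞ N] (h : IsPartialDiffeo I 𝓘(ℝ, V) κ) {z : N}
    (hz : z ∈ κ.source) {f : N → ℝ} (hf : ContMDiffAt I 𝓘(ℝ, ℝ) ∞ f z) (a : V) :
    ContMDiffAt I 𝓘(ℝ, ℝ) ∞ (coordDeriv I κ f a) z := by
  have h1 := h.eventually_coordDeriv_eq hz (eventually_mdifferentiableAt_of_contMDiffAt hf) a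
  refine ContMDiffAt.congr_of_eventuallyEq (f := fun z' => fderiv ℝ (f ∘ κ.symm) (κ z') a) ?_ h1
  exact ContMDiffAt.comp z (contDiffAt_fderiv_apply (h.contDiffAt_comp_symm hz hf) a).contMDiffAt
    (h.contMDiffAt hz)

theorem dirDeriv_coordDeriv [IsManifold I ∞ N] (h : IsPartialDiffeo I 𝓘(ℝ, V) κ) {z : N}
    (hz : z ∈ κ.source) {f : N → ℝ} (hf : ContMDiffAt I 𝓘(ℝ, ℝ) ∞ f z) (a : V)
    (Z : TangentSpace I z) :
    dirDeriv I (coordDeriv I κ f a) z Z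
      = fderiv ℝ (fun p => fderiv ℝ (f ∘ κ.symm) p a) (κ z) (mfderiv I 𝓘(ℝ, V) κ z Z) := by
  rw [h.dirDeriv_eq hz ((h.contMDiffAt_coordDeriv hz hf a).mdifferentiableAt (by simp))]
  congr 1
  -- The coordinate derivative is an ordinary partial derivative only on the domain of `κ`, so the
  -- two functions are compared as germs before differentiating again.
  apply Filter.EventuallyEq.fderiv_eq
  have h1 := h.eventually_coordDeriv_eq hz (eventually_mdifferentiableAt_of_contMDiffAt hf) a
  have h2 : Tendsto κ.symm (𝓝 (κ z)) (𝓝 z) := κ.tendsto_symm hz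
  filter_upwards [h2.eventually h1, κ.open_target.mem_nhds (κ.map_source hz)] with p hp hp'
  simp only [Function.comp_apply]
  rw [hp, κ.right_inv hp']

end IsPartialDiffeo

theorem contMDiffOn_tangentMap [IsManifold I ∞ N] [IsManifold J ∞ N'] {f : N → N'} {s : Set N}
    (hs : IsOpen s) (hf : ContMDiffOn I J ∞ f s) :
    ContMDiffOn I.tangent J.tangent ∞ (tangentMap I J f) (Bundle.TotalSpace.proj ⁻¹' s) := by
  have := IsManifold.of_le (I := I) (M := N) (m := 1) (n := ∞) (by simp)
  have := IsManifold.of_le (I := J) (M := N') (m := 1) (n := ∞) (by simp)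
  refine (hf.contMDiffOn_tangentMapWithin (m := ∞) (by simp) hs.uniqueMDiffOn).congr ?_
  intro w hw
  exact (tangentMapWithin_eq_tangentMap (hs.uniqueMDiffOn _ hw)
    ((hf.mdifferentiableOn (by simp) _ hw).mdifferentiableAt (hs.mem_nhds hw))).symm

/-- A vector field with smooth components in local coordinates is smooth. -/
theorem IsPartialDiffeo.contMDiffAt_vectorField [IsManifold I ∞ N]
    (h : IsPartialDiffeo I 𝓘(ℝ, V) κ) {z : N} (hz : z ∈ κ.source)
    {Γ : ∀ z : N, TangentSpace I z} {vec : V → V} (hvec : ContDiffAt ℝ ∞ vec (κ z))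
    (hΓ : ∀ᶠ z' in 𝓝 z, mfderiv I 𝓘(ℝ, V) κ z' (Γ z') = vec (κ z')) :
    ContMDiffAt I I.tangent ∞ (fun z => (⟨z, Γ z⟩ : TangentBundle I N)) z := by
  have h1 : ContMDiffAt 𝓘(ℝ, V) 𝓘(ℝ, V).tangent ∞
      (fun p : V => (⟨p, vec p⟩ : TangentBundle 𝓘(ℝ, V) V)) (κ z) :=
    contMDiffAt_vectorSpace_iff_contDiffAt.2 hvec
  have h2 := contMDiffOn_tangentMap κ.open_target h.smooth_symm
  have h3 : ContMDiffAt 𝓘(ℝ, V).tangent I.tangent ∞ (tangentMap 𝓘(ℝ, V) I κ.symm)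
      (⟨κ z, vec (κ z)⟩ : TangentBundle 𝓘(ℝ, V) V) :=
    h2.contMDiffAt ((κ.open_target.preimage (FiberBundle.continuous_proj V _)).mem_nhds
      (κ.map_source hz))
  have h4 := ContMDiffAt.comp z (ContMDiffAt.comp (κ z) h3 h1) (h.contMDiffAt hz)
  refine h4.congr_of_eventuallyEq ?_
  filter_upwards [hΓ, κ.open_source.mem_nhds hz] with z' hz' hs
  have h5 := h.symm_mfderiv_mfderiv hs (Γ z')
  rw [hz'] at h5
  symm
  show (⟨κ.symm (κ z'), mfderiv 𝓘(ℝ, V) I κ.symm (κ z') (vec (κ z'))⟩ : TangentBundle I N)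
    = ⟨z', Γ z'⟩
  exact Bundle.TotalSpace.ext (κ.left_inv hs) (heq_of_eq h5)

theorem IsPartialDiffeo.mem_contDiffGroupoid {f : OpenPartialHomeomorph H H}
    (h : IsPartialDiffeo I I f) : f ∈ contDiffGroupoid ∞ I := by
  rw [contDiffGroupoid, mem_groupoid_of_pregroupoid]
  have key : ∀ g : OpenPartialHomeomorph H H, ContMDiffOn I I ∞ g g.source →
      (contDiffPregroupoid ∞ I).property g g.source := by
    intro g hg
    -- On the model space `H` the extended chart is `I` at every point, so the two base points are
    -- arbitrary.
    have := (contMDiffOn_iff.1 hg).2 (I.symm 0) (I.symm 0)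
    have h2 : ContDiffOn ℝ ∞ (I ∘ g ∘ I.symm) _ := this
    refine h2.mono ?_
    rintro x ⟨hx, hx'⟩
    simp only [mfld_simps]
    exact ⟨⟨hx', trivial⟩, hx, trivial⟩
  exact ⟨key f h.smooth, key f.symm h.smooth_symm⟩

end PartialDiffeo

/-! ### Natural charts of tangent bundles -/

section NatChart

variable {F : Type*} [NormedAddCommGroup F] [NormedSpace ℝ F]
  {N : Type*} [TopologicalSpace N] [ChartedSpace F N]

theorem isPartialDiffeo_of_mem_maximalAtlas {e : OpenPartialHomeomorph N F}
    (he : e ∈ IsManifold.maximalAtlas 𝓘(ℝ, F) ∞ N) : IsPartialDiffeo 𝓘(ℝ, F) 𝓘(ℝ, F) e :=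
  ⟨contMDiffOn_of_mem_maximalAtlas he, contMDiffOn_symm_of_mem_maximalAtlas he⟩

variable [IsManifold 𝓘(ℝ, F) ∞ N]

/-- The Euler-Lagrange equations are imposed in all charts of the maximal atlas; this makes them
available in charts built by hand, such as those adapted to the bundle or moved by a group element.
-/
theorem mem_maximalAtlas_of_isPartialDiffeo {e : OpenPartialHomeomorph N F}
    (he : IsPartialDiffeo 𝓘(ℝ, F) 𝓘(ℝ, F) e) : e ∈ IsManifold.maximalAtlas 𝓘(ℝ, F) ∞ N := by
  rw [IsManifold.maximalAtlas, mem_maximalAtlas_iff]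
  intro e' he'
  have h' := isPartialDiffeo_of_mem_maximalAtlas (N := N)
    (IsManifold.subset_maximalAtlas (I := 𝓘(ℝ, F)) (n := ∞) he')
  exact ⟨(he.symm.trans h').mem_contDiffGroupoid, (h'.symm.trans he).mem_contDiffGroupoid⟩

theorem isPartialDiffeo_chartAt (x : N) : IsPartialDiffeo 𝓘(ℝ, F) 𝓘(ℝ, F) (chartAt F x) :=
  isPartialDiffeo_of_mem_maximalAtlas (IsManifold.chart_mem_maximalAtlas x)

/-- `TangentBundle 𝓘(ℝ, F) F` and `F × F` have the same points, but the former carries the bundle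
structure; this map and the next one translate between them. -/
theorem contMDiff_tangentBundle_pair :
    ContMDiff 𝓘(ℝ, F).tangent 𝓘(ℝ, F × F) ∞
      (fun w : TangentBundle 𝓘(ℝ, F) F => ((w.1, w.2) : F × F)) :=
  (Bundle.contMDiff_proj _).prodMk_space (contMDiff_snd_tangentBundle_modelSpace F 𝓘(ℝ, F))

theorem contMDiff_tangentBundle_mk :
    ContMDiff 𝓘(ℝ, F × F) 𝓘(ℝ, F).tangent ∞
      (fun p : F × F => (⟨p.1, p.2⟩ : TangentBundle 𝓘(ℝ, F) F)) := by
  intro p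
  apply Bundle.contMDiffAt_totalSpace.2
  refine ⟨contDiff_fst.contMDiff.contMDiffAt, ?_⟩
  convert! (contDiff_snd (𝕜 := ℝ) (E := F) (F := F) (n := ∞)).contMDiff.contMDiffAt with y
  · simp; rfl

/-- The natural chart of `TN` with values in `F × F` induced by a smooth chart of `N`. -/
def natChart (e : OpenPartialHomeomorph N F) (he : IsPartialDiffeo 𝓘(ℝ, F) 𝓘(ℝ, F) e) :
    OpenPartialHomeomorph (TangentBundle 𝓘(ℝ, F) N) (F × F) where
  toFun := natCoord e
  invFun p := tangentMap 𝓘(ℝ, F) 𝓘(ℝ, F) e.symm ⟨p.1, p.2⟩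
  source := Bundle.TotalSpace.proj ⁻¹' e.source
  target := Prod.fst ⁻¹' e.target
  map_source' w hw := e.map_source hw
  map_target' p hp := e.map_target hp
  left_inv' := by
    rintro ⟨x, u⟩ hw
    have h1 : e.symm (e x) = x := e.left_inv hw
    have h2 := he.symm_mfderiv_mfderiv hw u
    show (⟨e.symm (e x), mfderiv 𝓘(ℝ, F) 𝓘(ℝ, F) e.symm (e x) (mfderiv 𝓘(ℝ, F) 𝓘(ℝ, F) e x u)⟩ :
      TangentBundle 𝓘(ℝ, F) N) = ⟨x, u⟩
    exact Bundle.TotalSpace.ext h1 (heq_of_eq h2)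
  right_inv' := by
    rintro ⟨x, u⟩ hw
    have h1 : e (e.symm x) = x := e.right_inv hw
    have h2 := he.symm.symm_mfderiv_mfderiv hw u
    exact Prod.ext h1 h2
  open_source := e.open_source.preimage (FiberBundle.continuous_proj F _)
  open_target := e.open_target.preimage continuous_fst
  continuousOn_toFun := by
    have h1 := contMDiffOn_tangentMap e.open_source he.smooth
    exact (contMDiff_tangentBundle_pair.comp_contMDiffOn h1).continuousOn
  continuousOn_invFun := by
    have h1 := contMDiffOn_tangentMap e.open_target he.smooth_symm
    exact (h1.comp contMDiff_tangentBundle_mk.contMDiffOn (fun p hp => hp)).continuousOn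

variable {e : OpenPartialHomeomorph N F}

theorem isPartialDiffeo_natChart (he : IsPartialDiffeo 𝓘(ℝ, F) 𝓘(ℝ, F) e) :
    IsPartialDiffeo 𝓘(ℝ, F).tangent 𝓘(ℝ, F × F) (natChart e he) := by
  constructor
  · have h1 := contMDiffOn_tangentMap e.open_source he.smooth
    exact contMDiff_tangentBundle_pair.comp_contMDiffOn h1
  · have h1 := contMDiffOn_tangentMap e.open_target he.smooth_symm
    exact h1.comp contMDiff_tangentBundle_mk.contMDiffOn (fun p hp => hp)

@[simp] theorem coe_natChart (he : IsPartialDiffeo 𝓘(ℝ, F) 𝓘(ℝ, F) e) :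
    ⇑(natChart e he) = natCoord e := rfl

theorem mdifferentiableAt_proj (w : TangentBundle 𝓘(ℝ, F) N) :
    MDifferentiableAt 𝓘(ℝ, F).tangent 𝓘(ℝ, F)
      (fun w' : TangentBundle 𝓘(ℝ, F) N => w'.proj) w := by
  have := IsManifold.of_le (I := 𝓘(ℝ, F)) (M := N) (m := 1) (n := ∞) (by simp)
  have h := Bundle.contMDiff_proj (n := 1) (IB := 𝓘(ℝ, F)) (F := F)
    (TangentSpace 𝓘(ℝ, F) : N → Type _)
  exact (h w).mdifferentiableAt (by simp)

/-- The first component, in a natural chart, of a tangent vector of the tangent bundle. -/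
theorem fst_mfderiv_natCoord (he : IsPartialDiffeo 𝓘(ℝ, F) 𝓘(ℝ, F) e)
    {w : TangentBundle 𝓘(ℝ, F) N} (hw : w.proj ∈ e.source)
    (Z : TangentSpace 𝓘(ℝ, F).tangent w) :
    (mfderiv 𝓘(ℝ, F).tangent 𝓘(ℝ, F × F) (natCoord e) w Z : F × F).1
      = mfderiv 𝓘(ℝ, F) 𝓘(ℝ, F) e w.proj (mfderiv 𝓘(ℝ, F).tangent 𝓘(ℝ, F)
        (fun w' : TangentBundle 𝓘(ℝ, F) N => w'.proj) w Z) := by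
  have hκ := (isPartialDiffeo_natChart he).mdifferentiableAt (z := w) hw
  have h1 : mfderiv 𝓘(ℝ, F).tangent 𝓘(ℝ, F) (Prod.fst ∘ natCoord e) w = _ :=
    mfderiv_comp (I' := 𝓘(ℝ, F × F)) w
    (mdifferentiableAt_iff_differentiableAt.2 differentiableAt_fst) hκ
  have h2 : mfderiv 𝓘(ℝ, F).tangent 𝓘(ℝ, F)
      (e ∘ (fun w' : TangentBundle 𝓘(ℝ, F) N => w'.proj)) w = _ :=
    mfderiv_comp w (he.mdifferentiableAt hw) (mdifferentiableAt_proj w)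
  have h3 : (Prod.fst ∘ natCoord e : TangentBundle 𝓘(ℝ, F) N → F)
    = e ∘ (fun w' : TangentBundle 𝓘(ℝ, F) N => w'.proj) := rfl
  rw [h3, h2] at h1
  have h4 := DFunLike.congr_fun h1 Z
  rw [mfderiv_eq_fderiv, fderiv_fst] at h4
  exact h4.symm

end NatChart

/-! ### The Euler-Lagrange expression on a vector space -/

section Flat

variable {E : Type*} [NormedAddCommGroup E] [NormedSpace ℝ E]

/-- The Euler-Lagrange expression of a function `Λ(x, v)` at `p`, along `Z`, in direction `k`. -/
def elExpr (Λ : E × E → ℝ) (p Z : E × E) (k : E) : ℝ :=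
  fderiv ℝ (fun q => fderiv ℝ Λ q ((0, k) : E × E)) p Z - fderiv ℝ Λ p ((k, 0) : E × E)

/-- The tangent map of `τ` in the vector space setting. -/
def flatTangent {E' : Type*} [NormedAddCommGroup E'] [NormedSpace ℝ E'] (τ : E → E') (q : E × E) :
    E' × E' := (τ q.1, fderiv ℝ τ q.1 q.2)

theorem hasFDerivAt_flatTangent {E' : Type*} [NormedAddCommGroup E'] [NormedSpace ℝ E']
    {τ : E → E'} {q : E × E} (hτ : ContDiffAt ℝ ∞ τ q.1) :
    HasFDerivAt (flatTangent τ)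
      (((fderiv ℝ τ q.1).comp (ContinuousLinearMap.fst ℝ E E)).prod
        ((fderiv ℝ τ q.1).comp (ContinuousLinearMap.snd ℝ E E)
          + ((fderiv ℝ (fderiv ℝ τ) q.1).comp (ContinuousLinearMap.fst ℝ E E)).flip q.2)) q := by
  have h1 : HasFDerivAt τ (fderiv ℝ τ q.1) q.1 := (hτ.differentiableAt (by simp)).hasFDerivAt
  have h2 : HasFDerivAt (fderiv ℝ τ) (fderiv ℝ (fderiv ℝ τ) q.1) q.1 :=
    ((hτ.fderiv_right (m := ∞) (by simp)).differentiableAt (by simp)).hasFDerivAt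
  exact (h1.comp q hasFDerivAt_fst).prodMk ((h2.comp q hasFDerivAt_fst).clm_apply hasFDerivAt_snd)

theorem fderiv_flatTangent_apply {E' : Type*} [NormedAddCommGroup E'] [NormedSpace ℝ E']
    {τ : E → E'} {q : E × E} (hτ : ContDiffAt ℝ ∞ τ q.1) (a b : E) :
    fderiv ℝ (flatTangent τ) q (a, b)
      = (fderiv ℝ τ q.1 a, fderiv ℝ τ q.1 b + fderiv ℝ (fderiv ℝ τ) q.1 a q.2) := by
  rw [(hasFDerivAt_flatTangent hτ).fderiv]
  simp

theorem contDiffAt_flatTangent {E' : Type*} [NormedAddCommGroup E'] [NormedSpace ℝ E']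
    {τ : E → E'} {q : E × E} (hτ : ContDiffAt ℝ ∞ τ q.1) :
    ContDiffAt ℝ ∞ (flatTangent τ) q := by
  have h1 : ContDiffAt ℝ ∞ (fun q : E × E => τ q.1) q := ContDiffAt.comp q hτ contDiffAt_fst
  have h2 : ContDiffAt ℝ ∞ (fun q : E × E => fderiv ℝ τ q.1) q :=
    ContDiffAt.comp (g := fderiv ℝ τ) q (hτ.fderiv_right (m := ∞) (by simp)) contDiffAt_fst
  exact h1.prodMk (h2.clm_apply contDiffAt_snd)

theorem eventually_differentiableAt {W W' : Type*} [NormedAddCommGroup W] [NormedSpace ℝ W]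
    [NormedAddCommGroup W'] [NormedSpace ℝ W'] {f : W → W'} {p : W} (hf : ContDiffAt ℝ ∞ f p) :
    ∀ᶠ q in 𝓝 p, DifferentiableAt ℝ f q := by
  have h1 : ContDiffAt ℝ 1 f p := hf.of_le (by simp)
  filter_upwards [h1.eventually (by simp)] with q hq using hq.differentiableAt (by simp)

theorem eventually_contDiffAt {W W' : Type*} [NormedAddCommGroup W] [NormedSpace ℝ W]
    [NormedAddCommGroup W'] [NormedSpace ℝ W'] {f : W → W'} {p : W} (hf : ContDiffAt ℝ ∞ f p) :
    ∀ᶠ q in 𝓝 p, ContDiffAt ℝ 2 f q :=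
  (hf.of_le (n := ∞) (m := 2) ENat.LEInfty.out).eventually (by simp)

theorem fderiv_fderiv_symm {W : Type*} {W' : Type*} [NormedAddCommGroup W] [NormedSpace ℝ W]
    [NormedAddCommGroup W'] [NormedSpace ℝ W'] {f : W → W'} {p : W} (hf : ContDiffAt ℝ ∞ f p)
    (a b : W) : fderiv ℝ (fderiv ℝ f) p a b = fderiv ℝ (fderiv ℝ f) p b a :=
  (hf.isSymmSndFDerivAt (by simpa using ENat.LEInfty.out)).eq a b

theorem fderiv_fderiv_apply {W : Type*} {W' : Type*} [NormedAddCommGroup W] [NormedSpace ℝ W]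
    [NormedAddCommGroup W'] [NormedSpace ℝ W'] {f : W → W'} {p : W} (hf : ContDiffAt ℝ ∞ f p)
    (a b : W) : fderiv ℝ (fun q => fderiv ℝ f q b) p a = fderiv ℝ (fderiv ℝ f) p a b := by
  have h2 : HasFDerivAt (fderiv ℝ f) (fderiv ℝ (fderiv ℝ f) p) p :=
    ((hf.fderiv_right (m := ∞) (by simp)).differentiableAt (by simp)).hasFDerivAt
  rw [(h2.clm_apply (hasFDerivAt_const b p)).fderiv]
  simp

/-- Invariance of the Euler-Lagrange expression under changes of natural coordinates. -/
theorem elExpr_comp_flatTangent {E' : Type*} [NormedAddCommGroup E'] [NormedSpace ℝ E']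
    {Λ : E × E → ℝ} {Λ' : E' × E' → ℝ} {τ : E → E'} {p : E × E}
    (hτ : ContDiffAt ℝ ∞ τ p.1) (hΛ' : ContDiffAt ℝ ∞ Λ' (flatTangent τ p))
    (hΛ : Λ =ᶠ[𝓝 p] Λ' ∘ flatTangent τ) (a k : E) :
    elExpr Λ p (p.2, a) k
      = elExpr Λ' (flatTangent τ p) (fderiv ℝ (flatTangent τ) p (p.2, a)) (fderiv ℝ τ p.1 k) := by
  have hτ' : ∀ᶠ q : E × E in 𝓝 p, DifferentiableAt ℝ (flatTangent τ) q :=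
    eventually_differentiableAt (contDiffAt_flatTangent hτ)
  have hTc : ContinuousAt (flatTangent τ) p := (contDiffAt_flatTangent hτ).continuousAt
  -- Fibre directions go to fibre directions. This is needed on a neighbourhood, because the fibre
  -- derivative of `Λ` is differentiated once more.
  have hτe : ∀ᶠ q : E × E in 𝓝 p, ∀ b, fderiv ℝ (flatTangent τ) q (0, b) = (0, fderiv ℝ τ q.1 b) := by
    have h1 : ∀ᶠ q : E × E in 𝓝 p, ContDiffAt ℝ 2 τ q.1 :=
      continuousAt_fst.eventually (eventually_contDiffAt hτ)
    filter_upwards [h1] with q hq b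
    have h1 : HasFDerivAt τ (fderiv ℝ τ q.1) q.1 := (hq.differentiableAt (by simp)).hasFDerivAt
    have h2 : HasFDerivAt (fderiv ℝ τ) (fderiv ℝ (fderiv ℝ τ) q.1) q.1 :=
      ((hq.fderiv_right (m := 1) (by norm_num)).differentiableAt (by simp)).hasFDerivAt
    have h3 : HasFDerivAt (flatTangent τ) _ q := 
      (h1.comp q hasFDerivAt_fst).prodMk ((h2.comp q hasFDerivAt_fst).clm_apply hasFDerivAt_snd)
    rw [h3.fderiv]
    simp
  have hΛd : ∀ᶠ q in 𝓝 p, fderiv ℝ Λ q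
      = (fderiv ℝ Λ' (flatTangent τ q)).comp (fderiv ℝ (flatTangent τ) q) := by
    filter_upwards [hΛ.eventuallyEq_nhds, hτ', hTc.eventually (eventually_differentiableAt hΛ')]
      with q h1 h2 h3
    rw [h1.fderiv_eq, fderiv_comp q h3 h2]
  have h0 : (fun q => fderiv ℝ Λ q ((0, k) : E × E)) =ᶠ[𝓝 p]
      fun q => fderiv ℝ Λ' (flatTangent τ q) ((0, fderiv ℝ τ q.1 k) : E' × E') := by
    filter_upwards [hΛd, hτe] with q h1 h2
    rw [h1, ContinuousLinearMap.comp_apply, h2]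
  have hD1 : HasFDerivAt (fun q => fderiv ℝ Λ' (flatTangent τ q))
      ((fderiv ℝ (fderiv ℝ Λ') (flatTangent τ p)).comp (fderiv ℝ (flatTangent τ) p)) p :=
    HasFDerivAt.comp (g := fderiv ℝ Λ') p
      ((hΛ'.fderiv_right (m := ∞) (by simp)).differentiableAt (by simp)).hasFDerivAt
      ((contDiffAt_flatTangent hτ).differentiableAt (by simp)).hasFDerivAt
  have h2 : HasFDerivAt (fderiv ℝ τ) (fderiv ℝ (fderiv ℝ τ) p.1) p.1 :=
    ((hτ.fderiv_right (m := ∞) (by simp)).differentiableAt (by simp)).hasFDerivAt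
  have hD2 : HasFDerivAt (fun q : E × E => ((0, fderiv ℝ τ q.1 k) : E' × E')) _ p :=
    (hasFDerivAt_const (0 : E') p).prodMk
      ((h2.comp p hasFDerivAt_fst).clm_apply (hasFDerivAt_const k p))
  have hD := hD1.clm_apply hD2
  rw [elExpr, elExpr, h0.fderiv_eq, hD.fderiv, hΛd.self_of_nhds, fderiv_fderiv_apply hΛ']
  simp only [ContinuousLinearMap.comp_apply, add_apply, fderiv_flatTangent_apply hτ]
  -- Both the derivative of `∂Λ/∂v` along the motion and `∂Λ/∂x` produce a second derivative of `τ`,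
  -- evaluated at `(p.2, k)` and `(k, p.2)`. They cancel by symmetry; this uses that the first
  -- component of the tangent vector is the velocity `p.2`.
  simp [fderiv_fderiv_symm hτ k p.2]
  have e1 : ((fderiv ℝ τ p.1 k, fderiv ℝ (fderiv ℝ τ) p.1 p.2 k) : E' × E')
      = (fderiv ℝ τ p.1 k, 0) + (0, fderiv ℝ (fderiv ℝ τ) p.1 p.2 k) := by simp
  rw [e1, map_add, fderiv_flatTangent_apply hτ]
  ring

end Flat

/-! ### The Euler-Lagrange equations on a manifold, chart by chart. -/

section EulerLagrange

variable {E : Type*} [NormedAddCommGroup E] [NormedSpace ℝ E]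
  {M : Type*} [TopologicalSpace M] [ChartedSpace E M] [IsManifold 𝓘(ℝ, E) ∞ M]
  {L : TangentBundle 𝓘(ℝ, E) M → ℝ} {e e' : OpenPartialHomeomorph M E}

theorem euler_lagrange_eq_elExpr (hL : ContMDiff 𝓘(ℝ, E).tangent 𝓘(ℝ, ℝ) ∞ L)
    (he : IsPartialDiffeo 𝓘(ℝ, E) 𝓘(ℝ, E) e) {w : TangentBundle 𝓘(ℝ, E) M}
    (hw : w.proj ∈ e.source) (Z : TangentSpace 𝓘(ℝ, E).tangent w) (k : E) :
    dirDeriv 𝓘(ℝ, E).tangent (coordDeriv 𝓘(ℝ, E).tangent (natCoord e) L ((0, k) : E × E)) w Z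
      - coordDeriv 𝓘(ℝ, E).tangent (natCoord e) L ((k, 0) : E × E) w
      = elExpr (L ∘ (natChart e he).symm) (natCoord e w)
        (mfderiv 𝓘(ℝ, E).tangent 𝓘(ℝ, E × E) (natCoord e) w Z) k := by
  have h1 := (isPartialDiffeo_natChart he).dirDeriv_coordDeriv (z := w) hw hL.contMDiffAt (0, k) Z
  have h2 := (isPartialDiffeo_natChart he).coordDeriv_eq (z := w) hw
    (hL.contMDiffAt.mdifferentiableAt (by simp)) (k, 0)
  rw [coe_natChart] at h1 h2
  rw [h1, h2]
  rfl

theorem natCoord_change (he : IsPartialDiffeo 𝓘(ℝ, E) 𝓘(ℝ, E) e)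
    (he' : IsPartialDiffeo 𝓘(ℝ, E) 𝓘(ℝ, E) e') {w : TangentBundle 𝓘(ℝ, E) M}
    (hw : w.proj ∈ e.source) (hw' : w.proj ∈ e'.source) :
    natCoord e' w = flatTangent (e' ∘ e.symm) (natCoord e w) := by
  refine Prod.ext ?_ (he.mfderiv_apply_eq hw (he'.mdifferentiableAt hw') w.2)
  exact congrArg e' (e.left_inv hw).symm

theorem contDiffAt_change (he : IsPartialDiffeo 𝓘(ℝ, E) 𝓘(ℝ, E) e)
    (he' : IsPartialDiffeo 𝓘(ℝ, E) 𝓘(ℝ, E) e') {x : M} (hx : x ∈ e.source) (hx' : x ∈ e'.source) :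
    ContDiffAt ℝ ∞ (e' ∘ e.symm) (e x) :=
  he.contDiffAt_comp_symm hx (he'.contMDiffAt hx')

theorem contDiffAt_lagrangian (hL : ContMDiff 𝓘(ℝ, E).tangent 𝓘(ℝ, ℝ) ∞ L)
    (he : IsPartialDiffeo 𝓘(ℝ, E) 𝓘(ℝ, E) e) {w : TangentBundle 𝓘(ℝ, E) M}
    (hw : w.proj ∈ e.source) : ContDiffAt ℝ ∞ (L ∘ (natChart e he).symm) (natCoord e w) :=
  (isPartialDiffeo_natChart he).contDiffAt_comp_symm (z := w) hw hL.contMDiffAt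

theorem mfderiv_natCoord_change (he : IsPartialDiffeo 𝓘(ℝ, E) 𝓘(ℝ, E) e)
    (he' : IsPartialDiffeo 𝓘(ℝ, E) 𝓘(ℝ, E) e') {w : TangentBundle 𝓘(ℝ, E) M}
    (hw : w.proj ∈ e.source) (hw' : w.proj ∈ e'.source) (Z : TangentSpace 𝓘(ℝ, E).tangent w) :
    (mfderiv 𝓘(ℝ, E).tangent 𝓘(ℝ, E × E) (natCoord e') w Z : E × E)
      = fderiv ℝ (flatTangent (e' ∘ e.symm)) (natCoord e w)
        (mfderiv 𝓘(ℝ, E).tangent 𝓘(ℝ, E × E) (natCoord e) w Z) := by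
  have h := (isPartialDiffeo_natChart he).mfderiv_apply_eq (z := w) hw
    ((isPartialDiffeo_natChart he').mdifferentiableAt (z := w) hw') Z
  have h2 : natCoord e' ∘ (natChart e he).symm =ᶠ[𝓝 (natCoord e w)]
      flatTangent (e' ∘ e.symm) := by
    have h3 : ∀ᶠ w' in 𝓝 w, natCoord e' w' = flatTangent (e' ∘ e.symm) (natCoord e w') := by
      filter_upwards [(natChart e he).open_source.mem_nhds hw,
        (natChart e' he').open_source.mem_nhds hw'] with w' h1 h2
      exact natCoord_change he he' h1 h2
    have h4 : Tendsto (natChart e he).symm (𝓝 (natCoord e w)) (𝓝 w) :=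
      (natChart e he).tendsto_symm hw
    filter_upwards [h4.eventually h3, (natChart e he).open_target.mem_nhds
      ((natChart e he).map_source hw)] with p hp hp'
    simp only [Function.comp_apply]
    rw [hp]
    exact congrArg _ ((natChart e he).right_inv hp')
  rw [coe_natChart, coe_natChart, h2.fderiv_eq] at h
  exact h

theorem elExpr_change (hL : ContMDiff 𝓘(ℝ, E).tangent 𝓘(ℝ, ℝ) ∞ L)
    (he : IsPartialDiffeo 𝓘(ℝ, E) 𝓘(ℝ, E) e) (he' : IsPartialDiffeo 𝓘(ℝ, E) 𝓘(ℝ, E) e')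
    {w : TangentBundle 𝓘(ℝ, E) M} (hw : w.proj ∈ e.source) (hw' : w.proj ∈ e'.source)
    (a k : E) :
    elExpr (L ∘ (natChart e he).symm) (natCoord e w) ((natCoord e w).2, a) k
      = elExpr (L ∘ (natChart e' he').symm) (natCoord e' w)
        (fderiv ℝ (flatTangent (e' ∘ e.symm)) (natCoord e w) ((natCoord e w).2, a))
        (fderiv ℝ (e' ∘ e.symm) (natCoord e w).1 k) := by
  have hL' := contDiffAt_lagrangian hL he' hw'
  rw [natCoord_change he he' hw hw'] at hL' ⊢
  refine elExpr_comp_flatTangent (contDiffAt_change he he' hw hw') hL' ?_ a k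
  have h3 : ∀ᶠ w' in 𝓝 w, L w' = (L ∘ (natChart e' he').symm)
      (flatTangent (e' ∘ e.symm) (natCoord e w')) := by
    filter_upwards [(natChart e he).open_source.mem_nhds hw,
      (natChart e' he').open_source.mem_nhds hw'] with w' h1 h2
    rw [← natCoord_change he he' h1 h2]
    exact congrArg L ((natChart e' he').left_inv h2).symm
  have h4 : Tendsto (natChart e he).symm (𝓝 (natCoord e w)) (𝓝 w) :=
    (natChart e he).tendsto_symm hw
  filter_upwards [h4.eventually h3, (natChart e he).open_target.mem_nhds
    ((natChart e he).map_source hw)] with p hp hp'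
  simp only [Function.comp_apply] at hp ⊢
  rw [hp]
  have h5 : natCoord e ((natChart e he).symm p) = p := (natChart e he).right_inv hp'
  rw [h5]

theorem second_order_iff (he : IsPartialDiffeo 𝓘(ℝ, E) 𝓘(ℝ, E) e)
    {w : TangentBundle 𝓘(ℝ, E) M} (hw : w.proj ∈ e.source)
    (Z : TangentSpace 𝓘(ℝ, E).tangent w) :
    mfderiv 𝓘(ℝ, E).tangent 𝓘(ℝ, E) (fun w' : TangentBundle 𝓘(ℝ, E) M => w'.proj) w Z = w.2 ↔
      (mfderiv 𝓘(ℝ, E).tangent 𝓘(ℝ, E × E) (natCoord e) w Z : E × E).1 = (natCoord e w).2 := by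
  rw [fst_mfderiv_natCoord he hw]
  exact ⟨fun h => congrArg (mfderiv 𝓘(ℝ, E) 𝓘(ℝ, E) e w.proj) h,
    fun h => he.mfderiv_injective hw h⟩

/-- `Z` is a second-order tangent vector at `w` that satisfies the Euler-Lagrange equations in the
natural coordinates of the chart `e`. -/
def IsELVector (L : TangentBundle 𝓘(ℝ, E) M → ℝ) (e : OpenPartialHomeomorph M E)
    (he : IsPartialDiffeo 𝓘(ℝ, E) 𝓘(ℝ, E) e) (w : TangentBundle 𝓘(ℝ, E) M)
    (Z : TangentSpace 𝓘(ℝ, E).tangent w) : Prop :=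
  ∃ a : E, mfderiv 𝓘(ℝ, E).tangent 𝓘(ℝ, E × E) (natCoord e) w Z = ((natCoord e w).2, a) ∧
    ∀ k, elExpr (L ∘ (natChart e he).symm) (natCoord e w) ((natCoord e w).2, a) k = 0

theorem isELVector_iff (hL : ContMDiff 𝓘(ℝ, E).tangent 𝓘(ℝ, ℝ) ∞ L)
    (he : IsPartialDiffeo 𝓘(ℝ, E) 𝓘(ℝ, E) e) {w : TangentBundle 𝓘(ℝ, E) M}
    (hw : w.proj ∈ e.source) (Z : TangentSpace 𝓘(ℝ, E).tangent w) :
    IsELVector L e he w Z ↔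
      mfderiv 𝓘(ℝ, E).tangent 𝓘(ℝ, E) (fun w' : TangentBundle 𝓘(ℝ, E) M => w'.proj) w Z = w.2 ∧
      ∀ k : E, dirDeriv 𝓘(ℝ, E).tangent
        (coordDeriv 𝓘(ℝ, E).tangent (natCoord e) L ((0, k) : E × E)) w Z
        - coordDeriv 𝓘(ℝ, E).tangent (natCoord e) L ((k, 0) : E × E) w = 0 := by
  rw [second_order_iff he hw]
  simp only [euler_lagrange_eq_elExpr hL he hw]
  constructor
  · rintro ⟨a, h1, h2⟩
    rw [h1]
    exact ⟨rfl, h2⟩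
  · rintro ⟨h1, h2⟩
    refine ⟨(mfderiv 𝓘(ℝ, E).tangent 𝓘(ℝ, E × E) (natCoord e) w Z : E × E).2, ?_, ?_⟩
    · exact Prod.ext h1 rfl
    · intro k
      rw [← h2 k, ← h1]
      rfl

/-- The second-order condition is intrinsic and the Euler-Lagrange expression is a covector in `k`,
so its vanishing in one chart carries over to any other. It is what allows a field constructed from
one chart at each point to be smooth and to solve the equations in all charts. -/
theorem IsELVector.change (hL : ContMDiff 𝓘(ℝ, E).tangent 𝓘(ℝ, ℝ) ∞ L)
    (he : IsPartialDiffeo 𝓘(ℝ, E) 𝓘(ℝ, E) e) (he' : IsPartialDiffeo 𝓘(ℝ, E) 𝓘(ℝ, E) e')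
    {w : TangentBundle 𝓘(ℝ, E) M} (hw : w.proj ∈ e.source) (hw' : w.proj ∈ e'.source)
    {Z : TangentSpace 𝓘(ℝ, E).tangent w} (h : IsELVector L e he w Z) :
    IsELVector L e' he' w Z := by
  obtain ⟨a, h1, h2⟩ := h
  have h3 := mfderiv_natCoord_change he he' hw hw' Z
  have h4 := fderiv_flatTangent_apply (q := natCoord e w) (contDiffAt_change he he' hw hw')
    (natCoord e w).2 a
  have h5 : (natCoord e' w).2 = fderiv ℝ (e' ∘ e.symm) (natCoord e w).1 (natCoord e w).2 :=
    congrArg Prod.snd (natCoord_change he he' hw hw')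
  have h6 : fderiv ℝ (flatTangent (e' ∘ e.symm)) (natCoord e w) ((natCoord e w).2, a) =
      ((natCoord e' w).2, (fderiv ℝ (flatTangent (e' ∘ e.symm)) (natCoord e w)
        ((natCoord e w).2, a)).2) := by
    rw [h4, h5]
  refine ⟨(fderiv ℝ (flatTangent (e' ∘ e.symm)) (natCoord e w) ((natCoord e w).2, a)).2, ?_,
    fun k => ?_⟩
  · exact (h3.trans (congrArg _ h1)).trans h6
  · have h7 := elExpr_change hL he he' hw hw' a
      (fderiv ℝ (e ∘ e'.symm) (natCoord e' w).1 k)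
    rw [h2] at h7
    -- Every direction for `e'` is the image of one for `e`, since the derivatives of the two
    -- transition maps are inverse to each other.
    have h8 : fderiv ℝ (e' ∘ e.symm) (natCoord e w).1 
        (fderiv ℝ (e ∘ e'.symm) (natCoord e' w).1 k) = k := by
      have h9 := he'.mfderiv_apply_eq hw' (he.mdifferentiableAt hw)
        (mfderiv 𝓘(ℝ, E) 𝓘(ℝ, E) e'.symm (e' w.proj) k)
      have h10 := he.mfderiv_apply_eq hw (he'.mdifferentiableAt hw')
        (mfderiv 𝓘(ℝ, E) 𝓘(ℝ, E) e'.symm (e' w.proj) k)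
      have h11 := he'.mfderiv_symm_mfderiv hw' k
      have h9' := h9.trans (congrArg (fderiv ℝ (e ∘ e'.symm) (e' w.proj)) h11)
      exact ((congrArg (fderiv ℝ (e' ∘ e.symm) (e w.proj)) h9').symm.trans h10.symm).trans h11
    rw [h8, h6] at h7
    exact h7.symm

end EulerLagrange

/-! ### Existence and uniqueness of the Euler-Lagrange field -/

section FlatExistence

variable {E : Type*} [NormedAddCommGroup E] [NormedSpace ℝ E]

theorem isInvertible_of_injective_dual [FiniteDimensional ℝ E] {B : E →L[ℝ] (E →L[ℝ] ℝ)}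
    (h : ∀ a, (∀ k, B a k = 0) → a = 0) : B.IsInvertible := by
  have hinj : Function.Injective (B : E →ₗ[ℝ] (E →L[ℝ] ℝ)) := by
    rw [← LinearMap.ker_eq_bot, LinearMap.ker_eq_bot']
    intro a ha
    refine h a fun k => ?_
    have : B a = 0 := ha
    rw [this]
    rfl
  have hfin : Module.finrank ℝ E = Module.finrank ℝ (E →L[ℝ] ℝ) := by
    rw [← Subspace.dual_finrank_eq (K := ℝ) (V := E)]
    exact (LinearMap.toContinuousLinearMap (𝕜 := ℝ) (E := E) (F' := ℝ)).finrank_eq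
  exact ⟨(LinearEquiv.ofInjectiveOfFinrankEq _ hinj hfin).toContinuousLinearEquiv, by ext; rfl⟩

/-- The fibre Hessian of `Λ(x, v)` at `p`. -/
def fibreHess (Λ : E × E → ℝ) (p : E × E) : E →L[ℝ] (E →L[ℝ] ℝ) :=
  ((ContinuousLinearMap.compL ℝ E (E × E) ℝ).flip (ContinuousLinearMap.inr ℝ E E)).comp
    ((fderiv ℝ (fderiv ℝ Λ) p).comp (ContinuousLinearMap.inr ℝ E E))

theorem fibreHess_apply {Λ : E × E → ℝ} {p : E × E} (a k : E) :
    fibreHess Λ p a k = fderiv ℝ (fderiv ℝ Λ) p (0, a) (0, k) := rfl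

/-- The acceleration-free part of the Euler-Lagrange equations. -/
def elForce (Λ : E × E → ℝ) (p : E × E) : E →L[ℝ] ℝ :=
  (fderiv ℝ Λ p).comp (ContinuousLinearMap.inl ℝ E E)
    - (fderiv ℝ (fderiv ℝ Λ) p (p.2, 0)).comp (ContinuousLinearMap.inr ℝ E E)

/-- The Euler-Lagrange expression is affine in the acceleration, with the fibre Hessian as linear
part; regularity thus solves it for `a`. -/
theorem elExpr_eq {Λ : E × E → ℝ} {p : E × E} (hΛ : ContDiffAt ℝ ∞ Λ p) (a k : E) :
    elExpr Λ p (p.2, a) k = fibreHess Λ p a k - elForce Λ p k := by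
  rw [elExpr, fderiv_fderiv_apply hΛ, fibreHess_apply, elForce]
  have : ((p.2, a) : E × E) = (p.2, 0) + (0, a) := by simp
  rw [this, map_add]
  simp
  ring

theorem contDiffAt_fderiv_fderiv {Λ : E × E → ℝ} {p : E × E} (hΛ : ContDiffAt ℝ ∞ Λ p) :
    ContDiffAt ℝ ∞ (fderiv ℝ (fderiv ℝ Λ)) p :=
  (hΛ.fderiv_right (m := ∞) (by simp)).fderiv_right (m := ∞) (by simp)

theorem contDiffAt_elAccel [CompleteSpace E] {Λ : E × E → ℝ} {p : E × E}
    (hΛ : ContDiffAt ℝ ∞ Λ p) (hinv : (fibreHess Λ p).IsInvertible) :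
    ContDiffAt ℝ ∞ (fun q => (fibreHess Λ q).inverse (elForce Λ q)) p := by
  have h1 : ContDiffAt ℝ ∞ (fibreHess Λ) p :=
    contDiffAt_const.clm_comp ((contDiffAt_fderiv_fderiv hΛ).clm_comp contDiffAt_const)
  have h2 : ContDiffAt ℝ ∞ (elForce Λ) p := by
    refine ((hΛ.fderiv_right (m := ∞) (by simp)).clm_comp contDiffAt_const).sub ?_
    exact ((contDiffAt_fderiv_fderiv hΛ).clm_apply
      (contDiffAt_snd.prodMk contDiffAt_const)).clm_comp contDiffAt_const
  exact ((hinv.contDiffAt_map_inverse (n := ∞)).comp p h1).clm_apply h2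

end FlatExistence

/-! ### The intrinsic fibre derivative and Hessian in natural coordinates. -/

section Hessian

variable {E : Type*} [NormedAddCommGroup E] [NormedSpace ℝ E]
  {M : Type*} [TopologicalSpace M] [ChartedSpace E M] [IsManifold 𝓘(ℝ, E) ∞ M]
  {L : TangentBundle 𝓘(ℝ, E) M → ℝ} {e : OpenPartialHomeomorph M E}

/-- The derivative of a chart, as an endomorphism of the model space. -/
def chartDeriv (e : OpenPartialHomeomorph M E) (m : M) : E →L[ℝ] E :=
  mfderiv 𝓘(ℝ, E) 𝓘(ℝ, E) e m

theorem hasFDerivAt_fibre (hL : ContMDiff 𝓘(ℝ, E).tangent 𝓘(ℝ, ℝ) ∞ L)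
    (he : IsPartialDiffeo 𝓘(ℝ, E) 𝓘(ℝ, E) e) {m : M} (hm : m ∈ e.source) (y : E) :
    HasFDerivAt (fun u : E => L ⟨m, u⟩)
      ((fderiv ℝ (L ∘ (natChart e he).symm) (e m, chartDeriv e m y)).comp
        ((ContinuousLinearMap.inr ℝ E E).comp (chartDeriv e m))) y := by
  have h1 : (fun u : E => L ⟨m, u⟩) =
      (L ∘ (natChart e he).symm) ∘ (fun u : E => (e m, chartDeriv e m u)) := by
    funext u
    exact congrArg L ((natChart e he).left_inv
      (show (⟨m, u⟩ : TangentBundle 𝓘(ℝ, E) M) ∈ (natChart e he).source from hm)).symm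
  rw [h1]
  have h2 := contDiffAt_lagrangian hL he (w := ⟨m, y⟩) hm
  have h3 : HasFDerivAt (fun u : E => (e m, chartDeriv e m u))
      ((0 : E →L[ℝ] E).prod (chartDeriv e m)) y :=
    (hasFDerivAt_const _ _).prodMk (chartDeriv e m).hasFDerivAt
  have h4 : (ContinuousLinearMap.inr ℝ E E).comp (chartDeriv e m)
      = (0 : E →L[ℝ] E).prod (chartDeriv e m) := by ext <;> simp
  rw [h4]
  exact HasFDerivAt.comp y (h2.differentiableAt (by simp)).hasFDerivAt h3

theorem fibreDeriv_eq (hL : ContMDiff 𝓘(ℝ, E).tangent 𝓘(ℝ, ℝ) ∞ L)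
    (he : IsPartialDiffeo 𝓘(ℝ, E) 𝓘(ℝ, E) e) {w : TangentBundle 𝓘(ℝ, E) M}
    (hw : w.proj ∈ e.source) (u : TangentSpace 𝓘(ℝ, E) w.proj) :
    fibreDeriv L w u = fderiv ℝ (L ∘ (natChart e he).symm) (natCoord e w)
      ((0, chartDeriv e w.proj u) : E × E) :=
  DFunLike.congr_fun (hasFDerivAt_fibre hL he hw w.2).fderiv u

/-- A chart acts on the fibre over a point by one fixed linear map, so differentiating twice along
the fibre creates no further terms. -/
theorem hessian_eq (hL : ContMDiff 𝓘(ℝ, E).tangent 𝓘(ℝ, ℝ) ∞ L)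
    (he : IsPartialDiffeo 𝓘(ℝ, E) 𝓘(ℝ, E) e) {w : TangentBundle 𝓘(ℝ, E) M}
    (hw : w.proj ∈ e.source) (u v : TangentSpace 𝓘(ℝ, E) w.proj) :
    hessian L w u v = fibreHess (L ∘ (natChart e he).symm) (natCoord e w)
      (chartDeriv e w.proj u) (chartDeriv e w.proj v) := by
  set Λ := L ∘ (natChart e he).symm
  set A := chartDeriv e w.proj
  have h1 : (fun y : E => fderiv ℝ (fun u : E => L ⟨w.proj, u⟩) y)
      = fun y => (fderiv ℝ Λ (e w.proj, A y)).comp ((ContinuousLinearMap.inr ℝ E E).comp A) := by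
    funext y
    exact (hasFDerivAt_fibre hL he hw y).fderiv
  have h2 := contDiffAt_lagrangian hL he hw
  have h3 : HasFDerivAt (fun u : E => (e w.proj, A u)) ((0 : E →L[ℝ] E).prod A) w.2 :=
    (hasFDerivAt_const _ _).prodMk A.hasFDerivAt
  have h4 : HasFDerivAt (fun y : E => fderiv ℝ Λ (e w.proj, A y)) _ w.2 :=
    HasFDerivAt.comp (g := fderiv ℝ Λ) (f := fun u : E => (e w.proj, A u)) w.2
      ((h2.fderiv_right (m := ∞) (by simp)).differentiableAt (by simp)).hasFDerivAt h3
  have h5 := h4.clm_comp (hasFDerivAt_const ((ContinuousLinearMap.inr ℝ E E).comp A) w.2)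
  have key : ∀ u v : E, fderiv ℝ (fun y : E => fderiv ℝ (fun u : E => L ⟨w.proj, u⟩) y) w.2 u v
      = fibreHess Λ (natCoord e w) (A u) (A v) := by
    intro u v
    rw [h1, h5.fderiv, fibreHess_apply]
    simp only [add_apply]
    exact (congrArg₂ (· + ·) (map_zero (fderiv ℝ Λ (e w.proj, A w.2))) rfl).trans (zero_add _)
  exact key u v

theorem chartDeriv_surjective (he : IsPartialDiffeo 𝓘(ℝ, E) 𝓘(ℝ, E) e) {m : M}
    (hm : m ∈ e.source) : Function.Surjective (chartDeriv e m) :=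
  fun k => ⟨_, he.mfderiv_symm_mfderiv hm k⟩

theorem chartDeriv_injective (he : IsPartialDiffeo 𝓘(ℝ, E) 𝓘(ℝ, E) e) {m : M}
    (hm : m ∈ e.source) : Function.Injective (chartDeriv e m) :=
  he.mfderiv_injective hm

theorem isInvertible_fibreHess [FiniteDimensional ℝ E]
    (hL : ContMDiff 𝓘(ℝ, E).tangent 𝓘(ℝ, ℝ) ∞ L) (hreg : IsRegular L)
    (he : IsPartialDiffeo 𝓘(ℝ, E) 𝓘(ℝ, E) e) {w : TangentBundle 𝓘(ℝ, E) M}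
    (hw : w.proj ∈ e.source) :
    (fibreHess (L ∘ (natChart e he).symm) (natCoord e w)).IsInvertible := by
  apply isInvertible_of_injective_dual
  intro a ha
  obtain ⟨u, rfl⟩ := chartDeriv_surjective he hw a
  have : u = 0 := by
    refine hreg w u fun v => ?_
    exact (hessian_eq hL he hw u v).trans (ha _)
  rw [this, map_zero]

end Hessian

section Existence

variable {E : Type*} [NormedAddCommGroup E] [NormedSpace ℝ E] [FiniteDimensional ℝ E]
  {M : Type*} [TopologicalSpace M] [ChartedSpace E M] [IsManifold 𝓘(ℝ, E) ∞ M]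
  {L : TangentBundle 𝓘(ℝ, E) M → ℝ} {e e' : OpenPartialHomeomorph M E}

theorem isELVector_iff_accel (hL : ContMDiff 𝓘(ℝ, E).tangent 𝓘(ℝ, ℝ) ∞ L) (hreg : IsRegular L)
    (he : IsPartialDiffeo 𝓘(ℝ, E) 𝓘(ℝ, E) e) {w : TangentBundle 𝓘(ℝ, E) M}
    (hw : w.proj ∈ e.source) (Z : TangentSpace 𝓘(ℝ, E).tangent w) :
    IsELVector L e he w Z ↔ mfderiv 𝓘(ℝ, E).tangent 𝓘(ℝ, E × E) (natCoord e) w Z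
      = ((natCoord e w).2, (fibreHess (L ∘ (natChart e he).symm) (natCoord e w)).inverse
          (elForce (L ∘ (natChart e he).symm) (natCoord e w))) := by
  have hinv := isInvertible_fibreHess hL hreg he hw
  have hΛ := contDiffAt_lagrangian hL he hw
  constructor
  · rintro ⟨a, h1, h2⟩
    have h3 : fibreHess (L ∘ (natChart e he).symm) (natCoord e w) a
        = elForce (L ∘ (natChart e he).symm) (natCoord e w) := by
      ext k
      have := h2 k
      rw [elExpr_eq hΛ] at this
      exact sub_eq_zero.1 this
    rw [h1, ← h3, hinv.inverse_apply_self]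
  · intro h
    refine ⟨_, h, fun k => ?_⟩
    rw [elExpr_eq hΛ, hinv.self_apply_inverse, sub_self]

theorem IsELVector.unique (hL : ContMDiff 𝓘(ℝ, E).tangent 𝓘(ℝ, ℝ) ∞ L) (hreg : IsRegular L)
    (he : IsPartialDiffeo 𝓘(ℝ, E) 𝓘(ℝ, E) e) {w : TangentBundle 𝓘(ℝ, E) M}
    (hw : w.proj ∈ e.source) {Z Z' : TangentSpace 𝓘(ℝ, E).tangent w}
    (h : IsELVector L e he w Z) (h' : IsELVector L e he w Z') : Z = Z' := by
  rw [isELVector_iff_accel hL hreg he hw] at h h'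
  exact (isPartialDiffeo_natChart he).mfderiv_injective (z := w) hw (h.trans h'.symm)

theorem exists_isELVector (hL : ContMDiff 𝓘(ℝ, E).tangent 𝓘(ℝ, ℝ) ∞ L) (hreg : IsRegular L)
    (he : IsPartialDiffeo 𝓘(ℝ, E) 𝓘(ℝ, E) e) {w : TangentBundle 𝓘(ℝ, E) M}
    (hw : w.proj ∈ e.source) :
    ∃ Z : TangentSpace 𝓘(ℝ, E).tangent w, IsELVector L e he w Z := by
  simp only [isELVector_iff_accel hL hreg he hw]
  exact ⟨_, (isPartialDiffeo_natChart he).mfderiv_symm_mfderiv (z := w) hw _⟩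

theorem IsEulerLagrangeField.isELVector (hL : ContMDiff 𝓘(ℝ, E).tangent 𝓘(ℝ, ℝ) ∞ L)
    {Γ : ∀ w : TangentBundle 𝓘(ℝ, E) M, TangentSpace 𝓘(ℝ, E).tangent w}
    (h : IsEulerLagrangeField L Γ) (he : IsPartialDiffeo 𝓘(ℝ, E) 𝓘(ℝ, E) e)
    {w : TangentBundle 𝓘(ℝ, E) M} (hw : w.proj ∈ e.source) : IsELVector L e he w (Γ w) :=
  (isELVector_iff hL he hw _).2 ⟨h.second_order w,
    h.euler_lagrange e (mem_maximalAtlas_of_isPartialDiffeo he) w hw⟩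

/-- The vector at `w` is defined by the preferred chart at `w.proj` alone and then satisfies the
equations in all charts. Smoothness near `w` is read off in one fixed chart, where the field is `(v,
a)` with `a` the inverse Hessian applied to the force. -/
theorem existsUnique_isEulerLagrangeField (hL : ContMDiff 𝓘(ℝ, E).tangent 𝓘(ℝ, ℝ) ∞ L)
    (hreg : IsRegular L) :
    ∃! Γ : ∀ w : TangentBundle 𝓘(ℝ, E) M, TangentSpace 𝓘(ℝ, E).tangent w,
      IsEulerLagrangeField L Γ := by
  have := FiniteDimensional.complete ℝ E
  choose Γ hΓ using fun w : TangentBundle 𝓘(ℝ, E) M =>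
    exists_isELVector hL hreg (isPartialDiffeo_chartAt w.proj) (w := w) (mem_chart_source E w.proj)
  have hΓ' : ∀ (e : OpenPartialHomeomorph M E) (he : IsPartialDiffeo 𝓘(ℝ, E) 𝓘(ℝ, E) e)
      (w : TangentBundle 𝓘(ℝ, E) M), w.proj ∈ e.source → IsELVector L e he w (Γ w) :=
    fun e he w hw => (hΓ w).change hL (isPartialDiffeo_chartAt w.proj) he
      (mem_chart_source E w.proj) hw
  refine ⟨Γ, ⟨?_, ?_, ?_⟩, ?_⟩
  · intro w
    have he := isPartialDiffeo_chartAt (F := E) w.proj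
    have hw : w.proj ∈ (chartAt E w.proj).source := mem_chart_source E w.proj
    refine (isPartialDiffeo_natChart he).contMDiffAt_vectorField (z := w) hw
      (vec := fun q => (q.2, (fibreHess (L ∘ (natChart _ he).symm) q).inverse
        (elForce (L ∘ (natChart _ he).symm) q))) ?_ ?_
    · exact contDiffAt_snd.prodMk (contDiffAt_elAccel (contDiffAt_lagrangian hL he hw)
        (isInvertible_fibreHess hL hreg he hw))
    · filter_upwards [(natChart _ he).open_source.mem_nhds (x := w) hw] with w' hw'
      exact (isELVector_iff_accel hL hreg he hw' _).1 (hΓ' _ he w' hw')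
  · intro w
    exact ((isELVector_iff hL _ (mem_chart_source E w.proj) _).1 (hΓ w)).1
  · intro e he w hw
    exact ((isELVector_iff hL (isPartialDiffeo_of_mem_maximalAtlas he) hw _).1
      (hΓ' e (isPartialDiffeo_of_mem_maximalAtlas he) w hw)).2
  · intro Γ' h'
    funext w
    exact (h'.isELVector hL (isPartialDiffeo_chartAt w.proj) (mem_chart_source E w.proj)).unique hL
      hreg _ (mem_chart_source E w.proj) (hΓ w)

end Existence

/-! ### The logarithm of a commutative Lie group -/

section InverseFunction

variable {V : Type*} [NormedAddCommGroup V] [NormedSpace ℝ V] [CompleteSpace V]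
  {W : Type*} [NormedAddCommGroup W] [NormedSpace ℝ W]

theorem isOpen_setOf_isInvertible : IsOpen {T : V →L[ℝ] W | T.IsInvertible} := by
  have h := ContinuousLinearEquiv.isOpen (𝕜 := ℝ) (E := V) (F := W)
  exact h

/-- The inverse function theorem, for smooth functions on open sets. -/
theorem exists_isPartialDiffeo_of_isInvertible_fderiv [CompleteSpace W] {f : V → W} {U : Set V}
    (hU : IsOpen U) (hf : ContDiffOn ℝ ∞ f U) {x : V} (hx : x ∈ U)
    (hinv : (fderiv ℝ f x).IsInvertible) :
    ∃ κ : OpenPartialHomeomorph V W, IsPartialDiffeo 𝓘(ℝ, V) 𝓘(ℝ, W) κ ∧ x ∈ κ.source ∧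
      κ.source ⊆ U ∧ ∀ y, κ y = f y := by
  obtain ⟨f', hf'⟩ := hinv
  have hfx : ContDiffAt ℝ ∞ f x := hf.contDiffAt (hU.mem_nhds hx)
  have hd : HasFDerivAt f (f' : V →L[ℝ] W) x := by
    rw [hf']; exact (hfx.differentiableAt (by simp)).hasFDerivAt
  let κ₀ := hfx.toOpenPartialHomeomorph f hd (by simp)
  have hκ₀ : ∀ y, κ₀ y = f y := fun y => rfl
  have hxs : x ∈ κ₀.source := hfx.mem_toOpenPartialHomeomorph_source hd (by simp)
  have hcont : ContinuousOn (fderiv ℝ f) U :=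
    (hf.continuousOn_fderiv_of_isOpen hU (by simp))
  -- The local inverse is known to be smooth at the image of `x` only. Restricting to the points
  -- where the derivative is invertible makes it smooth on its whole domain.
  have hO : IsOpen (U ∩ fderiv ℝ f ⁻¹' {T | T.IsInvertible}) :=
    hcont.isOpen_inter_preimage hU isOpen_setOf_isInvertible
  let κ := κ₀.restrOpen _ hO
  have hsrc : ∀ {y}, y ∈ κ.source ↔ y ∈ κ₀.source ∧ y ∈ U ∧ (fderiv ℝ f y).IsInvertible := Iff.rfl
  have hsymm : ∀ z, κ.symm z = κ₀.symm z := fun z => rfl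
  refine ⟨κ, ⟨?_, ?_⟩, hsrc.2 ⟨hxs, hx, ⟨f', hf'⟩⟩, fun y hy => (hsrc.1 hy).2.1, hκ₀⟩
  · rw [contMDiffOn_iff_contDiffOn]
    exact hf.mono fun y hy => (hsrc.1 hy).2.1
  · rw [contMDiffOn_iff_contDiffOn]
    intro z hz
    have hy := κ.map_target hz
    obtain ⟨h1, h2, g', hg'⟩ := hsrc.1 hy
    have hfy : ContDiffAt ℝ ∞ f (κ.symm z) := hf.contDiffAt (hU.mem_nhds h2)
    refine (κ.contDiffAt_symm hz (f₀' := g') ?_ hfy).contDiffWithinAt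
    rw [hg']
    exact (hfy.differentiableAt (by simp)).hasFDerivAt

end InverseFunction

/-! ### The logarithm of a commutative local group law. -/

section LocalLog

variable {V : Type*} [NormedAddCommGroup V] [NormedSpace ℝ V]

/-- The derivative of `m(x, y)` with respect to `y`. -/
def partialSnd (m : V × V → V) (p : V × V) : V →L[ℝ] V :=
  (fderiv ℝ m p).comp (ContinuousLinearMap.inr ℝ V V)

variable {m : V × V → V} {o : V} {U : Set (V × V)}

theorem contDiffOn_partialSnd (hU : IsOpen U) (hm : ContDiffOn ℝ ∞ m U) :
    ContDiffOn ℝ ∞ (partialSnd m) U :=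
  (hm.fderiv_of_isOpen hU (by simp)).clm_comp contDiffOn_const

theorem hasFDerivAt_right (hU : IsOpen U) (hm : ContDiffOn ℝ ∞ m U) {x y : V} (h : (x, y) ∈ U) :
    HasFDerivAt (fun y => m (x, y)) (partialSnd m (x, y)) y := by
  have h1 : HasFDerivAt m (fderiv ℝ m (x, y)) (x, y) :=
    ((hm.contDiffAt (hU.mem_nhds h)).differentiableAt (by simp)).hasFDerivAt
  exact h1.comp y ((hasFDerivAt_prodMk_right x y))

/-- Differentiate `m (m (x, y), z) = m (x, m (y, z))` with respect to `z` at the neutral element.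
With `A x = partialSnd m (x, o)`, whose columns are the left-invariant fields, the result is `A (m
(x, y)) = partialSnd m (x, y) ∘ A y`, the left invariance of the frame. -/
theorem eventually_partialSnd_mul (hU : IsOpen U) (hm : ContDiffOn ℝ ∞ m U) (ho : (o, o) ∈ U)
    (hr : ∀ᶠ x in 𝓝 o, m (x, o) = x)
    (hassoc : ∀ᶠ q : V × V × V in 𝓝 (o, o, o),
      m (m (q.1, q.2.1), q.2.2) = m (q.1, m (q.2.1, q.2.2))) :
    ∀ᶠ p : V × V in 𝓝 (o, o), partialSnd m (m p, o)
      = (partialSnd m p).comp (partialSnd m (p.2, o)) := by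
  have hmc : ContinuousAt m (o, o) := (hm.contDiffAt (hU.mem_nhds ho)).continuousAt
  have hmo : m (o, o) = o := hr.self_of_nhds
  have t1 : Tendsto (fun p : V × V => (p.1, p.2, o)) (𝓝 (o, o)) (𝓝 (o, o, o)) :=
    Continuous.tendsto' (by fun_prop) _ _ rfl
  have t2 : Tendsto (fun p : V × V => (m p, o)) (𝓝 (o, o)) (𝓝 (o, o)) := by
    have := hmc.tendsto
    rw [hmo] at this
    exact this.prodMk_nhds tendsto_const_nhds
  have t3 : Tendsto (fun p : V × V => (p.2, o)) (𝓝 (o, o)) (𝓝 (o, o)) :=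
    Continuous.tendsto' (by fun_prop) _ _ rfl
  have t4 : Tendsto (fun p : V × V => p.2) (𝓝 (o, o)) (𝓝 o) :=
    Continuous.tendsto' (by fun_prop) _ _ rfl
  have hUo := hU.mem_nhds ho
  filter_upwards [t1.eventually hassoc.eventually_nhds, t2 hUo, t3 hUo, t4.eventually hr, hUo]
    with p h1 h2 h3 h4 h5
  have h6 : ∀ᶠ z in 𝓝 o, m (m p, z) = m (p.1, m (p.2, z)) := by
    have : Tendsto (fun z => (p.1, p.2, z)) (𝓝 o) (𝓝 (p.1, p.2, o)) :=
      Continuous.tendsto' (by fun_prop) _ _ rfl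
    exact this.eventually h1
  have h7 := hasFDerivAt_right hU hm h2
  have h8 := hasFDerivAt_right hU hm h3
  have h9 : HasFDerivAt (fun y => m (p.1, y)) (partialSnd m p) (m (p.2, o)) := by
    rw [h4]; exact hasFDerivAt_right hU hm h5
  have h10 : HasFDerivAt (fun z => m (m p, z)) _ o :=
    (HasFDerivAt.comp (g := fun y => m (p.1, y)) (f := fun z => m (p.2, z)) o h9
      h8).congr_of_eventuallyEq h6
  exact h7.unique h10

theorem fderiv_partialSnd_apply (hU : IsOpen U) (hm : ContDiffOn ℝ ∞ m U) {p : V × V} (hp : p ∈ U)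
    (u : V × V) (c : V) : fderiv ℝ (partialSnd m) p u c = fderiv ℝ (fderiv ℝ m) p u (0, c) := by
  have h2 : HasFDerivAt (fderiv ℝ m) (fderiv ℝ (fderiv ℝ m) p) p :=
    (((hm.contDiffAt (hU.mem_nhds hp)).fderiv_right (m := ∞) (by simp)).differentiableAt
      (by simp)).hasFDerivAt
  have h3 := h2.clm_comp (hasFDerivAt_const (ContinuousLinearMap.inr ℝ V V) p)
  have h4 : fderiv ℝ (partialSnd m) p = _ := h3.fderiv
  rw [h4]
  simp

/-- The antisymmetric part of this mixed derivative is the Lie bracket of the group law, and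
comparing `m` with `m ∘ Prod.swap` shows that it vanishes. Commutativity enters the construction of
the logarithm only here. -/
theorem fderiv_fderiv_swap (hU : IsOpen U) (hm : ContDiffOn ℝ ∞ m U) (ho : (o, o) ∈ U)
    (hcomm : ∀ᶠ p : V × V in 𝓝 (o, o), m p.swap = m p) (b c : V) :
    fderiv ℝ (fderiv ℝ m) (o, o) (b, 0) (0, c) = fderiv ℝ (fderiv ℝ m) (o, o) (c, 0) (0, b) := by
  have hmo := hm.contDiffAt (hU.mem_nhds ho)
  let S : V × V →L[ℝ] V × V := (ContinuousLinearEquiv.prodComm ℝ V V : V × V →L[ℝ] V × V)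
  have hS : ∀ p, S p = p.swap := fun p => rfl
  have tS : Tendsto S (𝓝 (o, o)) (𝓝 (o, o)) := S.continuous.tendsto' _ _ rfl
  have h1 : ∀ᶠ p in 𝓝 (o, o), fderiv ℝ m p = (fderiv ℝ m (S p)).comp S := by
    filter_upwards [hcomm.eventually_nhds, tS (hU.mem_nhds ho)] with p hp hpU
    have h2 : m =ᶠ[𝓝 p] m ∘ S := by
      filter_upwards [hp] with q hq using hq.symm
    rw [h2.fderiv_eq, fderiv_comp p ((hm.contDiffAt (hU.mem_nhds hpU)).differentiableAt (by simp))
      S.differentiableAt, S.fderiv]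
  have h2 : HasFDerivAt (fderiv ℝ m) (fderiv ℝ (fderiv ℝ m) (o, o)) (S (o, o)) :=
    ((hmo.fderiv_right (m := ∞) (by simp)).differentiableAt (by simp)).hasFDerivAt
  have h3 := (h2.comp (o, o) S.hasFDerivAt).clm_comp (hasFDerivAt_const S (o, o))
  have h4 : fderiv ℝ (fderiv ℝ m) (o, o) = _ := (Filter.EventuallyEq.fderiv_eq h1).trans h3.fderiv
  have h5 := congrArg (fun T => T (b, 0) (0, c)) h4
  rw [fderiv_fderiv_symm hmo (c, 0) (0, b)]
  simpa [hS] using h5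

/-- In other words, the left-invariant fields `x ↦ A x b` and `x ↦ A x c` commute. Differentiating
the left invariance of the frame in `y` at `o` in direction `b` and applying it to `c` gives `D²m
(x, o) (0, b) (0, c)` plus `A x` applied to the mixed derivative at `(o, o)`: the first term is
symmetric as a second derivative, the other by commutativity. -/
theorem fderiv_partialSnd_symm (hU : IsOpen U) (hm : ContDiffOn ℝ ∞ m U) (ho : (o, o) ∈ U)
    (hr : ∀ᶠ x in 𝓝 o, m (x, o) = x) (hl : ∀ᶠ x in 𝓝 o, m (o, x) = x)
    (hcomm : ∀ᶠ p : V × V in 𝓝 (o, o), m p.swap = m p)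
    (hassoc : ∀ᶠ q : V × V × V in 𝓝 (o, o, o),
      m (m (q.1, q.2.1), q.2.2) = m (q.1, m (q.2.1, q.2.2))) :
    ∀ᶠ x in 𝓝 o, ∀ b c : V,
      fderiv ℝ (fun x => partialSnd m (x, o)) x (partialSnd m (x, o) b) c
        = fderiv ℝ (fun x => partialSnd m (x, o)) x (partialSnd m (x, o) c) b := by
  have hA1 : partialSnd m (o, o) = ContinuousLinearMap.id ℝ V := by
    have h1 := hasFDerivAt_right hU hm ho
    exact h1.unique ((hasFDerivAt_id o).congr_of_eventuallyEq hl)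
  have t1 : Tendsto (fun x : V => (x, o)) (𝓝 o) (𝓝 (o, o)) :=
    Continuous.tendsto' (by fun_prop) _ _ rfl
  have hD : ∀ p ∈ U, HasFDerivAt (partialSnd m) (fderiv ℝ (partialSnd m) p) p := fun p hp =>
    (((contDiffOn_partialSnd hU hm).contDiffAt (hU.mem_nhds hp)).differentiableAt
      (by simp)).hasFDerivAt
  have hA : ∀ x, (x, o) ∈ U → HasFDerivAt (fun x => partialSnd m (x, o))
      ((fderiv ℝ (partialSnd m) (x, o)).comp (ContinuousLinearMap.inl ℝ V V)) x := fun x hx =>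
    HasFDerivAt.comp (g := partialSnd m) (f := fun x => (x, o)) x (hD _ hx)
      (hasFDerivAt_prodMk_left x o)
  have hUo := hU.mem_nhds ho
  filter_upwards [t1.eventually
    (eventually_partialSnd_mul hU hm ho hr hassoc).eventually_nhds, t1 hUo, hr] with x h1 hx hrx
  have key : ∀ b c : V, fderiv ℝ (fun x => partialSnd m (x, o)) x (partialSnd m (x, o) b) c
      = fderiv ℝ (fderiv ℝ m) (x, o) (0, b) (0, c)
        + partialSnd m (x, o) (fderiv ℝ (fderiv ℝ m) (o, o) (b, 0) (0, c)) := by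
    intro b c
    have h2 : ∀ᶠ y in 𝓝 o, partialSnd m (m (x, y), o)
        = (partialSnd m (x, y)).comp (partialSnd m (y, o)) := by
      have : Tendsto (fun y => (x, y)) (𝓝 o) (𝓝 (x, o)) :=
        Continuous.tendsto' (by fun_prop) _ _ rfl
      exact this.eventually h1
    have h3 : HasFDerivAt (fun x => partialSnd m (x, o))
        ((fderiv ℝ (partialSnd m) (x, o)).comp (ContinuousLinearMap.inl ℝ V V)) (m (x, o)) := by
      rw [hrx]; exact hA x hx
    have h4 := HasFDerivAt.comp (g := fun x => partialSnd m (x, o)) (f := fun y => m (x, y)) o h3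
      (hasFDerivAt_right hU hm hx)
    have h5 := (HasFDerivAt.comp (g := partialSnd m) (f := fun y => (x, y)) o (hD _ hx)
      (hasFDerivAt_prodMk_right x o)).clm_comp (hA o ho)
    have h6 := h4.unique (h5.congr_of_eventuallyEq h2)
    have h7 := congrArg (fun T => T b c) h6
    rw [(hA x hx).fderiv]
    simp only [ContinuousLinearMap.comp_apply] at h7 ⊢
    rw [h7]
    simp [hA1, fderiv_partialSnd_apply hU hm hx, fderiv_partialSnd_apply hU hm ho]
    abel
  intro b c
  rw [key, key, fderiv_fderiv_swap hU hm ho hcomm b c,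
    fderiv_fderiv_symm (hm.contDiffAt (hU.mem_nhds hx)) (0, b) (0, c)]

/-- A commutative local group law is, near its neutral element, isomorphic to the addition of
vectors. -/
theorem exists_local_log [CompleteSpace V] (hU : IsOpen U) (hm : ContDiffOn ℝ ∞ m U)
    (ho : (o, o) ∈ U)
    (hr : ∀ᶠ x in 𝓝 o, m (x, o) = x) (hl : ∀ᶠ x in 𝓝 o, m (o, x) = x)
    (hcomm : ∀ᶠ p : V × V in 𝓝 (o, o), m p.swap = m p)
    (hassoc : ∀ᶠ q : V × V × V in 𝓝 (o, o, o),
      m (m (q.1, q.2.1), q.2.2) = m (q.1, m (q.2.1, q.2.2))) :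
    ∃ (f : V → V) (S : Set V), IsOpen S ∧ o ∈ S ∧ ContDiffOn ℝ ∞ f S ∧ f o = 0 ∧
      HasFDerivAt f (ContinuousLinearMap.id ℝ V) o ∧
      ∀ᶠ p : V × V in 𝓝 (o, o), f (m p) = f p.1 + f p.2 := by
  set A : V → V →L[ℝ] V := fun x => partialSnd m (x, o) with hAdef
  have hA1 : A o = ContinuousLinearMap.id ℝ V :=
    (hasFDerivAt_right hU hm ho).unique ((hasFDerivAt_id o).congr_of_eventuallyEq hl)
  have hU1 : IsOpen {x : V | (x, o) ∈ U} := hU.preimage (by fun_prop)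
  have hAs : ContDiffOn ℝ ∞ A {x : V | (x, o) ∈ U} :=
    (contDiffOn_partialSnd hU hm).comp (contDiff_prodMk_left o).contDiffOn fun x hx => hx
  set U2 := {x : V | (x, o) ∈ U} ∩ A ⁻¹' {T | T.IsInvertible} with hU2def
  have hU2 : IsOpen U2 := hAs.continuousOn.isOpen_inter_preimage hU1 isOpen_setOf_isInvertible
  have hoU2 : o ∈ U2 := by
    refine ⟨ho, ?_⟩
    show (A o).IsInvertible
    rw [hA1]
    exact ⟨ContinuousLinearEquiv.refl ℝ V, rfl⟩
  -- `θ` is the Maurer-Cartan form, dual to the frame `A`; the logarithm will be a primitive of it.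
  set θ : V → V →L[ℝ] V := fun x => (A x).inverse with hθdef
  have hθs : ContDiffOn ℝ ∞ θ U2 := fun x hx =>
    ((ContinuousLinearMap.IsInvertible.contDiffAt_map_inverse (n := ∞) hx.2).comp x
      (hAs.contDiffAt (hU1.mem_nhds hx.1))).contDiffWithinAt
  have hclosed := fderiv_partialSnd_symm hU hm ho hr hl hcomm hassoc
  have hmul := eventually_partialSnd_mul hU hm ho hr hassoc
  have hmo : m (o, o) = o := hr.self_of_nhds
  -- a ball on which the form is closed
  obtain ⟨r, hr0, hball⟩ := Metric.eventually_nhds_iff_ball.1 (hclosed.and (hU2.mem_nhds hoU2))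
  have hθclosed : ∀ x ∈ Metric.ball o r, ∀ b c, fderiv ℝ θ x b c = fderiv ℝ θ x c b := by
    intro x hx b c
    obtain ⟨h1, h2⟩ := hball x hx
    have hinv : (A x).IsInvertible := h2.2
    have hAd : HasFDerivAt A (fderiv ℝ A x) x :=
      ((hAs.contDiffAt (hU1.mem_nhds h2.1)).differentiableAt (by simp)).hasFDerivAt
    have hθd : HasFDerivAt θ (fderiv ℝ θ x) x :=
      ((hθs.contDiffAt (hU2.mem_nhds h2)).differentiableAt (by simp)).hasFDerivAt
    have h3 := hθd.clm_comp hAd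
    -- Differentiating `θ ∘ A = id` converts the commutation of the frame into closedness of the
    -- dual form.
    have h4 : (fun x => (θ x).comp (A x)) =ᶠ[𝓝 x] fun _ => ContinuousLinearMap.id ℝ V := by
      filter_upwards [hU2.mem_nhds h2] with y hy
      exact ContinuousLinearMap.IsInvertible.inverse_comp_self hy.2
    have h5 := h3.unique ((hasFDerivAt_const _ x).congr_of_eventuallyEq h4)
    have h6 : ∀ b c, fderiv ℝ θ x (A x b) (A x c) = - θ x (fderiv ℝ A x (A x b) c) := by
      intro b c
      have := congrArg (fun T => T (A x b) c) h5
      simp at this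
      rw [← add_eq_zero_iff_eq_neg, add_comm]
      exact this
    rw [← hinv.self_apply_inverse b, ← hinv.self_apply_inverse c, h6, h6]
    exact congrArg (fun z => - θ x z) (h1 _ _)
  -- Poincaré's lemma: a closed form on a convex open set has a primitive.
  obtain ⟨f₀, hf₀⟩ := (convex_ball o r).exists_forall_hasFDerivAt_of_fderiv_symmetric
    Metric.isOpen_ball ((hθs.mono fun x hx => (hball x hx).2).differentiableOn (by simp)) hθclosed
  have hf : ∀ a ∈ Metric.ball o r, HasFDerivAt (fun x => f₀ x - f₀ o) (θ a) a :=
    fun a ha => (hf₀ a ha).sub_const _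
  refine ⟨fun x => f₀ x - f₀ o, Metric.ball o r, Metric.isOpen_ball, Metric.mem_ball_self hr0, ?_,
    sub_self _, ?_, ?_⟩
  · rw [contDiffOn_infty_iff_fderiv_of_isOpen Metric.isOpen_ball]
    refine ⟨fun a ha => (hf a ha).differentiableAt.differentiableWithinAt, ?_⟩
    exact (hθs.mono fun x hx => (hball x hx).2).congr fun a ha => (hf a ha).fderiv
  · have := hf o (Metric.mem_ball_self hr0)
    have h2 : θ o = ContinuousLinearMap.id ℝ V := by
      show (A o).inverse = _
      rw [hA1, ContinuousLinearMap.inverse_id]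
    rwa [h2] at this
  · have hmc : ContinuousAt m (o, o) := (hm.contDiffAt (hU.mem_nhds ho)).continuousAt
    have tm : Tendsto m (𝓝 (o, o)) (𝓝 o) := by simpa [hmo] using hmc.tendsto
    have hev : ∀ᶠ p : V × V in 𝓝 (o, o), partialSnd m (m p, o)
        = (partialSnd m p).comp (partialSnd m (p.2, o)) ∧ p ∈ U ∧ m p ∈ Metric.ball o r ∧
          p.2 ∈ Metric.ball o r ∧ m (p.1, o) = p.1 := by
      have hUm : ∀ᶠ p in 𝓝 (o, o), p ∈ U := hU.mem_nhds ho
      have hmb : ∀ᶠ p in 𝓝 (o, o), m p ∈ Metric.ball o r := tm (Metric.ball_mem_nhds o hr0)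
      refine hmul.and (hUm.and (hmb.and ?_))
      have t4 : Tendsto (fun p : V × V => p.2) (𝓝 (o, o)) (𝓝 o) :=
        Continuous.tendsto' (by fun_prop) _ _ rfl
      have t5 : Tendsto (fun p : V × V => p.1) (𝓝 (o, o)) (𝓝 o) :=
        Continuous.tendsto' (by fun_prop) _ _ rfl
      exact (t4.eventually (Metric.ball_mem_nhds o hr0)).and (t5.eventually hr)
    obtain ⟨δ, hδ, hδb⟩ := Metric.eventually_nhds_iff_ball.1 hev
    rw [← ball_prod_same] at hδb
    have hmem : Metric.ball o δ ×ˢ Metric.ball o δ ∈ 𝓝 (o, o) :=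
      prod_mem_nhds (Metric.ball_mem_nhds o hδ) (Metric.ball_mem_nhds o hδ)
    filter_upwards [hmem] with p hp
    obtain ⟨x, y⟩ := p
    obtain ⟨hx, hy⟩ : x ∈ Metric.ball o δ ∧ y ∈ Metric.ball o δ := hp
    -- For fixed `x`, the pullback of `θ` under `z ↦ m (x, z)` is `θ` by left invariance. So `f₀ (m
    -- (x, z)) - f₀ z` is constant in `z`, and `z = o` gives its value.
    have hd : ∀ z ∈ Metric.ball o δ,
        HasFDerivAt (fun z => f₀ (m (x, z)) - f₀ z) (0 : V →L[ℝ] V) z := by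
      intro z hz
      obtain ⟨h1, h2, h3, h4, -⟩ := hδb (x, z) ⟨hx, hz⟩
      have h5 := (HasFDerivAt.comp (g := f₀) (f := fun z => m (x, z)) z (hf₀ _ h3)
        (hasFDerivAt_right hU hm h2)).sub (hf₀ z h4)
      have h6 : (θ (m (x, z))).comp (partialSnd m (x, z)) = θ z := by
        have i1 : (A (m (x, z))).IsInvertible := (hball _ h3).2.2
        have i2 : (A z).IsInvertible := (hball _ h4).2.2
        have h7 : (θ (m (x, z))).comp (A (m (x, z))) = ContinuousLinearMap.id ℝ V :=
          i1.inverse_comp_self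
        have h8 : A (m (x, z)) = (partialSnd m (x, z)).comp (A z) := h1
        rw [h8, ← ContinuousLinearMap.comp_assoc] at h7
        have h9 := congrArg (fun T => T.comp (θ z)) h7
        simp only [ContinuousLinearMap.comp_assoc] at h9
        have h10 : (A z).comp (θ z) = ContinuousLinearMap.id ℝ V := i2.self_comp_inverse
        rw [h10] at h9
        simpa using h9
      rw [h6, sub_self] at h5
      exact h5
    have hconst := Metric.isOpen_ball.is_const_of_fderiv_eq_zero (𝕜 := ℝ)
      (convex_ball o δ).isPreconnected
      (fun z hz => (hd z hz).differentiableAt.differentiableWithinAt)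
      (fun z hz => (hd z hz).fderiv) hy (Metric.mem_ball_self hδ)
    obtain ⟨-, -, -, -, h1⟩ := hδb (x, o) ⟨hx, Metric.mem_ball_self hδ⟩
    simp only [h1] at hconst
    simp only
    rw [sub_eq_iff_eq_add] at hconst
    rw [hconst]
    abel

end LocalLog

section LieGroupLog

variable {EG : Type*} [NormedAddCommGroup EG] [NormedSpace ℝ EG] [FiniteDimensional ℝ EG]
  {G : Type*} [TopologicalSpace G] [ChartedSpace EG G] [CommGroup G] [LieGroup 𝓘(ℝ, EG) ∞ G]

/-- A logarithm on a neighbourhood of the identity of a commutative Lie group. -/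
structure IsLog (lam : OpenPartialHomeomorph G EG) : Prop where
  diffeo : IsPartialDiffeo 𝓘(ℝ, EG) 𝓘(ℝ, EG) lam
  one_mem : 1 ∈ lam.source
  map_one : lam 1 = 0
  deriv_one : ∀ ξ : GroupLieAlgebra 𝓘(ℝ, EG) G, mfderiv 𝓘(ℝ, EG) 𝓘(ℝ, EG) lam 1 ξ = ξ
  map_mul : ∀ k ∈ lam.source, ∀ᶠ p : G × G in 𝓝 (1, k), lam (p.1 * p.2) = lam p.1 + lam p.2

/-- The group law read in the chart at the identity is a commutative local group law; its logarithm
is composed with that chart. -/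
theorem exists_isLog : ∃ lam : OpenPartialHomeomorph G EG, IsLog lam := by
  have := FiniteDimensional.complete ℝ EG
  have hGc : IsTopologicalGroup G := topologicalGroup_of_lieGroup 𝓘(ℝ, EG) ∞
  set c := chartAt EG (1 : G) with hc
  have hcd : IsPartialDiffeo 𝓘(ℝ, EG) 𝓘(ℝ, EG) c := isPartialDiffeo_chartAt 1
  have h1 : (1 : G) ∈ c.source := mem_chart_source EG 1
  set o := c 1 with hodef
  have hco : c.symm o = 1 := c.left_inv h1
  have hot : o ∈ c.target := c.map_source h1
  set m : EG × EG → EG := fun p => c (c.symm p.1 * c.symm p.2) with hm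
  have hmulc : ContinuousOn (fun p : EG × EG => c.symm p.1 * c.symm p.2) (c.target ×ˢ c.target) :=
    (c.symm.continuousOn.comp continuousOn_fst fun p hp => hp.1).mul
      (c.symm.continuousOn.comp continuousOn_snd fun p hp => hp.2)
  set U : Set (EG × EG) := (c.target ×ˢ c.target) ∩
    (fun p : EG × EG => c.symm p.1 * c.symm p.2) ⁻¹' c.source with hUdef
  have hU : IsOpen U :=
    hmulc.isOpen_inter_preimage (c.open_target.prod c.open_target) c.open_source
  have ho : (o, o) ∈ U := ⟨⟨hot, hot⟩, by simp [hco, h1]⟩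
  have hms : ContDiffOn ℝ ∞ m U := by
    rw [← contMDiffOn_iff_contDiffOn]
    intro p hp
    have s1 : ContMDiffAt 𝓘(ℝ, EG × EG) 𝓘(ℝ, EG) ∞ (fun p : EG × EG => c.symm p.1) p :=
      ContMDiffAt.comp p (hcd.contMDiffAt_symm hp.1.1) contDiff_fst.contMDiff.contMDiffAt
    have s2 : ContMDiffAt 𝓘(ℝ, EG × EG) 𝓘(ℝ, EG) ∞ (fun p : EG × EG => c.symm p.2) p :=
      ContMDiffAt.comp p (hcd.contMDiffAt_symm hp.1.2) contDiff_snd.contMDiff.contMDiffAt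
    exact (ContMDiffAt.comp (g := c) p (hcd.contMDiffAt hp.2) (s1.mul s2)).contMDiffWithinAt
  have ht : ∀ᶠ x in 𝓝 o, x ∈ c.target := c.open_target.mem_nhds hot
  have hsymm : Tendsto c.symm (𝓝 o) (𝓝 1) := c.tendsto_symm h1
  have hsrc : ∀ᶠ g in 𝓝 (1 : G), g ∈ c.source := c.open_source.mem_nhds h1
  have hr : ∀ᶠ x in 𝓝 o, m (x, o) = x := by
    filter_upwards [ht] with x hx
    simp [hm, hco, c.right_inv hx]
  have hl : ∀ᶠ x in 𝓝 o, m (o, x) = x := by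
    filter_upwards [ht] with x hx
    simp [hm, hco, c.right_inv hx]
  have hcomm : ∀ᶠ p : EG × EG in 𝓝 (o, o), m p.swap = m p :=
    Eventually.of_forall fun p => congrArg c (mul_comm _ _)
  have hassoc : ∀ᶠ q : EG × EG × EG in 𝓝 (o, o, o),
      m (m (q.1, q.2.1), q.2.2) = m (q.1, m (q.2.1, q.2.2)) := by
    have t1 : Tendsto (fun q : EG × EG × EG => c.symm q.1) (𝓝 (o, o, o)) (𝓝 1) :=
      hsymm.comp (Continuous.tendsto' (by fun_prop) _ _ rfl)
    have t2 : Tendsto (fun q : EG × EG × EG => c.symm q.2.1) (𝓝 (o, o, o)) (𝓝 1) :=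
      hsymm.comp (Continuous.tendsto' (by fun_prop) _ _ rfl)
    have t3 : Tendsto (fun q : EG × EG × EG => c.symm q.2.2) (𝓝 (o, o, o)) (𝓝 1) :=
      hsymm.comp (Continuous.tendsto' (by fun_prop) _ _ rfl)
    have t12 := t1.mul t2
    have t23 := t2.mul t3
    rw [mul_one] at t12 t23
    filter_upwards [t12.eventually hsrc, t23.eventually hsrc] with q h12 h23
    simp only [hm]
    rw [c.left_inv h12, c.left_inv h23, mul_assoc]
  obtain ⟨f, S, hS, hoS, hfs, hf0, hfd, hfm⟩ := exists_local_log hU hms ho hr hl hcomm hassoc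
  obtain ⟨κ, hκ, hoκ, hκS, hκf⟩ := exists_isPartialDiffeo_of_isInvertible_fderiv hS hfs hoS
    (by rw [hfd.fderiv]; exact ⟨ContinuousLinearEquiv.refl ℝ EG, rfl⟩)
  let lam₀ := c.trans κ
  have hlam₀ : ∀ g, lam₀ g = f (c g) := fun g => hκf _
  have h1s : (1 : G) ∈ lam₀.source := ⟨h1, hoκ⟩
  have hmul : ∀ᶠ p : G × G in 𝓝 (1, 1), lam₀ (p.1 * p.2) = lam₀ p.1 + lam₀ p.2 := by
    have t1 : Tendsto (fun p : G × G => p.1) (𝓝 (1, 1)) (𝓝 1) :=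
      Continuous.tendsto' (by fun_prop) _ _ rfl
    have t2 : Tendsto (fun p : G × G => p.2) (𝓝 (1, 1)) (𝓝 1) :=
      Continuous.tendsto' (by fun_prop) _ _ rfl
    have tc : Tendsto c (𝓝 1) (𝓝 o) := (c.continuousAt h1)
    have t3 : Tendsto (fun p : G × G => (c p.1, c p.2)) (𝓝 (1, 1)) (𝓝 (o, o)) :=
      (tc.comp t1).prodMk_nhds (tc.comp t2)
    filter_upwards [t3.eventually hfm, t1.eventually hsrc, t2.eventually hsrc] with p h3 h4 h5
    rw [hlam₀, hlam₀, hlam₀, ← h3]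
    simp only [hm]
    rw [c.left_inv h4, c.left_inv h5]
  -- Additivity holds near `(1, 1)`, but `IsLog` asks for it near `(1, k)` for every `k` in the
  -- domain. An eventual property near `(1, 1)` is eventual near `(1, k)` for all `k` close to `1`,
  -- so the domain is cut down to the interior of `P`.
  let P : Set G := {k | ∀ᶠ p : G × G in 𝓝 (1, k), lam₀ (p.1 * p.2) = lam₀ p.1 + lam₀ p.2}
  have hP : P ∈ 𝓝 (1 : G) := by
    have t1 : Tendsto (fun k : G => ((1, k) : G × G)) (𝓝 1) (𝓝 (1, 1)) :=
      Continuous.tendsto' (by fun_prop) _ _ rfl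
    exact t1.eventually hmul.eventually_nhds
  refine ⟨lam₀.restrOpen (interior P) isOpen_interior, ?_, ⟨h1s, mem_interior_iff_mem_nhds.2 hP⟩,
    ?_, ?_, ?_⟩
  · exact (hcd.trans hκ).restrOpen _ _
  · exact (hlam₀ 1).trans hf0
  · intro ξ
    have e1 : mfderiv 𝓘(ℝ, EG) 𝓘(ℝ, EG) (f ∘ c) 1 = _ :=
      mfderiv_comp (1 : G) (mdifferentiableAt_iff_differentiableAt.2 hfd.differentiableAt)
        (hcd.mdifferentiableAt h1)
    have e2 : (⇑(lam₀.restrOpen (interior P) isOpen_interior) : G → EG) = f ∘ c := funext hlam₀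
    -- Tangent spaces are trivialised by the preferred chart, whose derivative at its own centre is
    -- therefore the identity. This gives the normalisation of the derivative of `lam` at `1`.
    have e3 : mfderiv 𝓘(ℝ, EG) 𝓘(ℝ, EG) c 1 = ContinuousLinearMap.id ℝ _ :=
      mfderiv_extChartAt_self
    rw [e2, e1, e3, mfderiv_eq_fderiv, hfd.fderiv]
    rfl
  · intro k hk
    have hk' : k ∈ P := interior_subset hk.2
    exact hk'

end LieGroupLog

/-! ### Charts adapted to a principal bundle -/

section ProdDiffeo

variable {F : Type*} [NormedAddCommGroup F] [NormedSpace ℝ F]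
  {N : Type*} [TopologicalSpace N] [ChartedSpace F N]
  {F' : Type*} [NormedAddCommGroup F'] [NormedSpace ℝ F']
  {N' : Type*} [TopologicalSpace N'] [ChartedSpace F' N']
  {V : Type*} [NormedAddCommGroup V] [NormedSpace ℝ V]
  {V' : Type*} [NormedAddCommGroup V'] [NormedSpace ℝ V']

theorem IsPartialDiffeo.prod {κ : OpenPartialHomeomorph N V} {κ' : OpenPartialHomeomorph N' V'}
    (h : IsPartialDiffeo 𝓘(ℝ, F) 𝓘(ℝ, V) κ) (h' : IsPartialDiffeo 𝓘(ℝ, F') 𝓘(ℝ, V') κ') :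
    IsPartialDiffeo (𝓘(ℝ, F).prod 𝓘(ℝ, F')) 𝓘(ℝ, V × V') (κ.prod κ') := by
  constructor
  · exact (h.smooth.comp contMDiffOn_fst (fun p hp => hp.1)).prodMk_space
      (h'.smooth.comp contMDiffOn_snd (fun p hp => hp.2))
  · exact (h.smooth_symm.comp contDiff_fst.contMDiff.contMDiffOn (fun p hp => hp.1)).prodMk
      (h'.smooth_symm.comp contDiff_snd.contMDiff.contMDiffOn (fun p hp => hp.2))

end ProdDiffeo

section Adapted

variable {E : Type*} [NormedAddCommGroup E] [NormedSpace ℝ E]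
  {EG : Type*} [NormedAddCommGroup EG] [NormedSpace ℝ EG] {n : ℕ}
  {M : Type*} [TopologicalSpace M] [ChartedSpace E M]
  {G : Type*} [TopologicalSpace G] [ChartedSpace EG G] [CommGroup G] [MulAction G M]
  [ChartedSpace (EuclideanSpace ℝ (Fin n)) (MulAction.orbitRel.Quotient G M)]

theorem orbitProj_smul (g : G) (m : M) : orbitProj M G (g • m) = orbitProj M G m :=
  Quotient.sound (MulAction.orbitRel_apply.2 ⟨g, rfl⟩)

theorem exists_smul_eq_of_orbitProj_eq {m m' : M} (h : orbitProj M G m = orbitProj M G m') :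
    ∃ g : G, g • m' = m :=
  MulAction.orbitRel_apply.1 (Quotient.exact h)

theorem contMDiff_orbitProj (hbundle : IsPrincipalBundle E EG n M G) :
    ContMDiff 𝓘(ℝ, E) (𝓡 n) ∞ (orbitProj M G) := by
  intro m
  obtain ⟨U, Ψ, hxU, -, hΨs, hΨt, -, hΨ', hπ, -⟩ := hbundle (orbitProj M G m)
  have hm : m ∈ Ψ.target := by rw [hΨt]; exact hxU
  have h1 : ContMDiffAt 𝓘(ℝ, E) (𝓡 n) ∞ (Prod.fst ∘ Ψ.symm) m :=
    ContMDiffAt.comp m contMDiffAt_fst (hΨ'.contMDiffAt (Ψ.open_target.mem_nhds hm))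
  refine h1.congr_of_eventuallyEq ?_
  filter_upwards [Ψ.open_target.mem_nhds hm] with m' hm'
  have hs := Ψ.map_target hm'
  have h2 := Ψ.right_inv hm'
  rw [hΨs] at hs
  have h3 := hπ _ hs.1 (Ψ.symm m').2
  rw [Prod.mk.eta, h2] at h3
  exact h3

/-- `e` is a chart of `M` adapted to the chart `eB` of `M / G` and the logarithm `lam` of `G`:
in terms of the decomposition `K` of the model space, the projection is the projection on the
first factor and `G` acts by translations in the second factor. -/
structure IsAdapted (lam : OpenPartialHomeomorph G EG)
    (eB : OpenPartialHomeomorph (MulAction.orbitRel.Quotient G M) (EuclideanSpace ℝ (Fin n)))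
    (e : OpenPartialHomeomorph M E) (K : E ≃L[ℝ] EuclideanSpace ℝ (Fin n) × EG) : Prop where
  diffeo : IsPartialDiffeo 𝓘(ℝ, E) 𝓘(ℝ, E) e
  proj_mem : ∀ m ∈ e.source, orbitProj M G m ∈ eB.source
  proj_eq : ∀ m ∈ e.source, (K (e m)).1 = eB (orbitProj M G m)
  act : ∀ m ∈ e.source, ∀ᶠ p : G × M in 𝓝 (1, m), e (p.1 • p.2) = e p.2 + K.symm (0, lam p.1)

variable [LieGroup 𝓘(ℝ, EG) ∞ G]

/-- A local trivialisation of the bundle is followed by `eB` on the base and by the logarithm on the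
group factor, which turns the left multiplication on that factor into a translation. -/
theorem exists_isAdapted (hbundle : IsPrincipalBundle E EG n M G)
    {lam : OpenPartialHomeomorph G EG} (hlam : IsLog lam)
    {eB : OpenPartialHomeomorph (MulAction.orbitRel.Quotient G M) (EuclideanSpace ℝ (Fin n))}
    (heB : IsPartialDiffeo (𝓡 n) (𝓡 n) eB) {m : M} (hm : orbitProj M G m ∈ eB.source) :
    ∃ (e : OpenPartialHomeomorph M E) (K : E ≃L[ℝ] EuclideanSpace ℝ (Fin n) × EG),
      IsAdapted lam eB e K ∧ m ∈ e.source := by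
  have hGc : IsTopologicalGroup G := topologicalGroup_of_lieGroup 𝓘(ℝ, EG) ∞
  obtain ⟨U, Ψ, hxU, hU, hΨs, hΨt, hΨ, hΨ', hπ, hact⟩ := hbundle (orbitProj M G m)
  have hΨd : IsPartialDiffeo ((𝓡 n).prod 𝓘(ℝ, EG)) 𝓘(ℝ, E) Ψ := ⟨hΨ, hΨ'⟩
  have hmt : ∀ m', m' ∈ Ψ.target ↔ orbitProj M G m' ∈ U := fun m' => by rw [hΨt]; rfl
  have hfst : ∀ m' ∈ Ψ.target, (Ψ.symm m').1 = orbitProj M G m' := by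
    intro m' hm'
    have hs := Ψ.map_target hm'
    rw [hΨs] at hs
    have h3 := hπ _ hs.1 (Ψ.symm m').2
    rw [Prod.mk.eta, Ψ.right_inv hm'] at h3
    exact h3.symm
  have hsmul : ∀ (g : G), ∀ m' ∈ Ψ.target,
      Ψ.symm (g • m') = (orbitProj M G m', g * (Ψ.symm m').2) := by
    intro g m' hm'
    have h4 := hact (orbitProj M G m') ((hmt _).1 hm') g (Ψ.symm m').2
    have h5 : Ψ (orbitProj M G m', (Ψ.symm m').2) = m' := by
      rw [← hfst m' hm', Prod.mk.eta, Ψ.right_inv hm']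
    rw [h5] at h4
    rw [← h4, Ψ.left_inv]
    rw [hΨs]
    exact ⟨(hmt _).1 hm', mem_univ _⟩
  -- Multiplication by the inverse of `h0` moves the group coordinate of `m` to the identity, where
  -- `lam` is defined. As the group commutes, it commutes with the action.
  set h0 := (Ψ.symm m).2 with hh0
  have hmul : IsPartialDiffeo 𝓘(ℝ, EG) 𝓘(ℝ, EG)
      (Homeomorph.mulLeft h0⁻¹).toOpenPartialHomeomorph := by
    constructor
    · exact contMDiff_mul_left.contMDiffOn
    · exact (contMDiff_mul_left (I := 𝓘(ℝ, EG)) (n := ∞) (a := (h0⁻¹)⁻¹)).contMDiffOn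
  set e1 := Ψ.symm.trans
    (eB.prod ((Homeomorph.mulLeft h0⁻¹).toOpenPartialHomeomorph.trans lam)) with he1
  have he1d : IsPartialDiffeo 𝓘(ℝ, E) 𝓘(ℝ, EuclideanSpace ℝ (Fin n) × EG) e1 :=
    hΨd.symm.trans (heB.prod (hmul.trans hlam.diffeo))
  have hsource : ∀ m', m' ∈ e1.source ↔ m' ∈ Ψ.target ∧ orbitProj M G m' ∈ eB.source ∧
      h0⁻¹ * (Ψ.symm m').2 ∈ lam.source := by
    intro m'
    simp only [he1, OpenPartialHomeomorph.trans_source, OpenPartialHomeomorph.symm_source, mem_inter_iff,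
      mem_preimage, OpenPartialHomeomorph.prod_source, mem_prod]
    refine and_congr_right fun hm' => ?_
    rw [hfst m' hm']
    simp
  have hval : ∀ m' ∈ Ψ.target,
      e1 m' = (eB (orbitProj M G m'), lam (h0⁻¹ * (Ψ.symm m').2)) := by
    intro m' hm'
    rw [← hfst m' hm']
    rfl
  have hm1 : m ∈ e1.source := by
    rw [hsource]
    refine ⟨(hmt m).2 hxU, hm, ?_⟩
    rw [hh0, inv_mul_cancel]
    exact hlam.one_mem
  -- The model space `E` comes without a splitting. The derivative of `e1` at `m` identifies it with
  -- the product, and composing with `K.symm` makes the chart take values in `E`.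
  let K : E ≃L[ℝ] EuclideanSpace ℝ (Fin n) × EG := he1d.mdifferentiable.mfderiv hm1
  have hKd : IsPartialDiffeo 𝓘(ℝ, EuclideanSpace ℝ (Fin n) × EG) 𝓘(ℝ, E)
      K.symm.toHomeomorph.toOpenPartialHomeomorph :=
    ⟨K.symm.contDiff.contMDiff.contMDiffOn, K.contDiff.contMDiff.contMDiffOn⟩
  have hsource' : ∀ m', m' ∈ (e1.trans K.symm.toHomeomorph.toOpenPartialHomeomorph).source ↔
      m' ∈ e1.source := by simp
  have hval' : ∀ m', e1.trans K.symm.toHomeomorph.toOpenPartialHomeomorph m' = K.symm (e1 m') :=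
    fun _ => rfl
  refine ⟨e1.trans K.symm.toHomeomorph.toOpenPartialHomeomorph, K,
    ⟨he1d.trans hKd, ?_, ?_, ?_⟩, (hsource' m).2 hm1⟩
  · intro m' hm'
    exact ((hsource m').1 ((hsource' m').1 hm')).2.1
  · intro m' hm'
    rw [hval', K.apply_symm_apply, hval _ ((hsource m').1 ((hsource' m').1 hm')).1]
  · intro m' hm'
    obtain ⟨ht, hb, hl⟩ := (hsource m').1 ((hsource' m').1 hm')
    have hc : Tendsto (fun p : G × M => (p.1, h0⁻¹ * (Ψ.symm p.2).2)) (𝓝 (1, m'))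
        (𝓝 (1, h0⁻¹ * (Ψ.symm m').2)) := by
      have h6 : ContinuousAt Ψ.symm m' := Ψ.continuousAt_symm ht
      have h7 : ContinuousAt (fun p : G × M => Ψ.symm p.2) (1, m') :=
        ContinuousAt.comp (g := Ψ.symm) (f := Prod.snd) h6 continuousAt_snd
      exact continuousAt_fst.prodMk (continuousAt_const.mul h7.snd)
    have h8 : ∀ᶠ p : G × M in 𝓝 (1, m'), p.2 ∈ Ψ.target :=
      continuousAt_snd.eventually (Ψ.open_target.mem_nhds ht)
    filter_upwards [hc.eventually (hlam.map_mul _ hl), h8] with p hp hp'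
    have h9 : p.1 • p.2 ∈ Ψ.target := by
      rw [hmt, orbitProj_smul, ← hmt]; exact hp'
    rw [hval', hval', hval _ h9, hval _ hp', hsmul _ _ hp', orbitProj_smul, ← map_add]
    have h10 : lam (h0⁻¹ * (p.1 * (Ψ.symm p.2).2)) = lam (h0⁻¹ * (Ψ.symm p.2).2) + lam p.1 := by
      rw [mul_left_comm, add_comm]
      exact hp
    simp only [h10, Prod.mk_add_mk, add_zero]

end Adapted

/-! ### The tangent action -/

section TangentAction

variable {E : Type*} [NormedAddCommGroup E] [NormedSpace ℝ E]
  {M : Type*} [TopologicalSpace M] [ChartedSpace E M]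
  {G : Type*} [TopologicalSpace G] [CommGroup G] [MulAction G M]

theorem tangentAct_one (w : TangentBundle 𝓘(ℝ, E) M) : tangentAct (1 : G) w = w := by
  have h1 : (fun m : M => (1 : G) • m) = id := by funext m; exact one_smul G m
  rw [tangentAct, h1, tangentMap_id]
  rfl

theorem contMDiff_smul_left (EG : Type*) [NormedAddCommGroup EG]
    [NormedSpace ℝ EG] [ChartedSpace EG G] [ContMDiffSMul 𝓘(ℝ, EG) 𝓘(ℝ, E) ∞ G M] (g : G) : ContMDiff 𝓘(ℝ, E) 𝓘(ℝ, E) ∞ (fun m : M => g • m) :=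
  ContMDiffSMul.contMDiff_const_smul (I := 𝓘(ℝ, EG)) g

theorem mdifferentiableAt_smul_left (EG : Type*) [NormedAddCommGroup EG]
    [NormedSpace ℝ EG] [ChartedSpace EG G] [ContMDiffSMul 𝓘(ℝ, EG) 𝓘(ℝ, E) ∞ G M] (g : G) (m : M) :
    MDifferentiableAt 𝓘(ℝ, E) 𝓘(ℝ, E) (fun m : M => g • m) m :=
  (contMDiff_smul_left EG g).mdifferentiableAt (by simp)

theorem tangentAct_mul (EG : Type*) [NormedAddCommGroup EG]
    [NormedSpace ℝ EG] [ChartedSpace EG G] [ContMDiffSMul 𝓘(ℝ, EG) 𝓘(ℝ, E) ∞ G M] (g h : G) (w : TangentBundle 𝓘(ℝ, E) M) :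
    tangentAct (g * h) w = tangentAct g (tangentAct h w) := by
  have h1 : (fun m : M => (g * h) • m) = (fun m : M => g • m) ∘ (fun m : M => h • m) := by
    funext m; exact mul_smul g h m
  rw [tangentAct, h1]
  exact tangentMap_comp_at w (mdifferentiableAt_smul_left EG g _)
    (mdifferentiableAt_smul_left EG h _)

theorem contMDiff_tangentAct [IsManifold 𝓘(ℝ, E) ∞ M] (EG : Type*) [NormedAddCommGroup EG]
    [NormedSpace ℝ EG] [ChartedSpace EG G] [ContMDiffSMul 𝓘(ℝ, EG) 𝓘(ℝ, E) ∞ G M] (g : G) :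
    ContMDiff 𝓘(ℝ, E).tangent 𝓘(ℝ, E).tangent ∞ (tangentAct (E := E) (M := M) g) := by
  have h := contMDiffOn_tangentMap isOpen_univ
    (contMDiff_smul_left (E := E) (M := M) EG g).contMDiffOn
  rwa [preimage_univ, contMDiffOn_univ] at h

variable {EG : Type*} [NormedAddCommGroup EG] [NormedSpace ℝ EG] [ChartedSpace EG G]
  [ContMDiffSMul 𝓘(ℝ, EG) 𝓘(ℝ, E) ∞ G M]

theorem mdifferentiableAt_orbit (g : G) (m : M) :
    MDifferentiableAt 𝓘(ℝ, EG) 𝓘(ℝ, E) (fun h : G => h • m) g := by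
  have h1 : ContMDiff 𝓘(ℝ, EG) 𝓘(ℝ, E) ∞ (fun h : G => h • m) :=
    (contMDiff_smul (I := 𝓘(ℝ, EG)) (I' := 𝓘(ℝ, E)) (n := ∞) (G := G) (M := M)).comp
      (contMDiff_id.prodMk contMDiff_const)
  exact h1.mdifferentiableAt (by simp)

theorem mfderiv_comp_orbit {F : Type*} [NormedAddCommGroup F] [NormedSpace ℝ F]
    {H : Type*} [TopologicalSpace H] {J : ModelWithCorners ℝ F H}
    {N : Type*} [TopologicalSpace N] [ChartedSpace H N] {f : M → N} {m : M}
    (hf : MDifferentiableAt 𝓘(ℝ, E) J f m) (ξ : EG) :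
    (mfderiv 𝓘(ℝ, EG) J (f ∘ fun g : G => g • m) 1 : EG →L[ℝ] F) ξ
      = (mfderiv 𝓘(ℝ, E) J f m : E →L[ℝ] F) (fundamental EG G m ξ) := by
  have h1 : mfderiv 𝓘(ℝ, EG) J (f ∘ fun g : G => g • m) 1 = _ :=
    mfderiv_comp_of_eq (I' := 𝓘(ℝ, E)) (y := m) hf (mdifferentiableAt_orbit 1 m) (one_smul G m)
  -- The points `1 • m` and `m` are equal only propositionally; the derivatives are compared as maps
  -- on the common model space.
  have h2 : ∀ m', m' = m → (mfderiv 𝓘(ℝ, E) J f m' : E →L[ℝ] F) = mfderiv 𝓘(ℝ, E) J f m := by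
    rintro _ rfl
    rfl
  have h3 := congrArg (fun A : EG →L[ℝ] F => A ξ) h1
  exact h3.trans (congrArg (fun A : E →L[ℝ] F => A (fundamental EG G m ξ))
    (h2 _ (one_smul G m)))

/-- The fundamental vector fields of a commutative group are invariant. -/
theorem smul_fundamental (g : G) (m : M) (ξ : GroupLieAlgebra 𝓘(ℝ, EG) G) :
    mfderiv 𝓘(ℝ, E) 𝓘(ℝ, E) (fun m' : M => g • m') m (fundamental EG G m ξ)
      = fundamental EG G (g • m) ξ := by
  have h1 : (fun h : G => h • (g • m)) = (fun m' : M => g • m') ∘ (fun h : G => h • m) := by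
    funext h; exact smul_comm h g m
  have h2 := mfderiv_comp_orbit (EG := EG) (G := G) (mdifferentiableAt_smul_left (E := E) (M := M) EG g m) ξ
  refine h2.symm.trans ?_
  exact congrArg (fun f : G → M => (mfderiv 𝓘(ℝ, EG) 𝓘(ℝ, E) f 1 : EG →L[ℝ] E) ξ) h1.symm

/-- The definition asks for invariance of the vertical projection only. The form inherits it because
the fundamental fields of a commutative group are themselves invariant; the adjoint action is
trivial. -/
theorem PrincipalConnection.form_smul [IsManifold 𝓘(ℝ, E) ∞ M] (A : PrincipalConnection E EG M G)
    (g : G) (m : M) (u : TangentSpace 𝓘(ℝ, E) m) :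
    A.form (g • m) (mfderiv 𝓘(ℝ, E) 𝓘(ℝ, E) (fun m' : M => g • m') m u) = A.form m u := by
  have h1 := A.invariant g m u
  have h2 := smul_fundamental (E := E) g m (A.form m u)
  have h3 := congrArg (A.form (g • m)) (h1.trans h2)
  exact (A.splits _ _).symm.trans (h3.trans (A.splits _ _))

end TangentAction

/-! ### Invariance of the momentum, of its level sets and of the Routhian. -/

section Momentum

variable {E : Type*} [NormedAddCommGroup E] [NormedSpace ℝ E]
  {EG : Type*} [NormedAddCommGroup EG] [NormedSpace ℝ EG]
  {M : Type*} [TopologicalSpace M] [ChartedSpace E M] [IsManifold 𝓘(ℝ, E) ∞ M]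
  {G : Type*} [TopologicalSpace G] [ChartedSpace EG G] [CommGroup G] [MulAction G M]
  [ContMDiffSMul 𝓘(ℝ, EG) 𝓘(ℝ, E) ∞ G M]
  {L : TangentBundle 𝓘(ℝ, E) M → ℝ}

/-- On fibres `g` acts by a linear map that preserves `L` and carries fundamental vectors to
fundamental vectors of the same `ξ`. For a commutative group the coadjoint action is trivial, so
equivariance of the momentum is invariance, and all of `G` preserves `N_μ`. -/
theorem momentum_tangentAct (hL : ContMDiff 𝓘(ℝ, E).tangent 𝓘(ℝ, ℝ) ∞ L)
    (hinv : ∀ (g : G) (w : TangentBundle 𝓘(ℝ, E) M), L (tangentAct g w) = L w)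
    (g : G) (w : TangentBundle 𝓘(ℝ, E) M) :
    momentum EG G L (tangentAct g w) = momentum EG G L w := by
  let T : E →L[ℝ] E := mfderiv 𝓘(ℝ, E) 𝓘(ℝ, E) (fun m' : M => g • m') w.proj
  have h1 : (fun u : E => L ⟨w.proj, u⟩) = (fun u : E => L ⟨g • w.proj, u⟩) ∘ T := by
    funext u
    exact (hinv g ⟨w.proj, u⟩).symm
  have hd : DifferentiableAt ℝ (fun u : E => L ⟨g • w.proj, u⟩) (T w.2) :=
    (hasFDerivAt_fibre hL (isPartialDiffeo_chartAt (g • w.proj)) (mem_chart_source E _)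
      (T w.2)).differentiableAt
  have hcomp : ∀ f : E → ℝ, ∀ x : E, DifferentiableAt ℝ f (T x) →
      fderiv ℝ (f ∘ T) x = (fderiv ℝ f (T x)).comp T := fun f x hf =>
    (hf.hasFDerivAt.comp x T.hasFDerivAt).fderiv
  have h2 : fderiv ℝ (fun u : E => L ⟨w.proj, u⟩) w.2
      = (fderiv ℝ (fun u : E => L ⟨g • w.proj, u⟩) (T w.2)).comp T := by
    rw [h1]
    exact hcomp _ _ hd
  have key : ∀ ξ : EG, fderiv ℝ (fun u : E => L ⟨g • w.proj, u⟩) (T w.2)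
        (fundamental EG G (g • w.proj) ξ : E)
      = fderiv ℝ (fun u : E => L ⟨w.proj, u⟩) w.2 (fundamental EG G w.proj ξ) := by
    intro ξ
    have h3 := congrArg (fderiv ℝ (fun u : E => L ⟨g • w.proj, u⟩) (T w.2))
      (smul_fundamental (E := E) g w.proj ξ)
    rw [h2]
    exact h3.symm
  exact ContinuousLinearMap.ext key

theorem routhian_tangentAct (hL : ContMDiff 𝓘(ℝ, E).tangent 𝓘(ℝ, ℝ) ∞ L)
    (hinv : ∀ (g : G) (w : TangentBundle 𝓘(ℝ, E) M), L (tangentAct g w) = L w)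
    (A : PrincipalConnection E EG M G) (g : G) (w : TangentBundle 𝓘(ℝ, E) M) :
    routhian A L (tangentAct g w) = routhian A L w := by
  have h1 : A.form (tangentAct g w).proj (tangentAct g w).2 = A.form w.proj w.2 :=
    A.form_smul g w.proj w.2
  rw [routhian, routhian, hinv, h1, momentum_tangentAct hL hinv]

theorem tangentAct_mem_levelSet (hL : ContMDiff 𝓘(ℝ, E).tangent 𝓘(ℝ, ℝ) ∞ L)
    (hinv : ∀ (g : G) (w : TangentBundle 𝓘(ℝ, E) M), L (tangentAct g w) = L w)
    {μ : GroupLieAlgebra 𝓘(ℝ, EG) G →L[ℝ] ℝ} (g : G) {w : TangentBundle 𝓘(ℝ, E) M}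
    (hw : w ∈ levelSet L μ) : tangentAct g w ∈ levelSet L μ :=
  (momentum_tangentAct hL hinv g w).trans hw

end Momentum

/-! ### Adapted coordinates on the tangent bundle -/

section AdaptedCoord

variable {E : Type*} [NormedAddCommGroup E] [NormedSpace ℝ E]
  {EG : Type*} [NormedAddCommGroup EG] [NormedSpace ℝ EG] {n : ℕ}
  {M : Type*} [TopologicalSpace M] [ChartedSpace E M]
  {G : Type*} [TopologicalSpace G] [ChartedSpace EG G] [CommGroup G] [MulAction G M]
  [ContMDiffSMul 𝓘(ℝ, EG) 𝓘(ℝ, E) ∞ G M]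
  [ChartedSpace (EuclideanSpace ℝ (Fin n)) (MulAction.orbitRel.Quotient G M)]
  {lam : OpenPartialHomeomorph G EG}
  {eB : OpenPartialHomeomorph (MulAction.orbitRel.Quotient G M) (EuclideanSpace ℝ (Fin n))}
  {e : OpenPartialHomeomorph M E} {K : E ≃L[ℝ] EuclideanSpace ℝ (Fin n) × EG}

namespace IsAdapted

/-- Along the orbit of `m` the chart is `e m + K.symm (0, lam g)` near `g = 1`, and `lam` has the
identity as its derivative there. -/
theorem chartDeriv_fundamental (ha : IsAdapted lam eB e K) (hlam : IsLog lam) {m : M}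
    (hm : m ∈ e.source) (ξ : GroupLieAlgebra 𝓘(ℝ, EG) G) :
    chartDeriv e m (fundamental EG G m ξ) = K.symm (0, ξ) := by
  have h1 : (e ∘ fun g : G => g • m) =ᶠ[𝓝 1] (fun s : EG => e m + K.symm (0, s)) ∘ lam := by
    have h2 : Tendsto (fun g : G => (g, m)) (𝓝 1) (𝓝 (1, m)) :=
      (Continuous.prodMk_left m).continuousAt
    exact h2.eventually (ha.act m hm)
  have h4 : HasFDerivAt (fun s : EG => e m + K.symm (0, s))
      ((K.symm : EuclideanSpace ℝ (Fin n) × EG →L[ℝ] E).comp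
        (ContinuousLinearMap.inr ℝ (EuclideanSpace ℝ (Fin n)) EG)) (lam 1) := by
    refine HasFDerivAt.const_add _ ?_
    exact ((K.symm : EuclideanSpace ℝ (Fin n) × EG →L[ℝ] E).comp
        (ContinuousLinearMap.inr ℝ (EuclideanSpace ℝ (Fin n)) EG)).hasFDerivAt
  have h5 : mfderiv 𝓘(ℝ, EG) 𝓘(ℝ, E) ((fun s : EG => e m + K.symm (0, s)) ∘ lam) 1 = _ :=
    mfderiv_comp (I' := 𝓘(ℝ, EG)) 1 (mdifferentiableAt_iff_differentiableAt.2 h4.differentiableAt)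
      (hlam.diffeo.mdifferentiableAt hlam.one_mem)
  have h6 : mfderiv 𝓘(ℝ, EG) 𝓘(ℝ, E) (e ∘ fun g : G => g • m) 1
    = mfderiv 𝓘(ℝ, EG) 𝓘(ℝ, E) ((fun s : EG => e m + K.symm (0, s)) ∘ lam) 1 := h1.mfderiv_eq
  have h7 : (mfderiv 𝓘(ℝ, EG) 𝓘(ℝ, E) (e ∘ fun g : G => g • m) 1 : EG →L[ℝ] E) ξ
      = (mfderiv 𝓘(ℝ, EG) 𝓘(ℝ, E) ((fun s : EG => e m + K.symm (0, s)) ∘ lam) 1 : EG →L[ℝ] E) ξ :=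
    congrArg (fun T : EG →L[ℝ] E => T ξ) h6
  have h8 : (mfderiv 𝓘(ℝ, EG) 𝓘(ℝ, E) (e ∘ fun g : G => g • m) 1 : EG →L[ℝ] E) ξ
      = chartDeriv e m (fundamental EG G m ξ) :=
    mfderiv_comp_orbit (EG := EG) (ha.diffeo.mdifferentiableAt hm) ξ
  have h9 : (mfderiv 𝓘(ℝ, EG) 𝓘(ℝ, E)
        ((fun s : EG => e m + K.symm (0, s)) ∘ lam) 1 : EG →L[ℝ] E) ξ
      = fderiv ℝ (fun s : EG => e m + K.symm (0, s)) (lam 1)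
        (mfderiv 𝓘(ℝ, EG) 𝓘(ℝ, EG) lam 1 ξ) := by
    rw [← mfderiv_eq_fderiv]
    exact congrArg (fun T : EG →L[ℝ] E => T ξ) h5
  rw [← h8, h7, h9, h4.fderiv]
  exact congrArg (fun s : EG => K.symm ((0 : EuclideanSpace ℝ (Fin n)), s)) (hlam.deriv_one ξ)

theorem mfderiv_orbitProj (ha : IsAdapted lam eB e K) (hbundle : IsPrincipalBundle E EG n M G)
    (heB : IsPartialDiffeo (𝓡 n) (𝓡 n) eB) {m : M} (hm : m ∈ e.source)
    (u : TangentSpace 𝓘(ℝ, E) m) :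
    mfderiv (𝓡 n) (𝓡 n) eB (orbitProj M G m) (mfderiv 𝓘(ℝ, E) (𝓡 n) (orbitProj M G) m u)
      = (K (chartDeriv e m u)).1 := by
  have h1 : (eB ∘ orbitProj M G) =ᶠ[𝓝 m] ((fun x : E => (K x).1) ∘ e) := by
    filter_upwards [e.open_source.mem_nhds hm] with m' hm'
    exact (ha.proj_eq m' hm').symm
  have h2 : mfderiv 𝓘(ℝ, E) (𝓡 n) (eB ∘ orbitProj M G) m = _ :=
    mfderiv_comp (I' := 𝓡 n) m (heB.mdifferentiableAt (ha.proj_mem m hm))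
      ((contMDiff_orbitProj hbundle).mdifferentiableAt (by simp))
  have h4 : HasFDerivAt (fun x : E => (K x).1)
      ((ContinuousLinearMap.fst ℝ _ _).comp (K : E →L[ℝ] EuclideanSpace ℝ (Fin n) × EG)) (e m) :=
    ((ContinuousLinearMap.fst ℝ _ _).comp
      (K : E →L[ℝ] EuclideanSpace ℝ (Fin n) × EG)).hasFDerivAt
  have h5 : mfderiv 𝓘(ℝ, E) (𝓡 n) ((fun x : E => (K x).1) ∘ e) m = _ :=
    mfderiv_comp (I' := 𝓘(ℝ, E)) m (mdifferentiableAt_iff_differentiableAt.2 h4.differentiableAt)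
      (ha.diffeo.mdifferentiableAt hm)
  have h6 : mfderiv 𝓘(ℝ, E) (𝓡 n) (eB ∘ orbitProj M G) m
    = mfderiv 𝓘(ℝ, E) (𝓡 n) ((fun x : E => (K x).1) ∘ e) m := h1.mfderiv_eq
  have h7 := (h2.symm.trans h6).trans h5
  have h8 := congrArg (fun T : E →L[ℝ] EuclideanSpace ℝ (Fin n) => T u) h7
  refine h8.trans ?_
  rw [mfderiv_eq_fderiv]
  exact congrArg (fun T : E →L[ℝ] EuclideanSpace ℝ (Fin n) => T (chartDeriv e m u)) h4.fderiv

theorem natCoord_tangentMap_orbitProj (ha : IsAdapted lam eB e K)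
    (hbundle : IsPrincipalBundle E EG n M G) (heB : IsPartialDiffeo (𝓡 n) (𝓡 n) eB)
    {w : TangentBundle 𝓘(ℝ, E) M} (hw : w.proj ∈ e.source) :
    natCoord eB (tangentMap 𝓘(ℝ, E) (𝓡 n) (orbitProj M G) w)
      = ((K (natCoord e w).1).1, (K (natCoord e w).2).1) :=
  Prod.ext (ha.proj_eq _ hw).symm (ha.mfderiv_orbitProj hbundle heB hw w.2)

/-- In adapted coordinates the tangent action is by translations. -/
theorem natCoord_tangentAct (ha : IsAdapted lam eB e K) [IsManifold 𝓘(ℝ, E) ∞ M]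
    {w : TangentBundle 𝓘(ℝ, E) M} (hw : w.proj ∈ e.source) :
    ∀ᶠ p : G × TangentBundle 𝓘(ℝ, E) M in 𝓝 (1, w), p.2.proj ∈ e.source ∧
      (tangentAct p.1 p.2).proj ∈ e.source ∧
      natCoord e (tangentAct p.1 p.2) = natCoord e p.2 + (K.symm (0, lam p.1), 0) := by
  have hcs : ContinuousSMul G M := ContMDiffSMul.continuousSMul (I := 𝓘(ℝ, EG)) (I' := 𝓘(ℝ, E)) ∞
  have h1 : ∀ᶠ p : G × M in 𝓝 (1, w.proj), p.2 ∈ e.source :=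
    continuousAt_snd.eventually (e.open_source.mem_nhds hw)
  have h2 : ∀ᶠ p : G × M in 𝓝 (1, w.proj), p.1 • p.2 ∈ e.source := by
    have h3 : ContinuousAt (fun p : G × M => p.1 • p.2) (1, w.proj) := continuous_smul.continuousAt
    refine h3.eventually (e.open_source.mem_nhds ?_)
    simpa using hw
  have h4 : Tendsto (fun p : G × TangentBundle 𝓘(ℝ, E) M => (p.1, p.2.proj)) (𝓝 (1, w))
      (𝓝 (1, w.proj)) :=
    (continuous_fst.prodMk ((FiberBundle.continuous_proj E _).comp continuous_snd)).continuousAt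
  filter_upwards [h4.eventually (h1.and (h2.and (ha.act _ hw).eventually_nhds))]
  rintro ⟨g, w'⟩ ⟨hs, hs', hev⟩
  refine ⟨hs, hs', ?_⟩
  have h5 : (e ∘ fun m : M => g • m) =ᶠ[𝓝 w'.proj] (fun x : E => x + K.symm (0, lam g)) ∘ e := by
    have h6 : Tendsto (fun m : M => (g, m)) (𝓝 w'.proj) (𝓝 (g, w'.proj)) :=
      (Continuous.prodMk_right g).continuousAt
    exact h6.eventually hev
  have h7 : mfderiv 𝓘(ℝ, E) 𝓘(ℝ, E) (e ∘ fun m : M => g • m) w'.proj = _ :=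
    mfderiv_comp (I' := 𝓘(ℝ, E)) w'.proj (ha.diffeo.mdifferentiableAt hs')
      (mdifferentiableAt_smul_left EG g _)
  have h8 : HasFDerivAt (fun x : E => x + K.symm (0, lam g)) (ContinuousLinearMap.id ℝ E)
      (e w'.proj) := (hasFDerivAt_id _).add_const _
  have h9 : mfderiv 𝓘(ℝ, E) 𝓘(ℝ, E) ((fun x : E => x + K.symm (0, lam g)) ∘ e) w'.proj = _ :=
    mfderiv_comp (I' := 𝓘(ℝ, E)) w'.proj
      (mdifferentiableAt_iff_differentiableAt.2 h8.differentiableAt)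
      (ha.diffeo.mdifferentiableAt hs)
  have h10 : mfderiv 𝓘(ℝ, E) 𝓘(ℝ, E) (e ∘ fun m : M => g • m) w'.proj
    = mfderiv 𝓘(ℝ, E) 𝓘(ℝ, E) ((fun x : E => x + K.symm (0, lam g)) ∘ e) w'.proj := h5.mfderiv_eq
  have h11 := congrArg (fun T : E →L[ℝ] E => T w'.2) ((h7.symm.trans h10).trans h9)
  have h12 : (mfderiv 𝓘(ℝ, E) 𝓘(ℝ, E) e (g • w'.proj)
      (mfderiv 𝓘(ℝ, E) 𝓘(ℝ, E) (fun m : M => g • m) w'.proj w'.2) : E)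
      = chartDeriv e w'.proj w'.2 := by
    refine h11.trans ?_
    rw [mfderiv_eq_fderiv]
    exact congrArg (fun T : E →L[ℝ] E => T (chartDeriv e w'.proj w'.2)) h8.fderiv
  refine Prod.ext ?_ ?_
  · exact h5.self_of_nhds
  · exact h12.trans (add_zero _).symm

end IsAdapted

end AdaptedCoord

/-! ### Invariant Lagrangians in adapted coordinates -/

/-- A `G`-invariant regular Lagrangian `Λ(x, v)` and a principal connection form `Ω` in adapted
coordinates, over the open subset `D` of the model space. -/
structure IsFlatSystem {E : Type*} [NormedAddCommGroup E] [NormedSpace ℝ E]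
    {EG : Type*} [NormedAddCommGroup EG] [NormedSpace ℝ EG]
    {V : Type*} [NormedAddCommGroup V] [NormedSpace ℝ V] (K : E ≃L[ℝ] V × EG) (D : Set E)
    (Λ : E × E → ℝ) (Ω : E → E →L[ℝ] EG) : Prop where
  isOpen : IsOpen D
  smooth : ∀ p : E × E, p.1 ∈ D → ContDiffAt ℝ ∞ Λ p
  inv : ∀ p : E × E, p.1 ∈ D → ∀ ξ, fderiv ℝ Λ p (K.symm (0, ξ), 0) = 0
  regular : ∀ p : E × E, p.1 ∈ D → ∀ a, (∀ k, fibreHess Λ p a k = 0) → a = 0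
  group_regular : ∀ p : E × E, p.1 ∈ D → ∀ ξ,
    (∀ η, fibreHess Λ p (K.symm (0, ξ)) (K.symm (0, η)) = 0) → ξ = 0
  form_smooth : ∀ x ∈ D, ContDiffAt ℝ ∞ Ω x
  form_vert : ∀ x ∈ D, ∀ ξ, Ω x (K.symm (0, ξ)) = ξ
  form_inv : ∀ x ∈ D, ∀ ξ v, fderiv ℝ Ω x (K.symm (0, ξ)) v = 0

/-! ### From adapted charts to invariant systems on a vector space. -/

section FlatOfAdapted

variable {E : Type*} [NormedAddCommGroup E] [NormedSpace ℝ E]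
  {EG : Type*} [NormedAddCommGroup EG] [NormedSpace ℝ EG] {n : ℕ}
  {M : Type*} [TopologicalSpace M] [ChartedSpace E M] [IsManifold 𝓘(ℝ, E) ∞ M]
  {G : Type*} [TopologicalSpace G] [ChartedSpace EG G] [CommGroup G] [MulAction G M]
  [ContMDiffSMul 𝓘(ℝ, EG) 𝓘(ℝ, E) ∞ G M]
  [ChartedSpace (EuclideanSpace ℝ (Fin n)) (MulAction.orbitRel.Quotient G M)]
  {lam : OpenPartialHomeomorph G EG}
  {eB : OpenPartialHomeomorph (MulAction.orbitRel.Quotient G M) (EuclideanSpace ℝ (Fin n))}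
  {e : OpenPartialHomeomorph M E} {K : E ≃L[ℝ] EuclideanSpace ℝ (Fin n) × EG}
  {L : TangentBundle 𝓘(ℝ, E) M → ℝ}

namespace IsAdapted

theorem tendsto_log_symm (hlam : IsLog lam) : Tendsto lam.symm (𝓝 0) (𝓝 1) := by
  have h1 := lam.continuousAt_symm (lam.map_source hlam.one_mem)
  rw [hlam.map_one] at h1
  have h2 : lam.symm 0 = 1 := by rw [← hlam.map_one]; exact lam.left_inv hlam.one_mem
  rw [ContinuousAt, h2] at h1
  exact h1

theorem eventually_log_symm (hlam : IsLog lam) : ∀ᶠ s in 𝓝 (0 : EG), lam (lam.symm s) = s := by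
  have h1 := lam.open_target.mem_nhds (lam.map_source hlam.one_mem)
  rw [hlam.map_one] at h1
  filter_upwards [h1] with s hs using lam.right_inv hs

/-- Invariant functions on the tangent bundle are locally invariant under vertical translations in
adapted coordinates. -/
theorem eventually_translate (ha : IsAdapted lam eB e K) (hlam : IsLog lam)
    {w : TangentBundle 𝓘(ℝ, E) M} (hw : w.proj ∈ e.source) {W : Type*}
    {f : TangentBundle 𝓘(ℝ, E) M → W} (hf : ∀ (g : G) w, f (tangentAct g w) = f w) :
    ∀ᶠ s in 𝓝 (0 : EG), (f ∘ (natChart e ha.diffeo).symm) (natCoord e w + (K.symm (0, s), 0))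
      = (f ∘ (natChart e ha.diffeo).symm) (natCoord e w) := by
  have h1 : Tendsto (fun s : EG => (lam.symm s, w)) (𝓝 0) (𝓝 (1, w)) :=
    (tendsto_log_symm hlam).prodMk_nhds tendsto_const_nhds
  filter_upwards [h1.eventually (ha.natCoord_tangentAct hw), eventually_log_symm hlam]
    with s ⟨h2, h3, h4⟩ hs
  rw [hs] at h4
  have h5 : (natChart e ha.diffeo).symm (natCoord e (tangentAct (lam.symm s) w))
      = tangentAct (lam.symm s) w := (natChart e ha.diffeo).left_inv h3
  have h6 : (natChart e ha.diffeo).symm (natCoord e w) = w := (natChart e ha.diffeo).left_inv h2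
  rw [Function.comp_apply, Function.comp_apply, ← h4, h5, h6, hf]

/-- This is the infinitesimal form of the local invariance under vertical translations. The target
`W` is general so that it serves both for the Lagrangian and for the `𝔤`-valued connection form. -/
theorem fderiv_vertical_eq_zero (ha : IsAdapted lam eB e K) (hlam : IsLog lam)
    {w : TangentBundle 𝓘(ℝ, E) M} (hw : w.proj ∈ e.source)
    {W : Type*} [NormedAddCommGroup W] [NormedSpace ℝ W]
    {f : TangentBundle 𝓘(ℝ, E) M → W} (hf : ∀ (g : G) w, f (tangentAct g w) = f w)
    (hfd : DifferentiableAt ℝ (f ∘ (natChart e ha.diffeo).symm) (natCoord e w)) (ξ : EG) :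
    fderiv ℝ (f ∘ (natChart e ha.diffeo).symm) (natCoord e w) (K.symm (0, ξ), 0) = 0 := by
  set F := f ∘ (natChart e ha.diffeo).symm
  let T : EG →L[ℝ] E × E := (ContinuousLinearMap.inl ℝ E E).comp
    ((K.symm : EuclideanSpace ℝ (Fin n) × EG →L[ℝ] E).comp (ContinuousLinearMap.inr ℝ _ EG))
  have h1 : HasFDerivAt (fun s : EG => natCoord e w + T s) T 0 := T.hasFDerivAt.const_add _
  have h2 : HasFDerivAt (fun s : EG => F (natCoord e w + T s))
      ((fderiv ℝ F (natCoord e w)).comp T) 0 := by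
    refine HasFDerivAt.comp (g := F) (f := fun s : EG => natCoord e w + T s) 0 ?_ h1
    simpa using hfd.hasFDerivAt
  have h3 : (fun s : EG => F (natCoord e w + T s)) =ᶠ[𝓝 0] fun _ => F (natCoord e w) :=
    ha.eventually_translate hlam hw hf
  have h4 : HasFDerivAt (fun s : EG => F (natCoord e w + T s)) (0 : EG →L[ℝ] W) 0 :=
    (hasFDerivAt_const _ _).congr_of_eventuallyEq h3
  exact DFunLike.congr_fun (h2.unique h4) ξ

theorem momentum_eq (ha : IsAdapted lam eB e K) (hlam : IsLog lam)
    (hL : ContMDiff 𝓘(ℝ, E).tangent 𝓘(ℝ, ℝ) ∞ L)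
    {w : TangentBundle 𝓘(ℝ, E) M} (hw : w.proj ∈ e.source) (ξ : GroupLieAlgebra 𝓘(ℝ, EG) G) :
    momentum EG G L w ξ = fderiv ℝ (L ∘ (natChart e ha.diffeo).symm) (natCoord e w)
      ((0, K.symm (0, ξ)) : E × E) := by
  refine (fibreDeriv_eq hL ha.diffeo hw _).trans ?_
  exact congrArg (fun y : E => fderiv ℝ (L ∘ (natChart e ha.diffeo).symm) (natCoord e w)
    ((0, y) : E × E)) (ha.chartDeriv_fundamental hlam hw ξ)

theorem hessian_fundamental (ha : IsAdapted lam eB e K) (hlam : IsLog lam)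
    (hL : ContMDiff 𝓘(ℝ, E).tangent 𝓘(ℝ, ℝ) ∞ L)
    {w : TangentBundle 𝓘(ℝ, E) M} (hw : w.proj ∈ e.source) (ξ η : GroupLieAlgebra 𝓘(ℝ, EG) G) :
    hessian L w (fundamental EG G w.proj ξ) (fundamental EG G w.proj η)
      = fibreHess (L ∘ (natChart e ha.diffeo).symm) (natCoord e w)
        (K.symm (0, ξ)) (K.symm (0, η)) := by
  refine (hessian_eq hL ha.diffeo hw _ _).trans ?_
  exact congrArg₂ (fun y z : E => fibreHess (L ∘ (natChart e ha.diffeo).symm) (natCoord e w) y z)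
    (ha.chartDeriv_fundamental hlam hw ξ) (ha.chartDeriv_fundamental hlam hw η)

end IsAdapted

/-- The connection form in the coordinates of a chart of `M`. -/
def formCoord (A : PrincipalConnection E EG M G) (e : OpenPartialHomeomorph M E) (x : E) :
    E →L[ℝ] EG :=
  (A.form (e.symm x)).comp (mfderiv 𝓘(ℝ, E) 𝓘(ℝ, E) e.symm x)

theorem formCoord_apply (A : PrincipalConnection E EG M G)
    (he : IsPartialDiffeo 𝓘(ℝ, E) 𝓘(ℝ, E) e) {m : M} (hm : m ∈ e.source)
    (u : TangentSpace 𝓘(ℝ, E) m) : formCoord A e (e m) (chartDeriv e m u) = A.form m u := by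
  have h1 := (natChart e he).left_inv
    (show (⟨m, u⟩ : TangentBundle 𝓘(ℝ, E) M) ∈ (natChart e he).source from hm)
  exact congrArg (fun w : TangentBundle 𝓘(ℝ, E) M => (A.form w.proj w.2 : EG)) h1

theorem contDiffAt_formCoord_apply (A : PrincipalConnection E EG M G)
    (he : IsPartialDiffeo 𝓘(ℝ, E) 𝓘(ℝ, E) e) {x : E} (hx : x ∈ e.target) (v : E) :
    ContDiffAt ℝ ∞ (fun q : E × E => formCoord A e q.1 q.2) (x, v) := by
  have h1 := (natChart e he).symm.map_source (x := (x, v)) hx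
  have h2 := (isPartialDiffeo_natChart he).contDiffAt_comp_symm h1 (W := EG)
    (f := fun w : TangentBundle 𝓘(ℝ, E) M => (A.form w.proj w.2 : EG)) (A.smooth _)
  rw [(natChart e he).right_inv (x := (x, v)) hx] at h2
  exact h2

/-- The connection is given as a smooth function on `TM`. In finite dimension a field of operators
is smooth as soon as its values on fixed vectors are, and these are restrictions of that function.
-/
theorem contDiffAt_formCoord [FiniteDimensional ℝ E] (A : PrincipalConnection E EG M G)
    (he : IsPartialDiffeo 𝓘(ℝ, E) 𝓘(ℝ, E) e) {x : E} (hx : x ∈ e.target) :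
    ContDiffAt ℝ ∞ (formCoord A e) x := by
  have h1 : ContDiffOn ℝ ∞ (formCoord A e) e.target := by
    rw [contDiffOn_clm_apply]
    intro v y hy
    have h2 := contDiffAt_formCoord_apply A he hy v
    exact (ContDiffAt.comp (f := fun y : E => (y, v)) y h2
      (contDiffAt_id.prodMk contDiffAt_const)).contDiffWithinAt
  exact h1.contDiffAt (e.open_target.mem_nhds hx)

/-- This collects everything that the derivation of Routh's equations uses about the bundle, so that
the derivation itself is calculus on `E × E`, with `K.symm (0, ξ)` as the vertical directions. -/
theorem IsAdapted.isFlatSystem [FiniteDimensional ℝ E] (ha : IsAdapted lam eB e K)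
    (hlam : IsLog lam) (hL : ContMDiff 𝓘(ℝ, E).tangent 𝓘(ℝ, ℝ) ∞ L)
    (hinv : ∀ (g : G) (w : TangentBundle 𝓘(ℝ, E) M), L (tangentAct g w) = L w)
    (hreg : IsRegular L) (hgreg : IsGroupRegular EG G L) (A : PrincipalConnection E EG M G) :
    IsFlatSystem K e.target (L ∘ (natChart e ha.diffeo).symm) (formCoord A e) := by
  have hlift : ∀ p : E × E, p.1 ∈ e.target → ∃ w : TangentBundle 𝓘(ℝ, E) M,
      w.proj ∈ e.source ∧ natCoord e w = p := fun p hp =>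
    ⟨(natChart e ha.diffeo).symm p, (natChart e ha.diffeo).symm.map_source (x := p) hp,
      (natChart e ha.diffeo).right_inv (x := p) hp⟩
  have hsmooth : ∀ p : E × E, p.1 ∈ e.target →
      ContDiffAt ℝ ∞ (L ∘ (natChart e ha.diffeo).symm) p := by
    intro p hp
    obtain ⟨w, hw, rfl⟩ := hlift p hp
    exact contDiffAt_lagrangian hL ha.diffeo hw
  refine ⟨e.open_target, hsmooth, ?_, ?_, ?_, ?_, ?_, ?_⟩
  · intro p hp ξ
    have h1 := (hsmooth p hp).differentiableAt (by simp)
    obtain ⟨w, hw, rfl⟩ := hlift p hp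
    exact ha.fderiv_vertical_eq_zero hlam hw hinv h1 ξ
  · intro p hp a h
    obtain ⟨w, hw, rfl⟩ := hlift p hp
    obtain ⟨u, rfl⟩ := chartDeriv_surjective ha.diffeo hw a
    have : u = 0 := hreg w u fun v => (hessian_eq hL ha.diffeo hw u v).trans (h _)
    rw [this, map_zero]
  · intro p hp ξ h
    obtain ⟨w, hw, rfl⟩ := hlift p hp
    exact hgreg w ξ fun η => (ha.hessian_fundamental hlam hL hw ξ η).trans (h η)
  · exact fun x hx => contDiffAt_formCoord A ha.diffeo hx
  · intro x hx ξ
    have hm := e.map_target hx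
    have h1 := formCoord_apply A ha.diffeo hm (fundamental EG G (e.symm x) ξ)
    exact (congrArg₂ (fun y v : E => formCoord A e y v) (e.right_inv hx)
      (ha.chartDeriv_fundamental hlam hm ξ)).symm.trans (h1.trans (A.splits _ _))
  · intro x hx ξ v
    obtain ⟨w, hw, hwp⟩ := hlift (x, v) hx
    have h1 := contDiffAt_formCoord_apply A ha.diffeo hx v
    have h2 := ha.fderiv_vertical_eq_zero hlam hw (W := EG)
      (f := fun w : TangentBundle 𝓘(ℝ, E) M => (A.form w.proj w.2 : EG))
      (fun g w => A.form_smul g w.proj w.2) (by rw [hwp]; exact h1.differentiableAt (by simp)) ξ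
    rw [hwp] at h2
    have h3 : HasFDerivAt (fun q : E × E => formCoord A e q.1 q.2) _ (x, v) :=
      HasFDerivAt.clm_apply (c := fun q : E × E => formCoord A e q.1) (u := fun q : E × E => q.2)
        (HasFDerivAt.comp (g := formCoord A e) (x, v)
          ((contDiffAt_formCoord A ha.diffeo hx).differentiableAt (by simp)).hasFDerivAt
          hasFDerivAt_fst) hasFDerivAt_snd
    have h4 := DFunLike.congr_fun h3.fderiv ((K.symm (0, ξ), 0) : E × E)
    have h5 := h4.symm.trans h2
    simpa using h5

end FlatOfAdapted

/-! ### Smoothness, regularity and conservation of the momentum. -/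

section MomentumMap

variable {E : Type*} [NormedAddCommGroup E] [NormedSpace ℝ E] [FiniteDimensional ℝ E]
  {EG : Type*} [NormedAddCommGroup EG] [NormedSpace ℝ EG] [FiniteDimensional ℝ EG] {n : ℕ}
  {M : Type*} [TopologicalSpace M] [ChartedSpace E M] [IsManifold 𝓘(ℝ, E) ∞ M]
  {G : Type*} [TopologicalSpace G] [ChartedSpace EG G] [CommGroup G] [LieGroup 𝓘(ℝ, EG) ∞ G]
  [MulAction G M] [ContMDiffSMul 𝓘(ℝ, EG) 𝓘(ℝ, E) ∞ G M]
  [ChartedSpace (EuclideanSpace ℝ (Fin n)) (MulAction.orbitRel.Quotient G M)]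
  [IsManifold (𝓡 n) ∞ (MulAction.orbitRel.Quotient G M)]
  {L : TangentBundle 𝓘(ℝ, E) M → ℝ}

theorem exists_isAdapted_chartAt (hbundle : IsPrincipalBundle E EG n M G) (m : M) :
    ∃ (lam : OpenPartialHomeomorph G EG)
      (e : OpenPartialHomeomorph M E) (K : E ≃L[ℝ] EuclideanSpace ℝ (Fin n) × EG),
      IsLog lam ∧ IsAdapted lam (chartAt (EuclideanSpace ℝ (Fin n)) (orbitProj M G m)) e K ∧
        m ∈ e.source := by
  obtain ⟨lam, hlam⟩ := exists_isLog (EG := EG) (G := G)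
  obtain ⟨e, K, h⟩ := exists_isAdapted hbundle hlam (isPartialDiffeo_chartAt (orbitProj M G m))
    (mem_chart_source _ _)
  exact ⟨lam, e, K, hlam, h⟩

theorem contMDiff_momentum (hbundle : IsPrincipalBundle E EG n M G)
    (hL : ContMDiff 𝓘(ℝ, E).tangent 𝓘(ℝ, ℝ) ∞ L) (ξ : GroupLieAlgebra 𝓘(ℝ, EG) G) :
    ContMDiff 𝓘(ℝ, E).tangent 𝓘(ℝ, ℝ) ∞ (fun w => momentum EG G L w ξ) := by
  intro w
  obtain ⟨lam, e, K, hlam, ha, hw⟩ := exists_isAdapted_chartAt hbundle w.proj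
  have h1 : ContDiffAt ℝ ∞ (fun q => fderiv ℝ (L ∘ (natChart e ha.diffeo).symm) q
      ((0, K.symm (0, ξ)) : E × E)) (natCoord e w) :=
    contDiffAt_fderiv_apply (contDiffAt_lagrangian hL ha.diffeo hw) _
  have h2 := ContMDiffAt.comp w h1.contMDiffAt
    ((isPartialDiffeo_natChart ha.diffeo).contMDiffAt (z := w) hw)
  refine h2.congr_of_eventuallyEq ?_
  filter_upwards [(natChart e ha.diffeo).open_source.mem_nhds (x := w) hw] with w' hw'
  exact ha.momentum_eq hlam hL hw' ξ

theorem dirDeriv_momentum {lam : OpenPartialHomeomorph G EG}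
    {eB : OpenPartialHomeomorph (MulAction.orbitRel.Quotient G M) (EuclideanSpace ℝ (Fin n))}
    {e : OpenPartialHomeomorph M E} {K : E ≃L[ℝ] EuclideanSpace ℝ (Fin n) × EG}
    (ha : IsAdapted lam eB e K) (hlam : IsLog lam) (hbundle : IsPrincipalBundle E EG n M G)
    (hL : ContMDiff 𝓘(ℝ, E).tangent 𝓘(ℝ, ℝ) ∞ L) (ξ : GroupLieAlgebra 𝓘(ℝ, EG) G)
    {w : TangentBundle 𝓘(ℝ, E) M} (hw : w.proj ∈ e.source)
    (Z : TangentSpace 𝓘(ℝ, E).tangent w) :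
    dirDeriv 𝓘(ℝ, E).tangent (fun w' => momentum EG G L w' ξ) w Z
      = fderiv ℝ (fderiv ℝ (L ∘ (natChart e ha.diffeo).symm)) (natCoord e w)
        (mfderiv 𝓘(ℝ, E).tangent 𝓘(ℝ, E × E) (natCoord e) w Z) ((0, K.symm (0, ξ)) : E × E) := by
  have h1 := (isPartialDiffeo_natChart ha.diffeo).dirDeriv_eq (z := w) hw
    ((contMDiff_momentum hbundle hL ξ).mdifferentiableAt (by simp)) Z
  refine (h1.trans ?_).trans (fderiv_fderiv_apply (contDiffAt_lagrangian hL ha.diffeo hw) _ _)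
  refine congrArg (fun T : E × E →L[ℝ] ℝ =>
    T (mfderiv 𝓘(ℝ, E).tangent 𝓘(ℝ, E × E) (natCoord e) w Z)) (Filter.EventuallyEq.fderiv_eq ?_)
  filter_upwards [(natChart e ha.diffeo).open_target.mem_nhds
    ((natChart e ha.diffeo).map_source (x := w) hw)] with q hq
  refine (ha.momentum_eq hlam hL ((natChart e ha.diffeo).symm.map_source hq) ξ).trans ?_
  have h2 : natCoord e ((natChart e ha.diffeo).symm q) = q := (natChart e ha.diffeo).right_inv hq
  rw [h2]

/-- It is enough to test on the vertical lifts of the fundamental vectors: along the lift of `η̃`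
the derivative of the component `ξ` of the momentum is `g(ξ̃, η̃)`. -/
theorem eq_zero_of_dirDeriv_momentum (hbundle : IsPrincipalBundle E EG n M G)
    (hL : ContMDiff 𝓘(ℝ, E).tangent 𝓘(ℝ, ℝ) ∞ L) (hgreg : IsGroupRegular EG G L)
    (w : TangentBundle 𝓘(ℝ, E) M) (ξ : GroupLieAlgebra 𝓘(ℝ, EG) G)
    (h : ∀ Z : TangentSpace 𝓘(ℝ, E).tangent w,
      dirDeriv 𝓘(ℝ, E).tangent (fun w' => momentum EG G L w' ξ) w Z = 0) : ξ = 0 := by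
  obtain ⟨lam, e, K, hlam, ha, hw⟩ := exists_isAdapted_chartAt hbundle w.proj
  refine hgreg w ξ fun η => (ha.hessian_fundamental hlam hL hw ξ η).trans ?_
  rw [fibreHess_apply, fderiv_fderiv_symm (contDiffAt_lagrangian hL ha.diffeo hw)]
  have h1 := (dirDeriv_momentum ha hlam hbundle hL ξ hw _).symm.trans
    (h (mfderiv 𝓘(ℝ, E × E) 𝓘(ℝ, E).tangent (natChart e ha.diffeo).symm (natCoord e w)
      ((0, K.symm (0, η)) : E × E)))
  have h2 := (isPartialDiffeo_natChart ha.diffeo).mfderiv_symm_mfderiv (z := w) hw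
    ((0, K.symm (0, η)) : E × E)
  refine Eq.trans ?_ h1
  exact congrArg (fun q : E × E => fderiv ℝ (fderiv ℝ (L ∘ (natChart e ha.diffeo).symm))
    (natCoord e w) q ((0, K.symm (0, ξ)) : E × E)) h2.symm

/-- The Euler-Lagrange field of an invariant Lagrangian preserves momentum. -/
theorem IsEulerLagrangeField.dirDeriv_momentum_eq_zero (hbundle : IsPrincipalBundle E EG n M G)
    (hL : ContMDiff 𝓘(ℝ, E).tangent 𝓘(ℝ, ℝ) ∞ L)
    (hinv : ∀ (g : G) (w : TangentBundle 𝓘(ℝ, E) M), L (tangentAct g w) = L w)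
    {Γ : ∀ w : TangentBundle 𝓘(ℝ, E) M, TangentSpace 𝓘(ℝ, E).tangent w}
    (hΓ : IsEulerLagrangeField L Γ) (w : TangentBundle 𝓘(ℝ, E) M)
    (ξ : GroupLieAlgebra 𝓘(ℝ, EG) G) :
    dirDeriv 𝓘(ℝ, E).tangent (fun w' => momentum EG G L w' ξ) w (Γ w) = 0 := by
  obtain ⟨lam, e, K, hlam, ha, hw⟩ := exists_isAdapted_chartAt hbundle w.proj
  have hΛ := contDiffAt_lagrangian hL ha.diffeo hw
  obtain ⟨a, h1, h2⟩ := hΓ.isELVector hL ha.diffeo hw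
  -- In a cyclic direction the force `∂L/∂x` vanishes and the Euler-Lagrange equation reads `Γ(p_ξ)
  -- = 0`.
  have h3 := h2 (K.symm (0, ξ))
  rw [elExpr, ha.fderiv_vertical_eq_zero hlam hw hinv (hΛ.differentiableAt (by simp)) ξ,
    fderiv_fderiv_apply hΛ, sub_zero] at h3
  refine (dirDeriv_momentum ha hlam hbundle hL ξ hw (Γ w)).trans ?_
  rw [h1]
  exact h3

end MomentumMap

/-- The Euler-Lagrange field of an invariant Lagrangian is invariant. -/
theorem IsEulerLagrangeField.mfderiv_tangentAct
    {E : Type*} [NormedAddCommGroup E] [NormedSpace ℝ E] [FiniteDimensional ℝ E]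
    {M : Type*} [TopologicalSpace M] [ChartedSpace E M] [IsManifold 𝓘(ℝ, E) ∞ M]
    {G : Type*} [TopologicalSpace G] [CommGroup G] [MulAction G M]
    (EG : Type*) [NormedAddCommGroup EG] [NormedSpace ℝ EG] [ChartedSpace EG G]
    [ContMDiffSMul 𝓘(ℝ, EG) 𝓘(ℝ, E) ∞ G M] {L : TangentBundle 𝓘(ℝ, E) M → ℝ}
    (hL : ContMDiff 𝓘(ℝ, E).tangent 𝓘(ℝ, ℝ) ∞ L)
    (hinv : ∀ (g : G) (w : TangentBundle 𝓘(ℝ, E) M), L (tangentAct g w) = L w)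
    (hreg : IsRegular L) {Γ : ∀ w : TangentBundle 𝓘(ℝ, E) M, TangentSpace 𝓘(ℝ, E).tangent w}
    (hΓ : IsEulerLagrangeField L Γ) (g : G) (w : TangentBundle 𝓘(ℝ, E) M) :
    mfderiv 𝓘(ℝ, E).tangent 𝓘(ℝ, E).tangent (tangentAct (E := E) (M := M) g) w (Γ w)
      = Γ (tangentAct g w) := by
  have hcs : ContinuousSMul G M := ContMDiffSMul.continuousSMul (I := 𝓘(ℝ, EG)) (I' := 𝓘(ℝ, E)) ∞
  set e := chartAt E (g • w.proj)
  have he : IsPartialDiffeo 𝓘(ℝ, E) 𝓘(ℝ, E) e := isPartialDiffeo_chartAt _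
  have hs : (tangentAct g w).proj ∈ e.source := mem_chart_source E _
  have hg : IsPartialDiffeo 𝓘(ℝ, E) 𝓘(ℝ, E)
      (Homeomorph.smul (α := M) g).toOpenPartialHomeomorph :=
    ⟨(contMDiff_smul_left EG g).contMDiffOn, (contMDiff_smul_left EG g⁻¹).contMDiffOn⟩
  -- In the chart `e' = e ∘ g` the point `w` has the coordinates that its image under `g` has in
  -- `e`, and `L` has the same local expression. So the equations at `w` in `e'` are those at the
  -- image in `e`, and uniqueness of the solution gives invariance.
  set e' := (Homeomorph.smul (α := M) g).toOpenPartialHomeomorph.trans e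
  have he' : IsPartialDiffeo 𝓘(ℝ, E) 𝓘(ℝ, E) e' := hg.trans he
  have hmem : ∀ m, m ∈ e'.source ↔ g • m ∈ e.source := fun m => by simp [e']
  have hs' : w.proj ∈ e'.source := (hmem _).2 hs
  have hcoord : ∀ w' : TangentBundle 𝓘(ℝ, E) M, w'.proj ∈ e'.source →
      natCoord e (tangentAct g w') = natCoord e' w' := by
    intro w' hw'
    have h1 : mfderiv 𝓘(ℝ, E) 𝓘(ℝ, E) (e ∘ fun m : M => g • m) w'.proj = _ :=
      mfderiv_comp w'.proj (he.mdifferentiableAt ((hmem _).1 hw'))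
        (mdifferentiableAt_smul_left EG g _)
    exact Prod.ext rfl (congrArg (fun T : E →L[ℝ] E => T w'.2) h1).symm
  have hLs : L ∘ (natChart e' he').symm =ᶠ[𝓝 (natCoord e' w)] L ∘ (natChart e he).symm := by
    filter_upwards [(natChart e' he').open_target.mem_nhds
      ((natChart e' he').map_source (x := w) hs')] with q hq
    obtain ⟨w', h1, rfl⟩ : ∃ w' : TangentBundle 𝓘(ℝ, E) M, w'.proj ∈ e'.source ∧
        natCoord e' w' = q :=
      ⟨_, (natChart e' he').symm.map_source hq, (natChart e' he').right_inv hq⟩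
    have h2 : (natChart e' he').symm (natCoord e' w') = w' :=
      (natChart e' he').left_inv (x := w') h1
    have h3 : (natChart e he).symm (natCoord e (tangentAct g w')) = tangentAct g w' :=
      (natChart e he).left_inv (x := tangentAct g w') ((hmem _).1 h1)
    rw [Function.comp_apply, Function.comp_apply, h2, ← hcoord w' h1, h3, hinv g]
  refine IsELVector.unique hL hreg he hs ?_ (hΓ.isELVector hL he hs)
  obtain ⟨a, h1, h2⟩ := hΓ.isELVector hL he' hs'
  refine ⟨a, ?_, ?_⟩
  · have h3 : mfderiv 𝓘(ℝ, E).tangent 𝓘(ℝ, E × E) (natCoord e ∘ tangentAct g) w = _ :=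
      mfderiv_comp w ((isPartialDiffeo_natChart he).mdifferentiableAt (z := tangentAct g w) hs)
        ((contMDiff_tangentAct EG g).mdifferentiableAt (by simp))
    have h4 : natCoord e ∘ tangentAct g =ᶠ[𝓝 w] natCoord e' := by
      filter_upwards [(natChart e' he').open_source.mem_nhds (x := w) hs'] with w' hw'
      exact hcoord w' hw'
    have h5 : mfderiv 𝓘(ℝ, E).tangent 𝓘(ℝ, E × E) (natCoord e ∘ tangentAct g) w
      = mfderiv 𝓘(ℝ, E).tangent 𝓘(ℝ, E × E) (natCoord e') w := h4.mfderiv_eq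
    have h6 := congrArg (fun T : E × E →L[ℝ] E × E => T (Γ w)) (h3.symm.trans h5)
    refine (h6.trans h1).trans ?_
    rw [hcoord w hs']
  · intro k
    rw [hcoord w hs', ← h2 k]
    have h7 : (fun q => fderiv ℝ (L ∘ (natChart e he).symm) q ((0, k) : E × E))
        =ᶠ[𝓝 (natCoord e' w)] fun q => fderiv ℝ (L ∘ (natChart e' he').symm) q (0, k) := by
      filter_upwards [hLs.eventuallyEq_nhds] with q hq
      rw [hq.fderiv_eq]
    rw [elExpr, elExpr, hLs.fderiv_eq, h7.fderiv_eq]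

/-! ### Local sections of the level sets of momentum in adapted coordinates -/

section FlatSlice

variable {E : Type*} [NormedAddCommGroup E] [NormedSpace ℝ E]
  {EG : Type*} [NormedAddCommGroup EG] [NormedSpace ℝ EG]
  {V : Type*} [NormedAddCommGroup V] [NormedSpace ℝ V]
  {K : E ≃L[ℝ] V × EG} {D : Set E} {Λ : E × E → ℝ} {Ω : E → E →L[ℝ] EG}

theorem symm_mk_zero (K : E ≃L[ℝ] V × EG) : K.symm ((0, 0) : V × EG) = 0 := K.symm.map_zero

/-- The inclusion of the vertical directions in the fibre directions. -/
def vertFibre (K : E ≃L[ℝ] V × EG) : EG →L[ℝ] E × E :=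
  (ContinuousLinearMap.inr ℝ E E).comp
    ((K.symm : V × EG →L[ℝ] E).comp (ContinuousLinearMap.inr ℝ V EG))

/-- The momentum map in adapted coordinates. -/
def flatMomentum (K : E ≃L[ℝ] V × EG) (Λ : E × E → ℝ) (p : E × E) : EG →L[ℝ] ℝ :=
  (fderiv ℝ Λ p).comp (vertFibre K)

theorem hasFDerivAt_flatMomentum {p : E × E} (hΛ : ContDiffAt ℝ ∞ Λ p) :
    HasFDerivAt (flatMomentum K Λ)
      (((ContinuousLinearMap.compL ℝ EG (E × E) ℝ).flip (vertFibre K)).comp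
        (fderiv ℝ (fderiv ℝ Λ) p)) p := by
  have h1 : HasFDerivAt (fderiv ℝ Λ) (fderiv ℝ (fderiv ℝ Λ) p) p :=
    ((hΛ.fderiv_right (m := ∞) (by simp)).differentiableAt (by simp)).hasFDerivAt
  exact HasFDerivAt.comp (g := (ContinuousLinearMap.compL ℝ EG (E × E) ℝ).flip (vertFibre K)) p
    (ContinuousLinearMap.hasFDerivAt _) h1

/-- Base position, horizontal velocity and momentum. -/
def sliceMap (K : E ≃L[ℝ] V × EG) (Λ : E × E → ℝ) (p : E × E) : E × V × (EG →L[ℝ] ℝ) :=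
  (p.1, (K p.2).1, flatMomentum K Λ p)

theorem fderiv_sliceMap {p : E × E} (hΛ : ContDiffAt ℝ ∞ Λ p) (Z : E × E) :
    fderiv ℝ (sliceMap K Λ) p Z
      = (Z.1, (K Z.2).1, (fderiv ℝ (fderiv ℝ Λ) p Z).comp (vertFibre K)) := by
  have h1 : HasFDerivAt (fun p : E × E => (K p.2).1)
      ((ContinuousLinearMap.fst ℝ V EG).comp
        ((K : E →L[ℝ] V × EG).comp (ContinuousLinearMap.snd ℝ E E))) p :=
    ((ContinuousLinearMap.fst ℝ V EG).comp
        ((K : E →L[ℝ] V × EG).comp (ContinuousLinearMap.snd ℝ E E))).hasFDerivAt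
  have h2 : HasFDerivAt (sliceMap K Λ) _ p :=
    hasFDerivAt_fst.prodMk (h1.prodMk (hasFDerivAt_flatMomentum hΛ))
  rw [h2.fderiv]
  rfl

namespace IsFlatSystem

theorem contDiffAt_sliceMap (h : IsFlatSystem K D Λ Ω) {p : E × E} (hp : p.1 ∈ D) :
    ContDiffAt ℝ ∞ (sliceMap K Λ) p := by
  refine contDiffAt_fst.prodMk (ContDiffAt.prodMk ?_ ?_)
  · exact contDiff_fst.contDiffAt.comp p (K.contDiff.contDiffAt.comp p contDiffAt_snd)
  · exact ((h.smooth p hp).fderiv_right (m := ∞) (by simp)).clm_comp contDiffAt_const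

/-- A vector in the kernel of the derivative has no position component and no horizontal velocity
component, so it is a vertical velocity. On vertical velocities the derivative of the momentum is
the matrix `g(ξ̃, η̃)`, hence injective. Dimensions agree, since the dual of `EG` replaces `EG`, and
the inverse function theorem applies. -/
theorem exists_sliceDiffeo [FiniteDimensional ℝ E] [FiniteDimensional ℝ V]
    [FiniteDimensional ℝ EG] (h : IsFlatSystem K D Λ Ω) {p : E × E} (hp : p.1 ∈ D) :
    ∃ κ : OpenPartialHomeomorph (E × E) (E × V × (EG →L[ℝ] ℝ)),
      IsPartialDiffeo 𝓘(ℝ, E × E) 𝓘(ℝ, E × V × (EG →L[ℝ] ℝ)) κ ∧ p ∈ κ.source ∧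
        κ.source ⊆ Prod.fst ⁻¹' D ∧ ∀ y, κ y = sliceMap K Λ y := by
  have := FiniteDimensional.complete ℝ (E × E)
  have := FiniteDimensional.complete ℝ (E × V × (EG →L[ℝ] ℝ))
  refine exists_isPartialDiffeo_of_isInvertible_fderiv (h.isOpen.preimage continuous_fst)
    (fun q hq => (h.contDiffAt_sliceMap hq).contDiffWithinAt) hp ?_
  have hinj : Function.Injective
      (fderiv ℝ (sliceMap K Λ) p : E × E →ₗ[ℝ] E × V × (EG →L[ℝ] ℝ)) := by
    rw [← LinearMap.ker_eq_bot, LinearMap.ker_eq_bot']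
    intro Z hZ
    have hZ' : fderiv ℝ (sliceMap K Λ) p Z = 0 := hZ
    rw [fderiv_sliceMap (h.smooth p hp)] at hZ'
    obtain ⟨h1, h2⟩ := Prod.ext_iff.1 hZ'
    obtain ⟨h3, h4⟩ := Prod.ext_iff.1 h2
    simp only [Prod.fst_zero, Prod.snd_zero] at h1 h3 h4
    obtain ⟨a, b⟩ := Z
    have hb : b = K.symm (0, (K b).2) := by
      rw [K.eq_symm_apply]
      exact Prod.ext h3 rfl
    simp only at h1
    subst h1
    have h5 : (K b).2 = 0 := by
      refine h.group_regular p hp _ fun η => ?_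
      rw [← hb, fibreHess_apply]
      exact DFunLike.congr_fun h4 η
    rw [hb, h5]
    simp
  have hdual : Module.finrank ℝ (EG →L[ℝ] ℝ) = Module.finrank ℝ EG := by
    rw [← Subspace.dual_finrank_eq (K := ℝ) (V := EG)]
    exact (LinearMap.toContinuousLinearMap (𝕜 := ℝ) (E := EG) (F' := ℝ)).finrank_eq.symm
  have hK : Module.finrank ℝ E = Module.finrank ℝ V + Module.finrank ℝ EG := by
    rw [K.toLinearEquiv.finrank_eq, Module.finrank_prod]
  have hfin : Module.finrank ℝ (E × E) = Module.finrank ℝ (E × V × (EG →L[ℝ] ℝ)) := by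
    rw [Module.finrank_prod, Module.finrank_prod, Module.finrank_prod, hdual, ← hK]
  exact ⟨(LinearEquiv.ofInjectiveOfFinrankEq _ hinj hfin).toContinuousLinearEquiv, by ext <;> rfl⟩

end IsFlatSystem

/-- `q` is, over the open set `O` of positions and velocities `(x, v)`, a section of the level set
`μ` of momentum through `p`, with constant vertical position. -/
structure IsSlice (K : E ≃L[ℝ] V × EG) (D : Set E) (Λ : E × E → ℝ) (μ : EG →L[ℝ] ℝ) (p : E × E)
    (O : Set (V × V)) (q : V × V → E × E) : Prop where
  isOpen : IsOpen O
  mem : ((K p.1).1, (K p.2).1) ∈ O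
  apply_mem : q ((K p.1).1, (K p.2).1) = p
  smooth : ContDiffOn ℝ ∞ q O
  mem_dom : ∀ y ∈ O, (q y).1 ∈ D
  position : ∀ y ∈ O, (q y).1 = K.symm (y.1, (K p.1).2)
  velocity : ∀ y ∈ O, (K (q y).2).1 = y.2
  momentum : ∀ y ∈ O, flatMomentum K Λ (q y) = μ
  unique : ∀ᶠ p' in 𝓝 p, (K p'.1).2 = (K p.1).2 → flatMomentum K Λ p' = μ →
    p' = q ((K p'.1).1, (K p'.2).1)

variable [FiniteDimensional ℝ E] [FiniteDimensional ℝ V] [FiniteDimensional ℝ EG]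

/-- The inverse of the slice map is restricted to the points with momentum `μ` and the group
coordinate of `p`. What remains free are the base position and the horizontal velocity. -/
theorem IsFlatSystem.exists_isSlice (h : IsFlatSystem K D Λ Ω) {p : E × E} (hp : p.1 ∈ D) :
    ∃ O q, IsSlice K D Λ (flatMomentum K Λ p) p O q := by
  obtain ⟨κ, hκ, hps, hκD, hκv⟩ := h.exists_sliceDiffeo hp
  set μ := flatMomentum K Λ p with hμ
  let T : V × V → E × V × (EG →L[ℝ] ℝ) := fun y => (K.symm (y.1, (K p.1).2), y.2, μ)
  have hT : ContDiff ℝ ∞ T := by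
    refine (K.symm.contDiff.comp ?_).prodMk (contDiff_snd.prodMk contDiff_const)
    exact contDiff_fst.prodMk contDiff_const
  have hTp : ∀ p' : E × E, (K p'.1).2 = (K p.1).2 → flatMomentum K Λ p' = μ →
      T ((K p'.1).1, (K p'.2).1) = κ p' := by
    intro p' h1 h2
    rw [hκv]
    refine Prod.ext ?_ (Prod.ext rfl h2.symm)
    show K.symm ((K p'.1).1, (K p.1).2) = p'.1
    rw [← h1, Prod.mk.eta, K.symm_apply_apply]
  have hspec : ∀ y ∈ T ⁻¹' κ.target, sliceMap K Λ (κ.symm (T y)) = T y := by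
    intro y hy
    rw [← hκv, κ.right_inv hy]
  refine ⟨T ⁻¹' κ.target, κ.symm ∘ T, ⟨κ.open_target.preimage hT.continuous, ?_, ?_, ?_, ?_, ?_,
    ?_, ?_, ?_⟩⟩
  · show T _ ∈ κ.target
    rw [hTp p rfl rfl]
    exact κ.map_source hps
  · show κ.symm (T _) = p
    rw [hTp p rfl rfl, κ.left_inv hps]
  · exact hκ.smooth_symm.contDiffOn.comp hT.contDiffOn (fun y hy => hy)
  · exact fun y hy => hκD (κ.map_target hy)
  · exact fun y hy => congrArg Prod.fst (hspec y hy)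
  · exact fun y hy => congrArg (fun z => z.2.1) (hspec y hy)
  · exact fun y hy => congrArg (fun z => z.2.2) (hspec y hy)
  · filter_upwards [κ.open_source.mem_nhds hps] with p' hp' h1 h2
    show p' = κ.symm (T _)
    rw [hTp p' h1 h2, κ.left_inv hp']

/-- Tangent vectors of the level set of momentum are velocities of curves in it. -/
theorem IsFlatSystem.exists_curve (h : IsFlatSystem K D Λ Ω) {p : E × E} (hp : p.1 ∈ D) {Z : E × E}
    (hZ : ∀ ξ, fderiv ℝ (fderiv ℝ Λ) p Z (0, K.symm (0, ξ)) = 0) :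
    ∃ j : ℝ → E × E, j 0 = p ∧ HasDerivAt j Z 0 ∧
      ∀ᶠ t in 𝓝 0, (j t).1 ∈ D ∧ flatMomentum K Λ (j t) = flatMomentum K Λ p := by
  obtain ⟨κ, hκ, hps, hκD, hκv⟩ := h.exists_sliceDiffeo hp
  set Z' := fderiv ℝ (sliceMap K Λ) p Z with hZ'
  have hZ'2 : Z'.2.2 = 0 := by
    rw [hZ', fderiv_sliceMap (h.smooth p hp)]
    ext ξ
    exact hZ ξ
  -- A straight line in the slice coordinates; its momentum component is constant because `Z` is
  -- annihilated by the differential of the momentum.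
  let c : ℝ → E × V × (EG →L[ℝ] ℝ) := fun t => κ p + t • Z'
  have hc : HasDerivAt c Z' 0 := by
    have h1 := ((hasDerivAt_id (0 : ℝ)).smul_const Z').const_add (κ p)
    rwa [one_smul] at h1
  have hc0 : c 0 = κ p := by simp [c]
  have hpt := κ.map_source hps
  have hev : ∀ᶠ t in 𝓝 0, c t ∈ κ.target :=
    hc.continuousAt.eventually (κ.open_target.mem_nhds (by rwa [hc0]))
  have hκfun : (κ : E × E → _) = sliceMap K Λ := funext hκv
  have hsymm : HasFDerivAt κ.symm (fderiv ℝ κ.symm (κ p)) (κ p) :=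
    ((hκ.contMDiffAt_symm hpt).contDiffAt.differentiableAt (by simp)).hasFDerivAt
  refine ⟨κ.symm ∘ c, ?_, ?_, ?_⟩
  · rw [Function.comp_apply, hc0, κ.left_inv hps]
  · have h1 : HasDerivAt (κ.symm ∘ c) (fderiv ℝ κ.symm (κ p) Z') 0 :=
      HasFDerivAt.comp_hasDerivAt (l := κ.symm) 0 (by rwa [hc0]) hc
    have h2 := hκ.symm_mfderiv_mfderiv hps Z
    rw [mfderiv_eq_fderiv, mfderiv_eq_fderiv] at h2
    have h3 : fderiv ℝ κ p Z = Z' := by rw [hκfun]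
    rw [← h3] at h1
    rwa [show fderiv ℝ κ.symm (κ p) (fderiv ℝ κ p Z) = Z from h2] at h1
  · filter_upwards [hev] with t ht
    refine ⟨hκD (κ.map_target ht), ?_⟩
    have h1 : sliceMap K Λ (κ.symm (c t)) = c t := by rw [← hκv, κ.right_inv ht]
    have h2 : flatMomentum K Λ (κ.symm (c t)) = (c t).2.2 := congrArg (fun z => z.2.2) h1
    rw [Function.comp_apply, h2]
    simp only [c, Prod.snd_add, Prod.smul_snd, hZ'2, smul_zero, add_zero, hκv]
    rfl

end FlatSlice

/-! ### Routh's equations in adapted coordinates -/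

section FlatRouth

variable {E : Type*} [NormedAddCommGroup E] [NormedSpace ℝ E]
  {EG : Type*} [NormedAddCommGroup EG] [NormedSpace ℝ EG]
  {V : Type*} [NormedAddCommGroup V] [NormedSpace ℝ V]
  {K : E ≃L[ℝ] V × EG} {D : Set E} {Λ : E × E → ℝ} {Ω : E → E →L[ℝ] EG}
  {μ : EG →L[ℝ] ℝ} {p₀ : E × E} {O : Set (V × V)} {q : V × V → E × E}

/-- The reduced Routhian in terms of a section of the level set of momentum. -/
def flatRouthian (Λ : E × E → ℝ) (Ω : E → E →L[ℝ] EG) (μ : EG →L[ℝ] ℝ) (q : V × V → E × E)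
    (y : V × V) : ℝ :=
  Λ (q y) - μ (Ω (q y).1 (q y).2)

namespace IsSlice

theorem contDiffAt (hq : IsSlice K D Λ μ p₀ O q) {y : V × V} (hy : y ∈ O) :
    ContDiffAt ℝ ∞ q y :=
  hq.smooth.contDiffAt (hq.isOpen.mem_nhds hy)

theorem hasFDerivAt (hq : IsSlice K D Λ μ p₀ O q) {y : V × V} (hy : y ∈ O) :
    HasFDerivAt q (fderiv ℝ q y) y :=
  ((hq.contDiffAt hy).differentiableAt (by simp)).hasFDerivAt

theorem fst_fderiv (hq : IsSlice K D Λ μ p₀ O q) {y : V × V} (hy : y ∈ O) (Y : V × V) :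
    (fderiv ℝ q y Y).1 = K.symm (Y.1, 0) := by
  have h1 : HasFDerivAt (fun y => (q y).1) _ y := (hq.hasFDerivAt hy).fst
  have h2 : HasFDerivAt (fun y : V × V => K.symm (y.1, (K p₀.1).2)) _ y :=
    (K.symm : V × EG →L[ℝ] E).hasFDerivAt.comp y
      ((hasFDerivAt_fst (𝕜 := ℝ) (p := y)).prodMk (hasFDerivAt_const ((K p₀.1).2) y))
  have h3 : (fun y => (q y).1) =ᶠ[𝓝 y] fun y : V × V => K.symm (y.1, (K p₀.1).2) := by
    filter_upwards [hq.isOpen.mem_nhds hy] with z hz using hq.position z hz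
  exact DFunLike.congr_fun (h1.unique (h2.congr_of_eventuallyEq h3)) Y

theorem fst_snd_fderiv (hq : IsSlice K D Λ μ p₀ O q) {y : V × V} (hy : y ∈ O) (Y : V × V) :
    (K (fderiv ℝ q y Y).2).1 = Y.2 := by
  have h1 : HasFDerivAt (fun y => (K (q y).2).1) _ y :=
    ((K : E →L[ℝ] V × EG).hasFDerivAt.comp y (hq.hasFDerivAt hy).snd).fst
  have h3 : (fun y => (K (q y).2).1) =ᶠ[𝓝 y] fun y : V × V => y.2 := by
    filter_upwards [hq.isOpen.mem_nhds hy] with z hz using hq.velocity z hz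
  exact DFunLike.congr_fun (h1.unique (hasFDerivAt_snd.congr_of_eventuallyEq h3)) Y

theorem fderiv_momentum (hq : IsSlice K D Λ μ p₀ O q) (h : IsFlatSystem K D Λ Ω) {y : V × V}
    (hy : y ∈ O) (Y : V × V) (ξ : EG) :
    fderiv ℝ (fderiv ℝ Λ) (q y) (fderiv ℝ q y Y) (0, K.symm (0, ξ)) = 0 := by
  have h1 : HasFDerivAt (flatMomentum K Λ ∘ q) _ y :=
    HasFDerivAt.comp y (hasFDerivAt_flatMomentum (h.smooth _ (hq.mem_dom y hy)))
      (hq.hasFDerivAt hy)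
  have h3 : flatMomentum K Λ ∘ q =ᶠ[𝓝 y] fun _ : V × V => μ := by
    filter_upwards [hq.isOpen.mem_nhds hy] with z hz using hq.momentum z hz
  have h4 := h1.unique ((hasFDerivAt_const μ y).congr_of_eventuallyEq h3)
  exact DFunLike.congr_fun (DFunLike.congr_fun h4 Y) ξ

/-- The velocity of the section, decomposed into horizontal and vertical parts. -/
theorem snd_fderiv (hq : IsSlice K D Λ μ p₀ O q) {y : V × V} (hy : y ∈ O) (Y : V × V) :
    (fderiv ℝ q y Y).2 = K.symm (Y.2, 0) + K.symm (0, (K (fderiv ℝ q y Y).2).2) := by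
  rw [← map_add, K.eq_symm_apply]
  exact Prod.ext (by simp [hq.fst_snd_fderiv hy Y]) (by simp)

theorem apply_snd (hq : IsSlice K D Λ μ p₀ O q) {y : V × V} (hy : y ∈ O) :
    (q y).2 = K.symm (y.2, 0) + K.symm (0, (K (q y).2).2) := by
  rw [← map_add, K.eq_symm_apply]
  exact Prod.ext (by simp [hq.velocity y hy]) (by simp)

theorem hasFDerivAt_form (hq : IsSlice K D Λ μ p₀ O q) (h : IsFlatSystem K D Λ Ω) {y : V × V}
    (hy : y ∈ O) : HasFDerivAt (fun y => Ω (q y).1)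
      ((fderiv ℝ Ω (q y).1).comp ((ContinuousLinearMap.fst ℝ E E).comp (fderiv ℝ q y))) y :=
  HasFDerivAt.comp (g := Ω) (f := fun y => (q y).1) y
    ((h.form_smooth _ (hq.mem_dom y hy)).differentiableAt (by simp)).hasFDerivAt
    (hq.hasFDerivAt hy).fst

theorem contDiffAt_flatRouthian (hq : IsSlice K D Λ μ p₀ O q) (h : IsFlatSystem K D Λ Ω)
    {y : V × V} (hy : y ∈ O) : ContDiffAt ℝ ∞ (flatRouthian Λ Ω μ q) y := by
  have h1 := hq.contDiffAt hy
  refine (ContDiffAt.comp y (h.smooth _ (hq.mem_dom y hy)) h1).sub ?_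
  refine μ.contDiff.contDiffAt.comp y (ContDiffAt.clm_apply ?_ h1.snd)
  exact ContDiffAt.comp (g := Ω) y (h.form_smooth _ (hq.mem_dom y hy)) h1.fst

/-- The derivative of the section has an unknown vertical velocity component `η`. It enters as `μ η`
through `Λ`, because the momentum is `μ` along the section, and as `-μ (Ω η) = -μ η` through the
connection term. Cancellation of the two is the purpose of subtracting `⟨p, ω⟩` from the Lagrangian.
-/
theorem fderiv_flatRouthian (hq : IsSlice K D Λ μ p₀ O q) (h : IsFlatSystem K D Λ Ω)
    {y : V × V} (hy : y ∈ O) (Y : V × V) :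
    fderiv ℝ (flatRouthian Λ Ω μ q) y Y
      = fderiv ℝ Λ (q y) (K.symm (Y.1, 0), K.symm (Y.2, 0))
        - μ (fderiv ℝ Ω (q y).1 (K.symm (Y.1, 0)) (q y).2) - μ (Ω (q y).1 (K.symm (Y.2, 0))) := by
  have hD := hq.mem_dom y hy
  have h1 : HasFDerivAt (fun y => Λ (q y)) _ y :=
    HasFDerivAt.comp (g := Λ) y ((h.smooth _ hD).differentiableAt (by simp)).hasFDerivAt
      (hq.hasFDerivAt hy)
  have h2 := (hq.hasFDerivAt_form h hy).clm_apply (hq.hasFDerivAt hy).snd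
  have h3 : HasFDerivAt (flatRouthian Λ Ω μ q) _ y :=
    h1.sub (HasFDerivAt.comp (g := μ) y μ.hasFDerivAt h2)
  rw [h3.fderiv]
  have h4 : fderiv ℝ q y Y = (K.symm (Y.1, 0), (fderiv ℝ q y Y).2) :=
    Prod.ext (hq.fst_fderiv hy Y) rfl
  have h5 := hq.snd_fderiv hy Y
  set η := (K (fderiv ℝ q y Y).2).2
  have h6 : fderiv ℝ q y Y
      = (K.symm (Y.1, 0), K.symm (Y.2, 0)) + (0, K.symm (0, η)) := by
    rw [h4, h5]; simp
  have h7 : fderiv ℝ Λ (q y) (0, K.symm (0, η)) = μ η :=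
    DFunLike.congr_fun (hq.momentum y hy) η
  have h8 := h.form_vert _ hD η
  simp only [sub_apply, ContinuousLinearMap.comp_apply, add_apply,
    ContinuousLinearMap.flip_apply, ContinuousLinearMap.coe_fst', ContinuousLinearMap.coe_snd']
  rw [h6, map_add, h7]
  simp only [Prod.fst_add, Prod.snd_add, map_add, add_zero, h8]
  ring

/-- The velocity derivatives of the Routhian are those of `Λ` in horizontal directions minus the
connection coefficients `μ (Ω k)`, throughout a neighbourhood. The latter depend on the position
only, so only `Y.1` appears in the correction. -/
theorem fderiv_fderiv_flatRouthian (hq : IsSlice K D Λ μ p₀ O q) (h : IsFlatSystem K D Λ Ω)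
    {y : V × V} (hy : y ∈ O) (k : V) (Y : V × V) :
    fderiv ℝ (fun z => fderiv ℝ (flatRouthian Λ Ω μ q) z (0, k)) y Y
      = fderiv ℝ (fderiv ℝ Λ) (q y) (fderiv ℝ q y Y) (0, K.symm (k, 0))
        - μ (fderiv ℝ Ω (q y).1 (K.symm (Y.1, 0)) (K.symm (k, 0))) := by
  have hD := hq.mem_dom y hy
  have h1 : (fun z => fderiv ℝ (flatRouthian Λ Ω μ q) z (0, k)) =ᶠ[𝓝 y]
      fun z => fderiv ℝ Λ (q z) (0, K.symm (k, 0)) - μ (Ω (q z).1 (K.symm (k, 0))) := by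
    filter_upwards [hq.isOpen.mem_nhds hy] with z hz
    rw [hq.fderiv_flatRouthian h hz]
    simp [symm_mk_zero]
  have h2 : HasFDerivAt (fun z => fderiv ℝ Λ (q z)) _ y :=
    HasFDerivAt.comp (g := fderiv ℝ Λ) y
      (((h.smooth _ hD).fderiv_right (m := ∞) (by simp)).differentiableAt (by simp)).hasFDerivAt
      (hq.hasFDerivAt hy)
  have h3 := h2.clm_apply (hasFDerivAt_const ((0, K.symm (k, 0)) : E × E) y)
  have h4 := (hq.hasFDerivAt_form h hy).clm_apply (hasFDerivAt_const (K.symm (k, 0)) y)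
  have h5 := h3.sub (HasFDerivAt.comp (g := μ) y μ.hasFDerivAt h4)
  rw [h1.fderiv_eq]
  refine (DFunLike.congr_fun h5.fderiv Y).trans ?_
  have h6 := hq.fst_fderiv hy Y
  simp only [sub_apply, ContinuousLinearMap.comp_apply, add_apply,
    ContinuousLinearMap.flip_apply, ContinuousLinearMap.coe_fst', zero_apply, map_zero, zero_add,
    h6]

/-- A vector of the level set of momentum with horizontal components `(Y.1, Y.2)` coincides with
the derivative of the section up to the action of the group. -/
theorem fderiv_fderiv_eq (hq : IsSlice K D Λ μ p₀ O q) (h : IsFlatSystem K D Λ Ω) {y : V × V}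
    (hy : y ∈ O) {Z : E × E}
    (hZ : ∀ ξ, fderiv ℝ (fderiv ℝ Λ) (q y) Z (0, K.symm (0, ξ)) = 0) (k : E × E) :
    fderiv ℝ (fderiv ℝ Λ) (q y) (fderiv ℝ q y ((K Z.1).1, (K Z.2).1)) k
      = fderiv ℝ (fderiv ℝ Λ) (q y) Z k := by
  have hD := hq.mem_dom y hy
  -- Differentiating the invariance of `Λ`: shifts of the group coordinate lie in the kernel of the
  -- full second derivative.
  have hinv : ∀ η, fderiv ℝ (fderiv ℝ Λ) (q y) (K.symm (0, η), 0) = 0 := by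
    intro η
    refine ContinuousLinearMap.ext fun k => ?_
    rw [fderiv_fderiv_symm (h.smooth _ hD), ← fderiv_fderiv_apply (h.smooth _ hD)]
    have h1 : (fun p => fderiv ℝ Λ p (K.symm (0, η), 0)) =ᶠ[𝓝 (q y)] fun _ => 0 := by
      filter_upwards [(h.isOpen.preimage continuous_fst).mem_nhds hD] with p hp
      exact h.inv p hp η
    rw [h1.fderiv_eq]
    simp
  set Y : V × V := ((K Z.1).1, (K Z.2).1) with hY
  set W := Z - fderiv ℝ q y Y with hW
  have h1 : W.1 = K.symm (0, (K Z.1).2) := by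
    rw [hW, Prod.fst_sub, hq.fst_fderiv hy, K.eq_symm_apply, map_sub, K.apply_symm_apply]
    exact Prod.ext (by simp [hY]) (by simp)
  have h2 : W.2 = K.symm (0, (K W.2).2) := by
    rw [K.eq_symm_apply]
    refine Prod.ext ?_ rfl
    rw [hW, Prod.snd_sub, map_sub, Prod.fst_sub, hq.fst_snd_fderiv hy]
    simp [hY]
  -- The difference `W` is a shift of the group coordinate plus a vertical velocity. The first is
  -- harmless by invariance. Since both `Z` and the derivative of the section preserve the momentum,
  -- the second is killed by the matrix `g(ξ̃, η̃)` and so is zero.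
  have h3 : W = (K.symm (0, (K Z.1).2), 0) + (0, K.symm (0, (K W.2).2)) := by
    rw [← h1, ← h2]; simp
  have h4 : (K W.2).2 = 0 := by
    refine h.group_regular (q y) hD _ fun η => ?_
    rw [fibreHess_apply]
    have h5 : fderiv ℝ (fderiv ℝ Λ) (q y) W (0, K.symm (0, η)) = 0 := by
      rw [hW, map_sub, sub_apply, hZ, hq.fderiv_momentum h hy, sub_zero]
    rw [h3, map_add, hinv, zero_add] at h5
    exact h5
  have h6 : fderiv ℝ (fderiv ℝ Λ) (q y) W = 0 := by
    rw [h3, map_add, hinv, h4, zero_add, symm_mk_zero]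
    exact map_zero _
  rw [hW, map_sub, sub_eq_zero] at h6
  rw [h6]

/-- Routh's equations. -/
theorem routh_equation (hq : IsSlice K D Λ μ p₀ O q) (h : IsFlatSystem K D Λ Ω) {y : V × V}
    (hy : y ∈ O) {a : E} (hEL : ∀ k, elExpr Λ (q y) ((q y).2, a) k = 0) (k : V) :
    fderiv ℝ (fun z => fderiv ℝ (flatRouthian Λ Ω μ q) z (0, k)) y (y.2, (K a).1)
        - fderiv ℝ (flatRouthian Λ Ω μ q) y (k, 0)
      = μ (fderiv ℝ Ω (q y).1 (K.symm (k, 0)) (K.symm (y.2, 0)))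
        - μ (fderiv ℝ Ω (q y).1 (K.symm (y.2, 0)) (K.symm (k, 0))) := by
  have hD := hq.mem_dom y hy
  have hEL' : ∀ k, fderiv ℝ (fderiv ℝ Λ) (q y) ((q y).2, a) (0, k) = fderiv ℝ Λ (q y) (k, 0) := by
    intro k
    have h1 := hEL k
    rw [elExpr, fderiv_fderiv_apply (h.smooth _ hD)] at h1
    exact sub_eq_zero.1 h1
  -- By the Euler-Lagrange equations in vertical directions, the second-order vector preserves the
  -- momentum. It may thus be exchanged for the derivative of the section along `(v, (K a).1)`.
  have h2 := hq.fderiv_fderiv_eq h hy (Z := ((q y).2, a))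
    (fun ξ => by rw [hEL', h.inv _ hD]) (0, K.symm (k, 0))
  simp only [hq.velocity y hy] at h2
  -- The vertical part of the velocity drops out: `Ω` reproduces vertical vectors at every point, so
  -- on them it is constant in the position.
  have h3 : fderiv ℝ Ω (q y).1 (K.symm (k, 0)) (q y).2
      = fderiv ℝ Ω (q y).1 (K.symm (k, 0)) (K.symm (y.2, 0)) := by
    have h4 : (fun x => Ω x (K.symm (0, (K (q y).2).2))) =ᶠ[𝓝 (q y).1]
        fun _ => (K (q y).2).2 := by
      filter_upwards [h.isOpen.mem_nhds hD] with x hx using h.form_vert x hx _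
    have h5 := ((h.form_smooth _ hD).differentiableAt (by simp)).hasFDerivAt.clm_apply
      (hasFDerivAt_const (K.symm (0, (K (q y).2).2)) (q y).1)
    have h6 := h5.unique ((hasFDerivAt_const _ _).congr_of_eventuallyEq h4)
    have h7 := DFunLike.congr_fun h6 (K.symm (k, 0))
    simp only [add_apply, ContinuousLinearMap.comp_apply, ContinuousLinearMap.flip_apply,
      zero_apply, map_zero, zero_add] at h7
    conv_lhs => rw [hq.apply_snd hy, map_add, h7, add_zero]
  rw [hq.fderiv_fderiv_flatRouthian h hy, hq.fderiv_flatRouthian h hy, h2, hEL', h3]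
  simp only [symm_mk_zero, map_zero]
  ring

/-- The reduced Routhian is regular. -/
theorem eq_zero_of_fderiv_fderiv (hq : IsSlice K D Λ μ p₀ O q) (h : IsFlatSystem K D Λ Ω)
    {y : V × V} (hy : y ∈ O) {a : V}
    (ha : ∀ k, fderiv ℝ (fun z => fderiv ℝ (flatRouthian Λ Ω μ q) z (0, k)) y (0, a) = 0) :
    a = 0 := by
  have hD := hq.mem_dom y hy
  have h1 : fderiv ℝ q y (0, a) = (0, (fderiv ℝ q y (0, a)).2) :=
    Prod.ext (by simpa [symm_mk_zero] using hq.fst_fderiv hy (0, a)) rfl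
  -- The lift of `(0, a)` through the section is a fibre vector. Its Hessian pairing with vertical
  -- directions vanishes because the momentum is constant along the section, and with horizontal
  -- ones by `ha`; regularity of `Λ` makes it zero.
  have h2 : (fderiv ℝ q y (0, a)).2 = 0 := by
    refine h.regular (q y) hD _ fun k => ?_
    rw [fibreHess_apply, ← h1]
    have h3 : ((0, k) : E × E) = (0, K.symm ((K k).1, 0)) + (0, K.symm (0, (K k).2)) := by
      rw [Prod.mk_add_mk, ← map_add, add_zero, Prod.mk_add_mk, add_zero, zero_add, Prod.mk.eta,
        K.symm_apply_apply]
    rw [h3, map_add, hq.fderiv_momentum h hy, add_zero]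
    have h4 := ha (K k).1
    rw [hq.fderiv_fderiv_flatRouthian h hy] at h4
    simpa [symm_mk_zero] using h4
  have h5 := hq.fst_snd_fderiv hy (0, a)
  rw [h2] at h5
  simpa using h5.symm

end IsSlice

end FlatRouth

/-! ### Local sections of `N_μ → T(M/G)` -/

section TangentProj

variable {E : Type*} [NormedAddCommGroup E] [NormedSpace ℝ E]
  {n : ℕ} {M : Type*} [TopologicalSpace M] [ChartedSpace E M]
  {G : Type*} [TopologicalSpace G] [CommGroup G] [MulAction G M]
  [ChartedSpace (EuclideanSpace ℝ (Fin n)) (MulAction.orbitRel.Quotient G M)]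

variable (E n M G) in
/-- The tangent map of the projection `M → M / G`. -/
abbrev tangentProj (w : TangentBundle 𝓘(ℝ, E) M) :
    TangentBundle (𝓡 n) (MulAction.orbitRel.Quotient G M) :=
  tangentMap 𝓘(ℝ, E) (𝓡 n) (orbitProj M G) w

variable {EG : Type*} [NormedAddCommGroup EG] [NormedSpace ℝ EG] [ChartedSpace EG G]

theorem contMDiff_tangentProj [IsManifold 𝓘(ℝ, E) ∞ M]
    [IsManifold (𝓡 n) ∞ (MulAction.orbitRel.Quotient G M)]
    (hbundle : IsPrincipalBundle E EG n M G) :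
    ContMDiff 𝓘(ℝ, E).tangent (𝓡 n).tangent ∞ (tangentProj E n M G) := by
  have h := contMDiffOn_tangentMap isOpen_univ (contMDiff_orbitProj hbundle).contMDiffOn
  rwa [preimage_univ, contMDiffOn_univ] at h

theorem tangentProj_tangentAct [ContMDiffSMul 𝓘(ℝ, EG) 𝓘(ℝ, E) ∞ G M]
    (hbundle : IsPrincipalBundle E EG n M G) (g : G) (w : TangentBundle 𝓘(ℝ, E) M) :
    tangentProj E n M G (tangentAct g w) = tangentProj E n M G w := by
  have h1 : orbitProj M G ∘ (fun m : M => g • m) = orbitProj M G :=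
    funext fun m => orbitProj_smul g m
  have h2 := tangentMap_comp_at (I := 𝓘(ℝ, E)) (I' := 𝓘(ℝ, E)) (I'' := 𝓡 n) w
    (g := orbitProj M G) (f := fun m : M => g • m)
    ((contMDiff_orbitProj hbundle).mdifferentiableAt (by simp))
    (mdifferentiableAt_smul_left EG g w.proj)
  rw [h1] at h2
  exact h2.symm

end TangentProj

/-! ### Adapted coordinates combined with a local section of the momentum level. -/

section RouthChart

variable {E : Type*} [NormedAddCommGroup E] [NormedSpace ℝ E] [FiniteDimensional ℝ E]
  {EG : Type*} [NormedAddCommGroup EG] [NormedSpace ℝ EG] [FiniteDimensional ℝ EG] {n : ℕ}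
  {M : Type*} [TopologicalSpace M] [ChartedSpace E M] [IsManifold 𝓘(ℝ, E) ∞ M]
  {G : Type*} [TopologicalSpace G] [ChartedSpace EG G] [CommGroup G] [LieGroup 𝓘(ℝ, EG) ∞ G]
  [MulAction G M] [ContMDiffSMul 𝓘(ℝ, EG) 𝓘(ℝ, E) ∞ G M]
  [ChartedSpace (EuclideanSpace ℝ (Fin n)) (MulAction.orbitRel.Quotient G M)]
  [IsManifold (𝓡 n) ∞ (MulAction.orbitRel.Quotient G M)]

/-- Adapted coordinates around `w ∈ TM`, together with a local section of the level set of
momentum through `w`. -/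
structure RouthChart (A : PrincipalConnection E EG M G) (L : TangentBundle 𝓘(ℝ, E) M → ℝ)
    (μ : GroupLieAlgebra 𝓘(ℝ, EG) G →L[ℝ] ℝ)
    (eB : OpenPartialHomeomorph (MulAction.orbitRel.Quotient G M) (EuclideanSpace ℝ (Fin n)))
    (w : TangentBundle 𝓘(ℝ, E) M) where
  /-- The logarithm of `G`. -/
  lam : OpenPartialHomeomorph G EG
  /-- The adapted chart of `M`. -/
  e : OpenPartialHomeomorph M E
  /-- The decomposition of the model space. -/
  K : E ≃L[ℝ] EuclideanSpace ℝ (Fin n) × EG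
  /-- The domain of the section, in coordinates. -/
  O : Set (EuclideanSpace ℝ (Fin n) × EuclideanSpace ℝ (Fin n))
  /-- The section, in coordinates. -/
  q : EuclideanSpace ℝ (Fin n) × EuclideanSpace ℝ (Fin n) → E × E
  bundle : IsPrincipalBundle E EG n M G
  smooth : ContMDiff 𝓘(ℝ, E).tangent 𝓘(ℝ, ℝ) ∞ L
  invariant : ∀ (g : G) (w : TangentBundle 𝓘(ℝ, E) M), L (tangentAct g w) = L w
  base : IsPartialDiffeo (𝓡 n) (𝓡 n) eB
  isLog : IsLog lam
  adapted : IsAdapted lam eB e K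
  mem : w.proj ∈ e.source
  flat : IsFlatSystem K e.target (L ∘ (natChart e adapted.diffeo).symm) (formCoord A e)
  slice : IsSlice K e.target (L ∘ (natChart e adapted.diffeo).symm) μ (natCoord e w) O q

variable {A : PrincipalConnection E EG M G} {L : TangentBundle 𝓘(ℝ, E) M → ℝ}
  {μ : GroupLieAlgebra 𝓘(ℝ, EG) G →L[ℝ] ℝ}
  {eB : OpenPartialHomeomorph (MulAction.orbitRel.Quotient G M) (EuclideanSpace ℝ (Fin n))}
  {w : TangentBundle 𝓘(ℝ, E) M}

theorem IsAdapted.flatMomentum_eq {lam : OpenPartialHomeomorph G EG}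
    {e : OpenPartialHomeomorph M E} {K : E ≃L[ℝ] EuclideanSpace ℝ (Fin n) × EG}
    (ha : IsAdapted lam eB e K) (hlam : IsLog lam)
    (hL : ContMDiff 𝓘(ℝ, E).tangent 𝓘(ℝ, ℝ) ∞ L)
    {w : TangentBundle 𝓘(ℝ, E) M} (hw : w.proj ∈ e.source) :
    flatMomentum K (L ∘ (natChart e ha.diffeo).symm) (natCoord e w) = momentum EG G L w :=
  ContinuousLinearMap.ext fun ξ => (ha.momentum_eq hlam hL hw ξ).symm

theorem nonempty_routhChart (hbundle : IsPrincipalBundle E EG n M G)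
    (A : PrincipalConnection E EG M G)
    (hL : ContMDiff 𝓘(ℝ, E).tangent 𝓘(ℝ, ℝ) ∞ L)
    (hinv : ∀ (g : G) (w : TangentBundle 𝓘(ℝ, E) M), L (tangentAct g w) = L w)
    (hreg : IsRegular L) (hgreg : IsGroupRegular EG G L) (heB : IsPartialDiffeo (𝓡 n) (𝓡 n) eB)
    (hw : w ∈ levelSet L μ) (hwB : orbitProj M G w.proj ∈ eB.source) :
    Nonempty (RouthChart A L μ eB w) := by
  obtain ⟨lam, hlam⟩ := exists_isLog (EG := EG) (G := G)
  obtain ⟨e, K, ha, hwe⟩ := exists_isAdapted hbundle hlam heB hwB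
  have hflat := ha.isFlatSystem hlam hL hinv hreg hgreg A
  obtain ⟨O, q, hq⟩ := hflat.exists_isSlice (p := natCoord e w) (e.map_source hwe)
  have h1 : flatMomentum K (L ∘ (natChart e ha.diffeo).symm) (natCoord e w) = μ :=
    (ha.flatMomentum_eq hlam hL hwe).trans hw
  rw [h1] at hq
  exact ⟨⟨lam, e, K, O, q, hbundle, hL, hinv, heB, hlam, ha, hwe, hflat, hq⟩⟩

namespace RouthChart

/-- The natural coordinates on `TM` of the adapted chart. -/
def κ (c : RouthChart A L μ eB w) : OpenPartialHomeomorph (TangentBundle 𝓘(ℝ, E) M) (E × E) :=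
  natChart c.e c.adapted.diffeo

/-- The domain of the local section. -/
def dom (c : RouthChart A L μ eB w) :
    Set (TangentBundle (𝓡 n) (MulAction.orbitRel.Quotient G M)) :=
  (natChart eB c.base).source ∩ natChart eB c.base ⁻¹' c.O

/-- The local section of `N_μ → T(M/G)` through `w`. -/
def sec (c : RouthChart A L μ eB w)
    (y : TangentBundle (𝓡 n) (MulAction.orbitRel.Quotient G M)) : TangentBundle 𝓘(ℝ, E) M :=
  c.κ.symm (c.q (natCoord eB y))

theorem isOpen_dom (c : RouthChart A L μ eB w) : IsOpen c.dom :=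
  (natChart eB c.base).isOpen_inter_preimage c.slice.isOpen

theorem natCoord_tangentProj (c : RouthChart A L μ eB w) {w' : TangentBundle 𝓘(ℝ, E) M}
    (hw' : w'.proj ∈ c.e.source) : natCoord eB (tangentProj E n M G w')
      = ((c.K (natCoord c.e w').1).1, (c.K (natCoord c.e w').2).1) :=
  c.adapted.natCoord_tangentMap_orbitProj c.bundle c.base hw'

theorem tangentProj_mem (c : RouthChart A L μ eB w) {w' : TangentBundle 𝓘(ℝ, E) M}
    (hw' : w'.proj ∈ c.e.source) : tangentProj E n M G w' ∈ (natChart eB c.base).source :=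
  c.adapted.proj_mem _ hw'

theorem mem_dom (c : RouthChart A L μ eB w) : tangentProj E n M G w ∈ c.dom := by
  refine ⟨c.tangentProj_mem c.mem, ?_⟩
  show natCoord eB (tangentProj E n M G w) ∈ c.O
  rw [c.natCoord_tangentProj c.mem]
  exact c.slice.mem

theorem natCoord_mem (c : RouthChart A L μ eB w)
    {y : TangentBundle (𝓡 n) (MulAction.orbitRel.Quotient G M)} (hy : y ∈ c.dom) :
    natCoord eB y ∈ c.O := hy.2

theorem q_mem (c : RouthChart A L μ eB w)
    {y : TangentBundle (𝓡 n) (MulAction.orbitRel.Quotient G M)} (hy : y ∈ c.dom) :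
    c.q (natCoord eB y) ∈ c.κ.target :=
  c.slice.mem_dom _ hy.2

theorem sec_proj_mem (c : RouthChart A L μ eB w)
    {y : TangentBundle (𝓡 n) (MulAction.orbitRel.Quotient G M)} (hy : y ∈ c.dom) :
    (c.sec y).proj ∈ c.e.source :=
  c.κ.map_target (c.q_mem hy)

theorem natCoord_sec (c : RouthChart A L μ eB w)
    {y : TangentBundle (𝓡 n) (MulAction.orbitRel.Quotient G M)} (hy : y ∈ c.dom) :
    natCoord c.e (c.sec y) = c.q (natCoord eB y) :=
  c.κ.right_inv (c.q_mem hy)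

theorem sec_tangentProj (c : RouthChart A L μ eB w) : c.sec (tangentProj E n M G w) = w := by
  rw [sec, c.natCoord_tangentProj c.mem, c.slice.apply_mem]
  exact c.κ.left_inv c.mem

theorem contMDiffOn_sec (c : RouthChart A L μ eB w) :
    ContMDiffOn (𝓡 n).tangent 𝓘(ℝ, E).tangent ∞ c.sec c.dom := by
  have h1 := (isPartialDiffeo_natChart c.base).smooth.mono (inter_subset_left : c.dom ⊆ _)
  have h2 := c.slice.smooth.contMDiffOn.comp h1 (fun y hy => hy.2)
  exact (isPartialDiffeo_natChart c.adapted.diffeo).smooth_symm.comp h2 (fun y hy => c.q_mem hy)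

theorem sec_mem_levelSet (c : RouthChart A L μ eB w)
    {y : TangentBundle (𝓡 n) (MulAction.orbitRel.Quotient G M)} (hy : y ∈ c.dom) :
    c.sec y ∈ levelSet L μ := by
  have h1 := c.adapted.flatMomentum_eq c.isLog c.smooth (c.sec_proj_mem hy)
  rw [c.natCoord_sec hy] at h1
  exact h1.symm.trans (c.slice.momentum _ hy.2)

theorem tangentProj_sec (c : RouthChart A L μ eB w)
    {y : TangentBundle (𝓡 n) (MulAction.orbitRel.Quotient G M)} (hy : y ∈ c.dom) :
    tangentProj E n M G (c.sec y) = y := by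
  refine (natChart eB c.base).injOn (c.tangentProj_mem (c.sec_proj_mem hy)) hy.1 ?_
  show natCoord eB (tangentProj E n M G (c.sec y)) = natCoord eB y
  rw [c.natCoord_tangentProj (c.sec_proj_mem hy), c.natCoord_sec hy, c.slice.velocity _ (c.natCoord_mem hy),
    c.slice.position _ (c.natCoord_mem hy), c.K.apply_symm_apply]

/-- Points of `N_μ` near `w` are, up to the action of `G`, in the image of the section. -/
theorem eventually_sec (c : RouthChart A L μ eB w) :
    ∀ᶠ w' in 𝓝 w, w' ∈ levelSet L μ →
      ∃ g : G, tangentAct g w' = c.sec (tangentProj E n M G w') := by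
  -- `s w'` is the difference of the group coordinates of `w'` and `w`. The group element with
  -- logarithm `-s w'` brings `w'` to the group coordinate of the slice, where the uniqueness clause
  -- of `IsSlice` identifies it.
  set s : TangentBundle 𝓘(ℝ, E) M → EG :=
    fun w' => (c.K (natCoord c.e w').1).2 - (c.K (natCoord c.e w).1).2 with hs
  have hκc : ContinuousAt (natCoord c.e) w := c.κ.continuousAt c.mem
  have hsc : ContinuousAt s w :=
    ((c.K.continuous.continuousAt.comp hκc.fst).snd).sub continuousAt_const
  have hs0 : s w = 0 := sub_self _
  have hns : Tendsto (fun w' => -s w') (𝓝 w) (𝓝 0) := by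
    have h1 := hsc.tendsto.neg
    rwa [hs0, neg_zero] at h1
  have hg : Tendsto (fun w' => (c.lam.symm (-s w'), w')) (𝓝 w) (𝓝 (1, w)) :=
    ((IsAdapted.tendsto_log_symm c.isLog).comp hns).prodMk_nhds tendsto_id
  have hcoord : Tendsto (fun w' => natCoord c.e w' + (c.K.symm (0, -s w'), 0)) (𝓝 w)
      (𝓝 (natCoord c.e w)) := by
    have h1 : Tendsto (fun w' => c.K.symm ((0 : EuclideanSpace ℝ (Fin n)), -s w')) (𝓝 w) (𝓝 0) := by
      have h2 := (c.K.symm.continuous.tendsto (0, 0)).comp (tendsto_const_nhds.prodMk_nhds hns)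
      rwa [symm_mk_zero] at h2
    have h3 := hκc.tendsto.add (h1.prodMk_nhds (tendsto_const_nhds (x := (0 : E))))
    rwa [Prod.mk_zero_zero, add_zero] at h3
  filter_upwards [hg.eventually (c.adapted.natCoord_tangentAct c.mem),
    hns.eventually (IsAdapted.eventually_log_symm c.isLog), hcoord.eventually c.slice.unique]
    with w' ⟨h1, h2, h3⟩ h4 h5 hw'
  refine ⟨c.lam.symm (-s w'), ?_⟩
  simp only [h4] at h2 h3
  rw [← h3] at h5
  have h6 : c.κ (tangentAct (c.lam.symm (-s w')) w') = _ := h5 ?_ ?_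
  · rw [← c.natCoord_tangentProj h2, tangentProj_tangentAct c.bundle] at h6
    rw [sec, ← h6]
    exact (c.κ.left_inv h2).symm
  · rw [h3]
    simp [hs]
  · rw [c.adapted.flatMomentum_eq c.isLog c.smooth h2]
    exact tangentAct_mem_levelSet c.smooth c.invariant _ hw'

/-- Tangent vectors of the level set are velocities of curves in it. -/
theorem exists_curve (c : RouthChart A L μ eB w) (hw : w ∈ levelSet L μ)
    {Z : TangentSpace 𝓘(ℝ, E).tangent w}
    (hZ : ∀ ξ : GroupLieAlgebra 𝓘(ℝ, EG) G,
      dirDeriv 𝓘(ℝ, E).tangent (fun w' => momentum EG G L w' ξ) w Z = 0) :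
    ∃ j : ℝ → TangentBundle 𝓘(ℝ, E) M, j 0 = w ∧
      MDifferentiableAt 𝓘(ℝ, ℝ) 𝓘(ℝ, E).tangent j 0 ∧
      (mfderiv 𝓘(ℝ, ℝ) 𝓘(ℝ, E).tangent j 0 : ℝ →L[ℝ] E × E) 1 = Z ∧
      ∀ᶠ t in 𝓝 0, j t ∈ levelSet L μ := by
  obtain ⟨i, h1, h2, h3⟩ := c.flat.exists_curve (p := natCoord c.e w) (c.e.map_source c.mem)
    (Z := mfderiv 𝓘(ℝ, E).tangent 𝓘(ℝ, E × E) (natCoord c.e) w Z)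
    (fun ξ => (dirDeriv_momentum c.adapted c.isLog c.bundle c.smooth ξ c.mem Z).symm.trans (hZ ξ))
  have hκd := isPartialDiffeo_natChart c.adapted.diffeo
  have ht : natCoord c.e w ∈ c.κ.target := c.κ.map_source c.mem
  have h4 : MDifferentiableAt 𝓘(ℝ, E × E) 𝓘(ℝ, E).tangent c.κ.symm (natCoord c.e w) :=
    hκd.mdifferentiableAt_symm ht
  refine ⟨c.κ.symm ∘ i, ?_, ?_, ?_, ?_⟩
  · rw [Function.comp_apply, h1]
    exact c.κ.left_inv c.mem
  · exact MDifferentiableAt.comp (I' := 𝓘(ℝ, E × E)) 0 (by rwa [h1])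
      h2.differentiableAt.mdifferentiableAt
  · have h5 := mfderiv_comp_of_eq (I' := 𝓘(ℝ, E × E)) h4 h2.differentiableAt.mdifferentiableAt h1
    have h6 := congrArg (fun T : ℝ →L[ℝ] E × E => T 1) h5
    have h7 : (mfderiv 𝓘(ℝ, ℝ) 𝓘(ℝ, E × E) i 0 : ℝ →L[ℝ] E × E) 1
        = mfderiv 𝓘(ℝ, E).tangent 𝓘(ℝ, E × E) (natCoord c.e) w Z := by
      have h10 : fderiv ℝ i 0 1 = deriv i 0 := fderiv_apply_one_eq_deriv
      rw [mfderiv_eq_fderiv]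
      exact h10.trans h2.deriv
    have h8 : ∀ p, p = natCoord c.e w → (mfderiv 𝓘(ℝ, E × E) 𝓘(ℝ, E).tangent c.κ.symm p :
        E × E →L[ℝ] E × E) (mfderiv 𝓘(ℝ, E).tangent 𝓘(ℝ, E × E) (natCoord c.e) w Z) = Z := by
      rintro _ rfl
      exact hκd.symm_mfderiv_mfderiv (z := w) c.mem Z
    refine h6.trans (Eq.trans ?_ (h8 (i 0) h1))
    exact congrArg (fun v : E × E => (mfderiv 𝓘(ℝ, E × E) 𝓘(ℝ, E).tangent c.κ.symm (i 0) :
        E × E →L[ℝ] E × E) v) h7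
  · filter_upwards [h3] with t ⟨h5, h6⟩
    have h7 : (c.κ.symm (i t)).proj ∈ c.e.source := c.κ.map_target h5
    have h8 := c.adapted.flatMomentum_eq c.isLog c.smooth h7
    have h9 : natCoord c.e (c.κ.symm (i t)) = i t := c.κ.right_inv h5
    rw [h9, h6, c.adapted.flatMomentum_eq c.isLog c.smooth c.mem] at h8
    exact h8.symm.trans hw

/-- Derivatives along vectors tangent to the level set only depend on the restriction to the level
set. -/
theorem mfderiv_congr (c : RouthChart A L μ eB w) (hw : w ∈ levelSet L μ)
    {Z : TangentSpace 𝓘(ℝ, E).tangent w}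
    (hZ : ∀ ξ : GroupLieAlgebra 𝓘(ℝ, EG) G,
      dirDeriv 𝓘(ℝ, E).tangent (fun w' => momentum EG G L w' ξ) w Z = 0)
    {F : Type*} [NormedAddCommGroup F] [NormedSpace ℝ F] {H : Type*} [TopologicalSpace H]
    {J : ModelWithCorners ℝ F H} {N : Type*} [TopologicalSpace N] [ChartedSpace H N]
    {f f' : TangentBundle 𝓘(ℝ, E) M → N} (hf : MDifferentiableAt 𝓘(ℝ, E).tangent J f w)
    (hf' : MDifferentiableAt 𝓘(ℝ, E).tangent J f' w)
    (h : ∀ᶠ w' in 𝓝 w, w' ∈ levelSet L μ → f w' = f' w') :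
    (mfderiv 𝓘(ℝ, E).tangent J f w : E × E →L[ℝ] F) Z
      = (mfderiv 𝓘(ℝ, E).tangent J f' w : E × E →L[ℝ] F) Z := by
  -- The maps agree only on `N_μ`, which is not open; their derivatives are compared along a curve
  -- in `N_μ` with velocity `Z`.
  obtain ⟨j, h1, h2, h3, h4⟩ := c.exists_curve hw hZ
  have key : ∀ f : TangentBundle 𝓘(ℝ, E) M → N, MDifferentiableAt 𝓘(ℝ, E).tangent J f w →
      (mfderiv 𝓘(ℝ, ℝ) J (f ∘ j) 0 : ℝ →L[ℝ] F) 1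
        = (mfderiv 𝓘(ℝ, E).tangent J f w : E × E →L[ℝ] F) Z := by
    intro f hf
    subst h1
    have h5 := mfderiv_comp (I' := 𝓘(ℝ, E).tangent) 0 hf h2
    refine (congrArg (fun T : ℝ →L[ℝ] F => T 1) h5).trans ?_
    exact congrArg (fun v : E × E => (mfderiv 𝓘(ℝ, E).tangent J f (j 0) : E × E →L[ℝ] F) v) h3
  rw [← key f hf, ← key f' hf']
  have h5 : f ∘ j =ᶠ[𝓝 0] f' ∘ j := by
    have h6 : Tendsto j (𝓝 0) (𝓝 w) := by rw [← h1]; exact h2.continuousAt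
    filter_upwards [h6.eventually h, h4] with t h7 h8 using h7 h8
  have h6 : mfderiv 𝓘(ℝ, ℝ) J (f ∘ j) 0 = mfderiv 𝓘(ℝ, ℝ) J (f' ∘ j) 0 := h5.mfderiv_eq
  exact congrArg (fun T : ℝ →L[ℝ] F => T 1) h6

end RouthChart

end RouthChart

/-! ### Pulling back a smooth structure along a local homeomorphism -/

section PullbackManifold

variable {X : Type*} [TopologicalSpace X] {F : Type*} [NormedAddCommGroup F] [NormedSpace ℝ F]
  {H : Type*} [TopologicalSpace H] {I : ModelWithCorners ℝ F H}
  {N : Type*} [TopologicalSpace N] [ChartedSpace H N]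
  {φ : X → N} (Φ : X → OpenPartialHomeomorph X N) (hΦ : ∀ x, x ∈ (Φ x).source)

/-- The charts of `N`, pulled back along a family of local homeomorphisms. -/
abbrev pullbackChartedSpace : ChartedSpace H X where
  atlas := range fun x => (Φ x).trans (chartAt H (Φ x x))
  chartAt x := (Φ x).trans (chartAt H (Φ x x))
  mem_chart_source x := by
    rw [OpenPartialHomeomorph.trans_source]
    exact ⟨hΦ x, mem_chart_source H _⟩
  chart_mem_atlas x := mem_range_self x

variable {Φ hΦ} [IsManifold I ∞ N]

/-- All the `Φ x` are restrictions of the one map `φ`, so `Φ x' ∘ (Φ x).symm` is the identity where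
it is defined, and the transition maps are those of `N`. -/
theorem contMDiffOn_pullback_change (hφ : ∀ x z, Φ x z = φ z) (x x' : X) :
    ContMDiffOn I I ∞ (((Φ x).trans (chartAt H (Φ x x))).symm.trans
        ((Φ x').trans (chartAt H (Φ x' x')))) (((Φ x).trans (chartAt H (Φ x x))).symm.trans
        ((Φ x').trans (chartAt H (Φ x' x')))).source := by
  have hc : ∀ y : N, IsPartialDiffeo I I (chartAt H y) := fun y =>
    ⟨contMDiffOn_of_mem_maximalAtlas (IsManifold.chart_mem_maximalAtlas y),
      contMDiffOn_symm_of_mem_maximalAtlas (IsManifold.chart_mem_maximalAtlas y)⟩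
  have h1 := ((hc (Φ x x)).symm.trans (hc (Φ x' x'))).smooth
  have hval : ∀ h ∈ (((Φ x).trans (chartAt H (Φ x x))).symm.trans
        ((Φ x').trans (chartAt H (Φ x' x')))).source,
      Φ x' ((Φ x).symm ((chartAt H (Φ x x)).symm h)) = (chartAt H (Φ x x)).symm h := by
    intro h hh
    simp only [OpenPartialHomeomorph.trans_source, OpenPartialHomeomorph.symm_source,
      OpenPartialHomeomorph.trans_target, mem_inter_iff, mem_preimage] at hh
    rw [hφ, ← hφ x]
    exact (Φ x).right_inv hh.1.2
  refine (h1.mono ?_).congr ?_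
  · intro h hh
    have h2 := hval h hh
    simp only [OpenPartialHomeomorph.trans_source, OpenPartialHomeomorph.symm_source,
      OpenPartialHomeomorph.trans_target, mem_inter_iff, mem_preimage] at hh ⊢
    refine ⟨hh.1.1, ?_⟩
    rw [← h2]
    exact hh.2.2
  · intro h hh
    exact congrArg (chartAt H (Φ x' x')) (hval h hh)

theorem isManifold_pullback (hφ : ∀ x z, Φ x z = φ z) :
    @IsManifold ℝ _ F _ _ H _ I ∞ X _ (pullbackChartedSpace Φ hΦ) := by
  letI : ChartedSpace H X := pullbackChartedSpace Φ hΦ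
  have : HasGroupoid X (contDiffGroupoid ∞ I) := by
    refine ⟨?_⟩
    rintro _ _ ⟨x, rfl⟩ ⟨x', rfl⟩
    exact IsPartialDiffeo.mem_contDiffGroupoid
      ⟨contMDiffOn_pullback_change hφ x x', contMDiffOn_pullback_change hφ x' x⟩
  exact { this with }

theorem isLocalDiffeomorph_pullback (hφ : ∀ x z, Φ x z = φ z) :
    letI : ChartedSpace H X := pullbackChartedSpace Φ hΦ
    IsLocalDiffeomorph I I ∞ φ := by
  letI : ChartedSpace H X := pullbackChartedSpace Φ hΦ
  have : IsManifold I ∞ X := isManifold_pullback hφ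
  have hc : ∀ (y : N), IsPartialDiffeo I I (chartAt H y) := fun y =>
    ⟨contMDiffOn_of_mem_maximalAtlas (IsManifold.chart_mem_maximalAtlas y),
      contMDiffOn_symm_of_mem_maximalAtlas (IsManifold.chart_mem_maximalAtlas y)⟩
  have hsmooth : ContMDiff I I ∞ φ := by
    intro z
    have h1 : ContMDiffAt I I ∞ (chartAt H z) z := contMDiffAt_of_mem_maximalAtlas
      (IsManifold.chart_mem_maximalAtlas z) (mem_chart_source H z)
    have h2 : ContMDiffAt I I ∞ (chartAt H (Φ z z)).symm (chartAt H z z) :=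
      (hc (Φ z z)).contMDiffAt_symm (mem_chart_target H _)
    refine (ContMDiffAt.comp z h2 h1).congr_of_eventuallyEq ?_
    filter_upwards [(chartAt H z).open_source.mem_nhds (mem_chart_source H z)] with z' hz'
    have hz'' : z' ∈ ((Φ z).trans (chartAt H (Φ z z))).source := hz'
    rw [OpenPartialHomeomorph.trans_source] at hz''
    rw [← hφ z]
    exact ((chartAt H (Φ z z)).left_inv hz''.2).symm
  intro x
  -- Smoothness into `X` is tested in the pulled-back chart at the image point. Composed with the
  -- local inverse, that chart is simply a chart of `N`.
  have hsymm : ContMDiffOn I I ∞ (Φ x).symm (Φ x).target := by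
    intro y hy
    have hyz : φ ((Φ x).symm y) = y := by rw [← hφ x, (Φ x).right_inv hy]
    refine ContMDiffAt.contMDiffWithinAt (contMDiffAt_iff_target.2
      ⟨(Φ x).continuousAt_symm hy, ?_⟩)
    have h1 : ContMDiffAt I 𝓘(ℝ, F) ∞ (extChartAt I (Φ ((Φ x).symm y) ((Φ x).symm y))) y := by
      have h2 : ∀ y', y' = y → ContMDiffAt I 𝓘(ℝ, F) ∞ (extChartAt I y') y := by
        rintro _ rfl
        exact contMDiffAt_extChartAt
      exact h2 _ (by rw [hφ, hyz])
    refine h1.congr_of_eventuallyEq ?_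
    filter_upwards [(Φ x).open_target.mem_nhds hy] with y' hy'
    have h3 : Φ ((Φ x).symm y) ((Φ x).symm y') = y' := by rw [hφ, ← hφ x, (Φ x).right_inv hy']
    show I (chartAt H (Φ ((Φ x).symm y) ((Φ x).symm y)) (Φ ((Φ x).symm y) ((Φ x).symm y'))) = _
    rw [h3]
    rfl
  refine ⟨⟨(Φ x).toPartialEquiv, (Φ x).open_source, (Φ x).open_target, ?_, hsymm⟩, hΦ x, ?_⟩
  · exact hsmooth.contMDiffOn.congr fun z _ => hφ x z
  · exact fun z _ => (hφ x z).symm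

end PullbackManifold

/-! ### The quotient of a level set of momentum -/

section Quotient

variable {E : Type*} [NormedAddCommGroup E] [NormedSpace ℝ E] [FiniteDimensional ℝ E]
  {EG : Type*} [NormedAddCommGroup EG] [NormedSpace ℝ EG] [FiniteDimensional ℝ EG] {n : ℕ}
  {M : Type*} [TopologicalSpace M] [ChartedSpace E M] [IsManifold 𝓘(ℝ, E) ∞ M]
  {G : Type*} [TopologicalSpace G] [ChartedSpace EG G] [CommGroup G] [LieGroup 𝓘(ℝ, EG) ∞ G]
  [MulAction G M] [ContMDiffSMul 𝓘(ℝ, EG) 𝓘(ℝ, E) ∞ G M]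
  [ChartedSpace (EuclideanSpace ℝ (Fin n)) (MulAction.orbitRel.Quotient G M)]
  [IsManifold (𝓡 n) ∞ (MulAction.orbitRel.Quotient G M)]
  {A : PrincipalConnection E EG M G} {L : TangentBundle 𝓘(ℝ, E) M → ℝ}
  {μ : GroupLieAlgebra 𝓘(ℝ, EG) G →L[ℝ] ℝ}

/-- The map `N_μ / G → T(M/G)` induced by the tangent map of `M → M / G`. -/
def reducedProj (hbundle : IsPrincipalBundle E EG n M G) (L : TangentBundle 𝓘(ℝ, E) M → ℝ)
    (μ : GroupLieAlgebra 𝓘(ℝ, EG) G →L[ℝ] ℝ) :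
    LevelQuotient L μ → TangentBundle (𝓡 n) (MulAction.orbitRel.Quotient G M) :=
  Quot.lift (fun w => tangentProj E n M G w.1) (by
    rintro w w' ⟨g, hg⟩
    rw [← hg, tangentProj_tangentAct hbundle])

theorem reducedProj_levelProj (hbundle : IsPrincipalBundle E EG n M G) (w : levelSet L μ) :
    reducedProj hbundle L μ (levelProj L μ w) = tangentProj E n M G w.1 := rfl

theorem continuous_reducedProj (hbundle : IsPrincipalBundle E EG n M G) :
    Continuous (reducedProj hbundle L μ) :=
  continuous_quot_lift _ ((contMDiff_tangentProj hbundle).continuous.comp continuous_subtype_val)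

theorem continuous_levelProj : Continuous (levelProj L μ) := continuous_quot_mk

theorem levelProj_eq {w w' : levelSet L μ} (g : G) (h : tangentAct g w.1 = w'.1) :
    levelProj L μ w = levelProj L μ w' :=
  Quot.sound ⟨g, h⟩

theorem levelProj_eq_iff {w w' : levelSet L μ} :
    levelProj L μ w = levelProj L μ w' ↔ ∃ g : G, tangentAct g w.1 = w'.1 := by
  have he : Equivalence (fun w w' : levelSet L μ => ∃ g : G, tangentAct g w.1 = w'.1) := by
    refine ⟨fun w => ⟨1, tangentAct_one _⟩, ?_, ?_⟩
    · rintro w w' ⟨g, hg⟩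
      exact ⟨g⁻¹, by rw [← hg, ← tangentAct_mul EG, inv_mul_cancel, tangentAct_one]⟩
    · rintro w w' w'' ⟨g, hg⟩ ⟨h, hh⟩
      exact ⟨h * g, by rw [tangentAct_mul EG, hg, hh]⟩
  exact Quot.eq.trans he.eqvGen_iff

/-- The saturation of an open set is the union of its preimages under the homeomorphisms by which
`G` acts on `N_μ`. -/
theorem isOpenMap_levelProj (hL : ContMDiff 𝓘(ℝ, E).tangent 𝓘(ℝ, ℝ) ∞ L)
    (hinv : ∀ (g : G) (w : TangentBundle 𝓘(ℝ, E) M), L (tangentAct g w) = L w) :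
    IsOpenMap (levelProj L μ) := by
  intro U hU
  have h1 : levelProj L μ ⁻¹' (levelProj L μ '' U)
      = ⋃ g : G, (fun w : levelSet L μ =>
        (⟨tangentAct g w.1, tangentAct_mem_levelSet hL hinv g w.2⟩ : levelSet L μ)) ⁻¹' U := by
    ext w
    simp only [mem_preimage, mem_image, mem_iUnion]
    constructor
    · rintro ⟨w', hw', h2⟩
      obtain ⟨g, hg⟩ := levelProj_eq_iff.1 h2.symm
      refine ⟨g, ?_⟩
      convert hw'
    · rintro ⟨g, hg⟩
      exact ⟨_, hg, (levelProj_eq g rfl).symm⟩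
  have h2 : IsOpen (levelProj L μ ⁻¹' (levelProj L μ '' U)) := by
    rw [h1]
    refine isOpen_iUnion fun g => hU.preimage ?_
    exact ((contMDiff_tangentAct EG g).continuous.comp continuous_subtype_val).subtype_mk _
  exact h2

namespace RouthChart

variable {eB : OpenPartialHomeomorph (MulAction.orbitRel.Quotient G M) (EuclideanSpace ℝ (Fin n))}
  {w : TangentBundle 𝓘(ℝ, E) M}

open Classical in
/-- The local section of `N_μ / G → T(M/G)`. -/
def quotSec (c : RouthChart A L μ eB w) (hw : w ∈ levelSet L μ)
    (y : TangentBundle (𝓡 n) (MulAction.orbitRel.Quotient G M)) : LevelQuotient L μ :=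
  -- Outside `dom` the value of `sec` need not lie in `N_μ`; the class of `w` serves as a default
  -- there.
  levelProj L μ (if h : c.sec y ∈ levelSet L μ then ⟨c.sec y, h⟩ else ⟨w, hw⟩)

theorem quotSec_eq (c : RouthChart A L μ eB w) (hw : w ∈ levelSet L μ)
    {y : TangentBundle (𝓡 n) (MulAction.orbitRel.Quotient G M)} (hy : y ∈ c.dom) :
    c.quotSec hw y = levelProj L μ ⟨c.sec y, c.sec_mem_levelSet hy⟩ := by
  rw [quotSec, dif_pos]

theorem reducedProj_quotSec (c : RouthChart A L μ eB w) (hw : w ∈ levelSet L μ)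
    {y : TangentBundle (𝓡 n) (MulAction.orbitRel.Quotient G M)} (hy : y ∈ c.dom) :
    reducedProj c.bundle L μ (c.quotSec hw y) = y := by
  rw [c.quotSec_eq hw hy]
  exact c.tangentProj_sec hy

theorem continuousOn_quotSec (c : RouthChart A L μ eB w) (hw : w ∈ levelSet L μ) :
    ContinuousOn (c.quotSec hw) c.dom := by
  rw [continuousOn_iff_continuous_domRestrict]
  have h1 : c.dom.domRestrict (c.quotSec hw) = fun y : c.dom =>
      levelProj L μ ⟨c.sec y.1, c.sec_mem_levelSet y.2⟩ :=
    funext fun y => c.quotSec_eq hw y.2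
  rw [h1]
  exact continuous_levelProj.comp
    ((continuousOn_iff_continuous_domRestrict.1 c.contMDiffOn_sec.continuousOn).subtype_mk _)

/-- On `N_μ` the section recovers nearby points up to the group, and openness of `levelProj` carries
the neighbourhood to the quotient. -/
theorem eventually_quotSec (c : RouthChart A L μ eB w) (hw : w ∈ levelSet L μ) :
    ∀ᶠ z in 𝓝 (levelProj L μ ⟨w, hw⟩), c.quotSec hw (reducedProj c.bundle L μ z) = z := by
  have h1 : ∀ᶠ w' : levelSet L μ in 𝓝 ⟨w, hw⟩,
      c.quotSec hw (reducedProj c.bundle L μ (levelProj L μ w')) = levelProj L μ w' := by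
    have h2 : Tendsto (fun w' : levelSet L μ => w'.1) (𝓝 ⟨w, hw⟩) (𝓝 w) :=
      continuous_subtype_val.continuousAt
    have h3 : Tendsto (fun w' : levelSet L μ => tangentProj E n M G w'.1) (𝓝 ⟨w, hw⟩)
        (𝓝 (tangentProj E n M G w)) :=
      ((contMDiff_tangentProj c.bundle).continuous.continuousAt).tendsto.comp h2
    filter_upwards [h2.eventually c.eventually_sec,
      h3.eventually (c.isOpen_dom.mem_nhds c.mem_dom)] with w' h4 h5
    obtain ⟨g, hg⟩ := h4 w'.2
    rw [reducedProj_levelProj, c.quotSec_eq hw h5]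
    exact (levelProj_eq g hg).symm
  exact (isOpenMap_levelProj c.smooth c.invariant).image_mem_nhds h1 |> fun h =>
    Filter.mem_of_superset h (by rintro _ ⟨w', hw', rfl⟩; exact hw')

/-- `N_μ / G → T(M/G)` is a local homeomorphism. -/
def quotHomeo (c : RouthChart A L μ eB w) (hw : w ∈ levelSet L μ) :
    OpenPartialHomeomorph (LevelQuotient L μ)
      (TangentBundle (𝓡 n) (MulAction.orbitRel.Quotient G M)) where
  toFun := reducedProj c.bundle L μ
  invFun := c.quotSec hw
  -- The section inverts `φ` only near the class of `w`; passing to the interior keeps the domain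
  -- open.
  source := interior {z | c.quotSec hw (reducedProj c.bundle L μ z) = z}
    ∩ reducedProj c.bundle L μ ⁻¹' c.dom
  target := c.dom ∩ c.quotSec hw ⁻¹'
    interior {z | c.quotSec hw (reducedProj c.bundle L μ z) = z}
  map_source' z hz := ⟨hz.2, by
    have h1 : c.quotSec hw (reducedProj c.bundle L μ z) = z :=
      interior_subset (s := {z | c.quotSec hw (reducedProj c.bundle L μ z) = z}) hz.1
    rw [mem_preimage, h1]
    exact hz.1⟩
  map_target' y hy := ⟨hy.2, by
    rw [mem_preimage, c.reducedProj_quotSec hw hy.1]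
    exact hy.1⟩
  left_inv' z hz :=
    interior_subset (s := {z | c.quotSec hw (reducedProj c.bundle L μ z) = z}) hz.1
  right_inv' y hy := c.reducedProj_quotSec hw hy.1
  open_source := isOpen_interior.inter (c.isOpen_dom.preimage (continuous_reducedProj c.bundle))
  open_target := (c.continuousOn_quotSec hw).isOpen_inter_preimage c.isOpen_dom isOpen_interior
  continuousOn_toFun := (continuous_reducedProj c.bundle).continuousOn
  continuousOn_invFun := (c.continuousOn_quotSec hw).mono inter_subset_left

theorem mem_quotHomeo_source (c : RouthChart A L μ eB w) (hw : w ∈ levelSet L μ) :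
    levelProj L μ ⟨w, hw⟩ ∈ (c.quotHomeo hw).source :=
  ⟨mem_interior_iff_mem_nhds.2 (c.eventually_quotSec hw), c.mem_dom⟩

end RouthChart

end Quotient

/-! ### Curvature in adapted coordinates -/

section Curvature

variable {E : Type*} [NormedAddCommGroup E] [NormedSpace ℝ E] [FiniteDimensional ℝ E]
  {EG : Type*} [NormedAddCommGroup EG] [NormedSpace ℝ EG] {n : ℕ}
  {M : Type*} [TopologicalSpace M] [ChartedSpace E M] [IsManifold 𝓘(ℝ, E) ∞ M]
  {G : Type*} [TopologicalSpace G] [ChartedSpace EG G] [CommGroup G] [MulAction G M]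
  [ContMDiffSMul 𝓘(ℝ, EG) 𝓘(ℝ, E) ∞ G M]
  [ChartedSpace (EuclideanSpace ℝ (Fin n)) (MulAction.orbitRel.Quotient G M)]
  {lam : OpenPartialHomeomorph G EG}
  {eB : OpenPartialHomeomorph (MulAction.orbitRel.Quotient G M) (EuclideanSpace ℝ (Fin n))}
  {e : OpenPartialHomeomorph M E} {K : E ≃L[ℝ] EuclideanSpace ℝ (Fin n) × EG}
  {A : PrincipalConnection E EG M G} {Λ : E × E → ℝ}

/-- The horizontal lift of the coordinate field `∂/∂x^i` in adapted coordinates. -/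
def horizontalCoord {V : Type*} [NormedAddCommGroup V] [NormedSpace ℝ V] (K : E ≃L[ℝ] V × EG)
    (Ω : E → E →L[ℝ] EG) (v : V) (x : E) : E :=
  K.symm (v, 0) - K.symm (0, Ω x (K.symm (v, 0)))

theorem eq_horizontalCoord {V : Type*} [NormedAddCommGroup V] [NormedSpace ℝ V]
    {K : E ≃L[ℝ] V × EG} {Ω : E → E →L[ℝ] EG} {D : Set E} (h : IsFlatSystem K D Λ Ω) {x : E}
    (hx : x ∈ D) {v : V} {u : E} : ((K u).1 = v ∧ Ω x u = 0) ↔ u = horizontalCoord K Ω v x := by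
  constructor
  · rintro ⟨h1, h2⟩
    have h3 : u = K.symm (v, 0) + K.symm (0, (K u).2) := by
      rw [← map_add, K.eq_symm_apply]
      exact Prod.ext (by simp [h1]) (by simp)
    have h4 : (K u).2 = -Ω x (K.symm (v, 0)) := by
      rw [h3, map_add, h.form_vert x hx] at h2
      exact eq_neg_of_add_eq_zero_right h2
    rw [h4] at h3
    have h5 : K.symm ((0 : V), -Ω x (K.symm (v, 0))) = -K.symm (0, Ω x (K.symm (v, 0))) := by
      have h6 := map_neg K.symm ((0 : V), Ω x (K.symm (v, 0)))
      rwa [Prod.neg_mk, neg_zero] at h6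
    rw [h3, h5, horizontalCoord, sub_eq_add_neg]
  · rintro rfl
    constructor
    · simp [horizontalCoord]
    · rw [horizontalCoord, map_sub, h.form_vert x hx, sub_self]

/-- The horizontal lift is defined by choice. In adapted coordinates its two conditions fix the
first component and, through `Ω`, the vertical one, so exactly one vector satisfies them. -/
theorem chartDeriv_horizontalField (ha : IsAdapted lam eB e K)
    (hbundle : IsPrincipalBundle E EG n M G) (heB : IsPartialDiffeo (𝓡 n) (𝓡 n) eB)
    (h : IsFlatSystem K e.target Λ (formCoord A e)) {m : M} (hm : m ∈ e.source) (i : Fin n) :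
    chartDeriv e m (horizontalField A eB i m)
      = horizontalCoord K (formCoord A e) (EuclideanSpace.single i (1 : ℝ)) (e m) := by
  have hmB := ha.proj_mem m hm
  set v : EuclideanSpace ℝ (Fin n) := EuclideanSpace.single i (1 : ℝ)
  set v' := (mfderiv (𝓡 n) (𝓡 n) eB (orbitProj M G m)).inverse v with hv'
  have hv : mfderiv (𝓡 n) (𝓡 n) eB (orbitProj M G m) v' = v := by
    rw [hv', heB.inverse_mfderiv hmB]
    exact heB.mfderiv_symm_mfderiv hmB v
  have key : ∀ u : TangentSpace 𝓘(ℝ, E) m,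
      (mfderiv 𝓘(ℝ, E) (𝓡 n) (orbitProj M G) m u = v' ∧ A.form m u = 0) ↔
        chartDeriv e m u = horizontalCoord K (formCoord A e) v (e m) := by
    intro u
    rw [← eq_horizontalCoord h (e.map_source hm)]
    have h1 := ha.mfderiv_orbitProj hbundle heB hm u
    have h2 := formCoord_apply A ha.diffeo hm u
    constructor
    · rintro ⟨h3, h4⟩
      exact ⟨(h1.symm.trans (congrArg _ h3)).trans hv, h2.trans h4⟩
    · rintro ⟨h3, h4⟩
      exact ⟨heB.mfderiv_injective hmB ((h1.trans h3).trans hv.symm), h2.symm.trans h4⟩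
  obtain ⟨u, hu⟩ := chartDeriv_surjective ha.diffeo hm
    (horizontalCoord K (formCoord A e) v (e m))
  exact (key _).1 (Classical.epsilon_spec (p := fun u : TangentSpace 𝓘(ℝ, E) m =>
    mfderiv 𝓘(ℝ, E) (𝓡 n) (orbitProj M G) m u = v' ∧ A.form m u = 0) ⟨u, (key u).2 hu⟩)

theorem hasFDerivAt_horizontalCoord {V : Type*} [NormedAddCommGroup V] [NormedSpace ℝ V]
    {K : E ≃L[ℝ] V × EG} {Ω : E → E →L[ℝ] EG} {D : Set E} (h : IsFlatSystem K D Λ Ω) {x : E}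
    (hx : x ∈ D) (v : V) : HasFDerivAt (horizontalCoord K Ω v)
      (-((K.symm : V × EG →L[ℝ] E).comp ((ContinuousLinearMap.inr ℝ V EG).comp
        ((fderiv ℝ Ω x).flip (K.symm (v, 0)))))) x := by
  have h1 : HasFDerivAt (fun x => Ω x (K.symm (v, 0))) ((fderiv ℝ Ω x).flip (K.symm (v, 0))) x := by
    have h2 := ((h.form_smooth x hx).differentiableAt (by simp)).hasFDerivAt.clm_apply
      (hasFDerivAt_const (K.symm (v, 0)) x)
    simpa using h2
  have h3 := ((K.symm : V × EG →L[ℝ] E).comp (ContinuousLinearMap.inr ℝ V EG)).hasFDerivAt.comp x h1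
  exact h3.const_sub (K.symm (v, 0))

theorem contDiffAt_horizontalCoord {V : Type*} [NormedAddCommGroup V] [NormedSpace ℝ V]
    {K : E ≃L[ℝ] V × EG} {Ω : E → E →L[ℝ] EG} {D : Set E} (h : IsFlatSystem K D Λ Ω) {x : E}
    (hx : x ∈ D) (v : V) : ContDiffAt ℝ ∞ (horizontalCoord K Ω v) x := by
  have h1 : ContDiffAt ℝ ∞ (fun x => ((0 : V), Ω x (K.symm (v, 0)))) x :=
    contDiffAt_const.prodMk ((h.form_smooth x hx).clm_apply contDiffAt_const)
  exact contDiffAt_const.sub (K.symm.contDiff.contDiffAt.comp x h1)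

/-- Only the vertical component of a horizontal field varies with the point, through `Ω`. Its
derivative along the vertical part of the other field vanishes, because `Ω` is invariant under
vertical translations, so no term quadratic in `Ω` survives. -/
theorem lieBracket_horizontalCoord {V : Type*} [NormedAddCommGroup V] [NormedSpace ℝ V]
    {K : E ≃L[ℝ] V × EG} {Ω : E → E →L[ℝ] EG} {D : Set E} (h : IsFlatSystem K D Λ Ω) {x : E}
    (hx : x ∈ D) (v v' : V) :
    VectorField.lieBracket ℝ (horizontalCoord K Ω v) (horizontalCoord K Ω v') x
      = K.symm (0, fderiv ℝ Ω x (K.symm (v', 0)) (K.symm (v, 0))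
        - fderiv ℝ Ω x (K.symm (v, 0)) (K.symm (v', 0))) := by
  have h1 : ∀ v v' : V, fderiv ℝ (horizontalCoord K Ω v') x (horizontalCoord K Ω v x)
      = -K.symm (0, fderiv ℝ Ω x (K.symm (v, 0)) (K.symm (v', 0))) := by
    intro v v'
    rw [(hasFDerivAt_horizontalCoord h hx v').fderiv]
    show -K.symm (0, fderiv ℝ Ω x (horizontalCoord K Ω v x) (K.symm (v', 0))) = _
    rw [horizontalCoord, map_sub, sub_apply, h.form_inv x hx, sub_zero]
  rw [VectorField.lieBracket, h1, h1]
  have h2 : ∀ a b : EG, -K.symm ((0 : V), a) - -K.symm (0, b) = K.symm (0, b - a) := by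
    intro a b
    rw [neg_sub_neg, ← map_sub, Prod.mk_sub_mk, sub_zero]
  exact h2 _ _

/-- The bracket is natural under pullback by the chart, so it may be computed on coordinate fields;
the result is vertical, and the form reads off its component. -/
theorem curvature_eq (ha : IsAdapted lam eB e K)
    (hbundle : IsPrincipalBundle E EG n M G) (heB : IsPartialDiffeo (𝓡 n) (𝓡 n) eB)
    (h : IsFlatSystem K e.target Λ (formCoord A e)) {m : M} (hm : m ∈ e.source) (i j : Fin n) :
    curvature A eB i j m
      = fderiv ℝ (formCoord A e) (e m) (K.symm (EuclideanSpace.single j (1 : ℝ), 0))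
          (K.symm (EuclideanSpace.single i (1 : ℝ), 0))
        - fderiv ℝ (formCoord A e) (e m) (K.symm (EuclideanSpace.single i (1 : ℝ), 0))
          (K.symm (EuclideanSpace.single j (1 : ℝ), 0)) := by
  have := FiniteDimensional.complete ℝ E
  have : IsManifold 𝓘(ℝ, E) (minSmoothness ℝ 2) M :=
    IsManifold.of_le (n := ∞) (by simpa using ENat.LEInfty.out)
  have : IsManifold 𝓘(ℝ, E) (minSmoothness ℝ 2) E :=
    IsManifold.of_le (n := ∞) (by simpa using ENat.LEInfty.out)
  let X : Fin n → ∀ x : E, TangentSpace 𝓘(ℝ, E) x := fun i =>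
    horizontalCoord K (formCoord A e) (EuclideanSpace.single i (1 : ℝ))
  have hmE := e.map_source hm
  have hpull : ∀ (Y : ∀ x : E, TangentSpace 𝓘(ℝ, E) x) {m' : M}, m' ∈ e.source →
      chartDeriv e m' (VectorField.mpullback 𝓘(ℝ, E) 𝓘(ℝ, E) e Y m') = Y (e m') := by
    intro Y m' hm'
    have h1 := congrArg (fun T : E →L[ℝ] E => chartDeriv e m' (T (Y (e m'))))
      (ha.diffeo.inverse_mfderiv hm')
    exact Eq.trans h1 (ha.diffeo.mfderiv_symm_mfderiv hm' _)
  have h1 : ∀ i, horizontalField A eB i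
      =ᶠ[𝓝 m] VectorField.mpullback 𝓘(ℝ, E) 𝓘(ℝ, E) e (X i) := by
    intro i
    filter_upwards [e.open_source.mem_nhds hm] with m' hm'
    exact chartDeriv_injective ha.diffeo hm'
      ((chartDeriv_horizontalField ha hbundle heB h hm' i).trans (hpull (X i) hm').symm)
  have hXd : ∀ i, MDifferentiableAt 𝓘(ℝ, E) 𝓘(ℝ, E).tangent
      (fun x => (⟨x, X i x⟩ : TangentBundle 𝓘(ℝ, E) E)) (e m) := fun i =>
    (contMDiffAt_vectorSpace_iff_contDiffAt.2
      (contDiffAt_horizontalCoord h hmE _)).mdifferentiableAt (by simp)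
  have h2 := (h1 i).mlieBracket_vectorField_eq (h1 j)
  have h3 := VectorField.mpullback_mlieBracket (n := ∞) (hXd i) (hXd j) (ha.diffeo.contMDiffAt hm)
    (by simpa using ENat.LEInfty.out)
  have h6 : VectorField.mlieBracket 𝓘(ℝ, E) (X i) (X j) (e m)
      = VectorField.lieBracket ℝ (X i) (X j) (e m) := by
    rw [← VectorField.mlieBracketWithin_univ, VectorField.mlieBracketWithin_eq_lieBracketWithin]
    exact congrFun (VectorField.lieBracketWithin_univ (𝕜 := ℝ) (V := X i) (W := X j)) (e m)
  have h4 : chartDeriv e m (VectorField.mlieBracket 𝓘(ℝ, E) (horizontalField A eB i)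
      (horizontalField A eB j) m) = VectorField.lieBracket ℝ (X i) (X j) (e m) :=
    (congrArg (chartDeriv e m) (h2.trans h3.symm)).trans ((hpull _ hm).trans h6)
  have h5 := formCoord_apply A ha.diffeo hm (VectorField.mlieBracket 𝓘(ℝ, E)
    (horizontalField A eB i) (horizontalField A eB j) m)
  refine h5.symm.trans ((congrArg (formCoord A e (e m)) (h4.trans
    (lieBracket_horizontalCoord h hmE _ _))).trans ?_)
  exact h.form_vert _ hmE _

/-- Contracting `curvature_eq` with `v` puts the right-hand side of Routh's equations in the form in
which `IsSlice.routh_equation` delivers it. -/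
theorem sum_curvature (ha : IsAdapted lam eB e K)
    (hbundle : IsPrincipalBundle E EG n M G) (heB : IsPartialDiffeo (𝓡 n) (𝓡 n) eB)
    (h : IsFlatSystem K e.target Λ (formCoord A e)) {m : M} (hm : m ∈ e.source) (i : Fin n)
    (μ : GroupLieAlgebra 𝓘(ℝ, EG) G →L[ℝ] ℝ) (v : EuclideanSpace ℝ (Fin n)) :
    (- ∑ j : Fin n, μ (curvature A eB i j m) * v j : ℝ)
      = (μ : EG →L[ℝ] ℝ) (fderiv ℝ (formCoord A e) (e m)
          (K.symm (EuclideanSpace.single i (1 : ℝ), 0)) (K.symm (v, 0)))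
        - (μ : EG →L[ℝ] ℝ) (fderiv ℝ (formCoord A e) (e m) (K.symm (v, 0))
          (K.symm (EuclideanSpace.single i (1 : ℝ), 0))) := by
  set ei : E := K.symm (EuclideanSpace.single i (1 : ℝ), 0)
  let μ' : EG →L[ℝ] ℝ := μ
  let T : EuclideanSpace ℝ (Fin n) →L[ℝ] E :=
    (K.symm : EuclideanSpace ℝ (Fin n) × EG →L[ℝ] E).comp (ContinuousLinearMap.inl ℝ _ EG)
  let Q : EuclideanSpace ℝ (Fin n) →L[ℝ] ℝ :=
    μ'.comp (((fderiv ℝ (formCoord A e) (e m) ei) - (fderiv ℝ (formCoord A e) (e m)).flip ei).comp T)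
  have hQ : ∀ v, Q v = μ' (fderiv ℝ (formCoord A e) (e m) ei (T v))
      - μ' (fderiv ℝ (formCoord A e) (e m) (T v) ei) := fun v => map_sub μ' _ _
  have hv : v = ∑ j, v j • EuclideanSpace.single j (1 : ℝ) := by
    simpa using ((EuclideanSpace.basisFun (Fin n) ℝ).sum_repr v).symm
  have hQv : Q v = ∑ j, v j * Q (EuclideanSpace.single j (1 : ℝ)) := by
    refine (congrArg Q hv).trans ((map_sum Q _ _).trans (Finset.sum_congr rfl fun j _ => ?_))
    exact map_smul Q _ _
  refine Eq.trans ?_ (hQ v)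
  rw [hQv, ← Finset.sum_neg_distrib]
  refine Finset.sum_congr rfl fun j _ => ?_
  rw [hQ]
  have h1 : μ (curvature A eB i j m)
      = μ' (fderiv ℝ (formCoord A e) (e m) (T (EuclideanSpace.single j (1 : ℝ))) ei)
        - μ' (fderiv ℝ (formCoord A e) (e m) ei (T (EuclideanSpace.single j (1 : ℝ)))) :=
    (congrArg μ' (curvature_eq ha hbundle heB h hm i j)).trans (map_sub μ' _ _)
  rw [h1]
  ring

end Curvature

/-! ### Sections of local diffeomorphisms -/

section LocalDiffeo

variable {F : Type*} [NormedAddCommGroup F] [NormedSpace ℝ F]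
  {H : Type*} [TopologicalSpace H] {I : ModelWithCorners ℝ F H}
  {X : Type*} [TopologicalSpace X] [ChartedSpace H X]
  {F' : Type*} [NormedAddCommGroup F'] [NormedSpace ℝ F']
  {H' : Type*} [TopologicalSpace H'] {J : ModelWithCorners ℝ F' H'}
  {N : Type*} [TopologicalSpace N] [ChartedSpace H' N] {φ : X → N}

/-- A continuous section stays in the domain of one local inverse of `φ`, hence coincides with it
locally. -/
theorem contMDiffAt_section (hφ : IsLocalDiffeomorph I J ∞ φ) {s : N → X} {y : N}
    (hs : ContinuousAt s y) (h : ∀ᶠ y' in 𝓝 y, φ (s y') = y') : ContMDiffAt J I ∞ s y := by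
  obtain ⟨Φ, hx, hΦ⟩ := hφ (s y)
  have hy : Φ (s y) = y := (hΦ hx).symm.trans h.self_of_nhds
  have hmem : y ∈ Φ.target := hy ▸ Φ.toPartialEquiv.map_source hx
  refine (Φ.contMDiffOn_invFun.contMDiffAt
    (Φ.open_target.mem_nhds hmem)).congr_of_eventuallyEq ?_
  filter_upwards [h, hs.eventually (Φ.open_source.mem_nhds hx)] with y' h1 h2
  have h3 : Φ (s y') = y' := (hΦ h2).symm.trans h1
  refine (Φ.toPartialEquiv.left_inv h2).symm.trans ?_
  exact congrArg Φ.toPartialEquiv.symm h3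

theorem exists_diffeomorph_of_bijective (hφ : IsLocalDiffeomorph I J ∞ φ)
    (hb : Function.Bijective φ) : ∃ Φ : Diffeomorph I J X N ∞, ⇑Φ = φ := by
  have h1 : Continuous (Equiv.ofBijective φ hb).symm := by
    rw [continuous_def]
    intro s hs
    have h2 : (Equiv.ofBijective φ hb).symm ⁻¹' s = φ '' s :=
      ((Equiv.ofBijective φ hb).image_eq_preimage_symm s).symm
    rw [h2]
    exact hφ.isOpenMap s hs
  exact ⟨⟨Equiv.ofBijective φ hb, hφ.contMDiff, fun y => contMDiffAt_section hφ h1.continuousAt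
    (Eventually.of_forall (Equiv.ofBijective φ hb).apply_symm_apply)⟩, rfl⟩

theorem mfderiv_inverse_mfderiv (hφ : IsLocalDiffeomorph I J ∞ φ) (z : X)
    (Z : TangentSpace J (φ z)) : mfderiv I J φ z ((mfderiv I J φ z).inverse Z) = Z := by
  rw [← hφ.mfderivToContinuousLinearEquiv_coe (by simp) z, ContinuousLinearMap.inverse_equiv]
  exact (hφ.mfderivToContinuousLinearEquiv (by simp) z).apply_symm_apply Z

theorem mfderiv_injective_of_isLocalDiffeomorph (hφ : IsLocalDiffeomorph I J ∞ φ) (z : X) :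
    Function.Injective (mfderiv I J φ z) := by
  rw [← hφ.mfderivToContinuousLinearEquiv_coe (by simp) z]
  exact (hφ.mfderivToContinuousLinearEquiv (by simp) z).injective

end LocalDiffeo

section QuotientManifold

variable {E : Type*} [NormedAddCommGroup E] [NormedSpace ℝ E] [FiniteDimensional ℝ E]
  {EG : Type*} [NormedAddCommGroup EG] [NormedSpace ℝ EG] [FiniteDimensional ℝ EG] {n : ℕ}
  {M : Type*} [TopologicalSpace M] [ChartedSpace E M] [IsManifold 𝓘(ℝ, E) ∞ M]
  {G : Type*} [TopologicalSpace G] [ChartedSpace EG G] [CommGroup G] [LieGroup 𝓘(ℝ, EG) ∞ G]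
  [MulAction G M] [ContMDiffSMul 𝓘(ℝ, EG) 𝓘(ℝ, E) ∞ G M]
  [ChartedSpace (EuclideanSpace ℝ (Fin n)) (MulAction.orbitRel.Quotient G M)]
  [IsManifold (𝓡 n) ∞ (MulAction.orbitRel.Quotient G M)]
  {L : TangentBundle 𝓘(ℝ, E) M → ℝ}
  {μ : GroupLieAlgebra 𝓘(ℝ, EG) G →L[ℝ] ℝ}

/-! ### The smooth structure of `N_μ / G` -/

theorem nonempty_routhChart_chartAt (hbundle : IsPrincipalBundle E EG n M G)
    (A : PrincipalConnection E EG M G)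
    (hL : ContMDiff 𝓘(ℝ, E).tangent 𝓘(ℝ, ℝ) ∞ L)
    (hinv : ∀ (g : G) (w : TangentBundle 𝓘(ℝ, E) M), L (tangentAct g w) = L w)
    (hreg : IsRegular L) (hgreg : IsGroupRegular EG G L) (w : levelSet L μ) :
    Nonempty (RouthChart A L μ
      (chartAt (EuclideanSpace ℝ (Fin n)) (orbitProj M G w.1.proj)) w.1) :=
  nonempty_routhChart hbundle A hL hinv hreg hgreg (isPartialDiffeo_chartAt _) w.2
    (mem_chart_source _ _)

theorem exists_isLocalDiffeomorph_reducedProj (hbundle : IsPrincipalBundle E EG n M G)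
    (A : PrincipalConnection E EG M G)
    (hL : ContMDiff 𝓘(ℝ, E).tangent 𝓘(ℝ, ℝ) ∞ L)
    (hinv : ∀ (g : G) (w : TangentBundle 𝓘(ℝ, E) M), L (tangentAct g w) = L w)
    (hreg : IsRegular L) (hgreg : IsGroupRegular EG G L) :
    ∃ (_ : ChartedSpace (ModelProd (EuclideanSpace ℝ (Fin n)) (EuclideanSpace ℝ (Fin n)))
        (LevelQuotient L μ)) (_ : IsManifold (𝓡 n).tangent ∞ (LevelQuotient L μ)),
      IsLocalDiffeomorph (𝓡 n).tangent (𝓡 n).tangent ∞ (reducedProj hbundle L μ) := by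
  have h1 : ∀ z : LevelQuotient L μ, ∃ Φ : OpenPartialHomeomorph (LevelQuotient L μ)
      (TangentBundle (𝓡 n) (MulAction.orbitRel.Quotient G M)), z ∈ Φ.source ∧
      ∀ z', Φ z' = reducedProj hbundle L μ z' := by
    intro z
    obtain ⟨w, rfl⟩ := Quot.exists_rep z
    obtain ⟨c⟩ := nonempty_routhChart_chartAt hbundle A hL hinv hreg hgreg w
    exact ⟨c.quotHomeo w.2, c.mem_quotHomeo_source w.2, fun z' => rfl⟩
  choose Φ hΦ hφ using h1
  exact ⟨pullbackChartedSpace Φ hΦ, isManifold_pullback hφ, isLocalDiffeomorph_pullback hφ⟩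

/-- Two vectors with the same image in `T(M/G)` can be moved by the group to the same base point,
where they differ by some `ξ̃`; uniqueness in the momentum equation gives `ξ = 0`. For surjectivity,
any lift of the given vector is corrected by the solution of that equation. -/
theorem bijective_reducedProj (hbundle : IsPrincipalBundle E EG n M G)
    (hL : ContMDiff 𝓘(ℝ, E).tangent 𝓘(ℝ, ℝ) ∞ L)
    (hinv : ∀ (g : G) (w : TangentBundle 𝓘(ℝ, E) M), L (tangentAct g w) = L w)
    (hex : ∀ (m : M) (u : TangentSpace 𝓘(ℝ, E) m), ∃! ξ : GroupLieAlgebra 𝓘(ℝ, EG) G,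
      (⟨m, u + fundamental EG G m ξ⟩ : TangentBundle 𝓘(ℝ, E) M) ∈ levelSet L μ) :
    Function.Bijective (reducedProj hbundle L μ) := by
  obtain ⟨lam, hlam⟩ := exists_isLog (EG := EG) (G := G)
  constructor
  · intro z z' hzz
    obtain ⟨w, rfl⟩ := Quot.exists_rep z
    obtain ⟨w', rfl⟩ := Quot.exists_rep z'
    have h1 : tangentProj E n M G w.1 = tangentProj E n M G w'.1 := hzz
    obtain ⟨g, hg⟩ := exists_smul_eq_of_orbitProj_eq (G := G)
      (congrArg Bundle.TotalSpace.proj h1).symm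
    refine levelProj_eq g ?_
    have h2 : tangentProj E n M G (tangentAct g w.1) = tangentProj E n M G w'.1 :=
      (tangentProj_tangentAct hbundle g w.1).trans h1
    have h3 : tangentAct g w.1 ∈ levelSet L μ := tangentAct_mem_levelSet hL hinv g w.2
    have h4 : (tangentAct g w.1).proj = w'.1.proj := hg
    obtain ⟨⟨m, u'⟩, hw'⟩ := w'
    -- Freeing the translated vector from its definition lets the equality of base points be
    -- substituted, after which both vectors live in the same tangent space.
    generalize tangentAct g w.1 = w₁ at h2 h3 h4
    obtain ⟨m₁, u₁⟩ := w₁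
    dsimp only at h4
    subst h4
    obtain ⟨e, K, ha, hm⟩ := exists_isAdapted hbundle hlam
      (isPartialDiffeo_chartAt (orbitProj M G m₁)) (mem_chart_source _ _)
    have heB := isPartialDiffeo_chartAt (F := EuclideanSpace ℝ (Fin n)) (orbitProj M G m₁)
    have h5 := congrArg (natCoord (chartAt (EuclideanSpace ℝ (Fin n)) (orbitProj M G m₁))) h2
    have h6 : (K (chartDeriv e m₁ u₁)).1 = (K (chartDeriv e m₁ u')).1 :=
      (congrArg Prod.snd (ha.natCoord_tangentMap_orbitProj hbundle heB (w := ⟨m₁, u₁⟩) hm)).symm.trans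
        ((congrArg Prod.snd h5).trans (congrArg Prod.snd
          (ha.natCoord_tangentMap_orbitProj hbundle heB (w := ⟨m₁, u'⟩) hm)))
    set ξ : EG := (K (chartDeriv e m₁ u₁)).2 - (K (chartDeriv e m₁ u')).2
    have h7 : u₁ = u' + fundamental EG G m₁ ξ := by
      refine chartDeriv_injective ha.diffeo hm (Eq.trans ?_ (map_add (chartDeriv e m₁) u'
        (fundamental EG G m₁ ξ)).symm)
      refine Eq.trans ?_ (congrArg (fun v : E => chartDeriv e m₁ u' + v)
        (ha.chartDeriv_fundamental hlam hm ξ)).symm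
      apply K.injective
      rw [map_add, K.apply_symm_apply]
      exact Prod.ext (by simp [h6]) (by simp [ξ])
    have h8 : ξ = 0 := by
      refine (hex m₁ u').unique (y₁ := ξ) (y₂ := 0) ?_ ?_
      · rw [← h7]; exact h3
      · have h9 : u' + fundamental EG G m₁ (0 : GroupLieAlgebra 𝓘(ℝ, EG) G) = u' :=
          (congrArg (fun v => u' + v) (map_zero (fundamental EG G m₁))).trans (add_zero u')
        rw [h9]; exact hw'
    have h9 : u₁ = u' := h7.trans ((congrArg (fun ξ : GroupLieAlgebra 𝓘(ℝ, EG) G =>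
      u' + fundamental EG G m₁ ξ) h8).trans ((congrArg (fun v => u' + v)
        (map_zero (fundamental EG G m₁))).trans (add_zero u')))
    rw [h9]
  · intro y
    obtain ⟨m, hm⟩ := Quotient.exists_rep y.proj
    have hm' : orbitProj M G m = y.proj := hm
    have heB := isPartialDiffeo_chartAt (F := EuclideanSpace ℝ (Fin n)) (orbitProj M G m)
    obtain ⟨e, K, ha, hme⟩ := exists_isAdapted hbundle hlam heB (mem_chart_source _ _)
    obtain ⟨u, hu⟩ : ∃ u : TangentSpace 𝓘(ℝ, E) m, chartDeriv e m u = K.symm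
        ((natCoord (chartAt (EuclideanSpace ℝ (Fin n)) (orbitProj M G m)) y).2, 0) :=
      chartDeriv_surjective ha.diffeo hme _
    obtain ⟨ξ, hξ, -⟩ := hex m u
    refine ⟨levelProj L μ ⟨_, hξ⟩, ?_⟩
    have hy : y.proj ∈ (chartAt (EuclideanSpace ℝ (Fin n)) (orbitProj M G m)).source := by
      rw [← hm']
      exact mem_chart_source _ _
    refine (natChart _ heB).injOn (ha.proj_mem m hme) hy ?_
    refine (ha.natCoord_tangentMap_orbitProj hbundle heB
      (w := ⟨m, u + fundamental EG G m ξ⟩) hme).trans (Prod.ext ?_ ?_)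
    · exact (ha.proj_eq m hme).trans (congrArg _ hm')
    · have h1 : chartDeriv e m (u + fundamental EG G m ξ) = K.symm
          ((natCoord (chartAt (EuclideanSpace ℝ (Fin n)) (orbitProj M G m)) y).2, 0)
          + K.symm (0, ξ) :=
        (map_add (chartDeriv e m) u (fundamental EG G m ξ)).trans
          (congrArg₂ (fun a b : E => a + b) hu (ha.chartDeriv_fundamental hlam hme ξ))
      refine (congrArg (fun v => (K v).1) h1).trans ?_
      simp

theorem RouthChart.routhian_sec {A : PrincipalConnection E EG M G}
    {eB : OpenPartialHomeomorph (MulAction.orbitRel.Quotient G M)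
      (EuclideanSpace ℝ (Fin n))} {w : TangentBundle 𝓘(ℝ, E) M} (c : RouthChart A L μ eB w)
    {y : TangentBundle (𝓡 n) (MulAction.orbitRel.Quotient G M)} (hy : y ∈ c.dom) :
    routhian A L (c.sec y) = flatRouthian (L ∘ (natChart c.e c.adapted.diffeo).symm)
      (formCoord A c.e) μ c.q (natCoord eB y) := by
  have h1 := c.natCoord_sec hy
  have h2 : momentum EG G L (c.sec y) = μ := c.sec_mem_levelSet hy
  have h3 := formCoord_apply A c.adapted.diffeo (c.sec_proj_mem hy) (c.sec y).2
  have h4 : c.e (c.sec y).proj = (c.q (natCoord eB y)).1 := congrArg Prod.fst h1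
  have h5 : chartDeriv c.e (c.sec y).proj (c.sec y).2 = (c.q (natCoord eB y)).2 :=
    congrArg Prod.snd h1
  rw [h4] at h3
  have h6 := (congrArg (formCoord A c.e (c.q (natCoord eB y)).1) h5).symm.trans h3
  rw [routhian, h2]
  exact congrArg (fun v => L (c.sec y) - v) (congrArg μ h6.symm)

variable [ChartedSpace (ModelProd (EuclideanSpace ℝ (Fin n)) (EuclideanSpace ℝ (Fin n)))
  (LevelQuotient L μ)] {hbundle : IsPrincipalBundle E EG n M G}
  {A : PrincipalConnection E EG M G}

namespace RouthChart

variable {eB : OpenPartialHomeomorph (MulAction.orbitRel.Quotient G M) (EuclideanSpace ℝ (Fin n))}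
  {w : TangentBundle 𝓘(ℝ, E) M}

theorem isPartialDiffeo_quotHomeo (c : RouthChart A L μ eB w) (hw : w ∈ levelSet L μ)
    (hφ : IsLocalDiffeomorph (𝓡 n).tangent (𝓡 n).tangent ∞ (reducedProj hbundle L μ)) :
    IsPartialDiffeo (𝓡 n).tangent (𝓡 n).tangent (c.quotHomeo hw) := by
  refine ⟨hφ.contMDiff.contMDiffOn, fun y hy => ContMDiffAt.contMDiffWithinAt
    (contMDiffAt_section hφ ((c.quotHomeo hw).continuousAt_symm hy) ?_)⟩
  filter_upwards [(c.quotHomeo hw).open_target.mem_nhds hy] with y' hy'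
  exact (c.quotHomeo hw).right_inv hy'

/-- Local coordinates `(x, v)` on `N_μ / G`. -/
def quotChart (c : RouthChart A L μ eB w) (hw : w ∈ levelSet L μ) :
    OpenPartialHomeomorph (LevelQuotient L μ)
      (EuclideanSpace ℝ (Fin n) × EuclideanSpace ℝ (Fin n)) :=
  (c.quotHomeo hw).trans (natChart eB c.base)

theorem isPartialDiffeo_quotChart (c : RouthChart A L μ eB w) (hw : w ∈ levelSet L μ)
    (hφ : IsLocalDiffeomorph (𝓡 n).tangent (𝓡 n).tangent ∞ (reducedProj hbundle L μ)) :
    IsPartialDiffeo (𝓡 n).tangent 𝓘(ℝ, EuclideanSpace ℝ (Fin n) × EuclideanSpace ℝ (Fin n))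
      (c.quotChart hw) :=
  (c.isPartialDiffeo_quotHomeo hw hφ).trans (isPartialDiffeo_natChart c.base)

theorem mem_quotChart_source (c : RouthChart A L μ eB w) (hw : w ∈ levelSet L μ) :
    levelProj L μ ⟨w, hw⟩ ∈ (c.quotChart hw).source :=
  ⟨c.mem_quotHomeo_source hw, c.mem_dom.1⟩

theorem reducedProj_mem_dom (c : RouthChart A L μ eB w) (hw : w ∈ levelSet L μ)
    {z : LevelQuotient L μ} (hz : z ∈ (c.quotChart hw).source) :
    reducedProj hbundle L μ z ∈ c.dom := hz.1.2

theorem levelProj_sec (c : RouthChart A L μ eB w) (hw : w ∈ levelSet L μ)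
    {z : LevelQuotient L μ} (hz : z ∈ (c.quotHomeo hw).source) :
    levelProj L μ ⟨c.sec (reducedProj hbundle L μ z), c.sec_mem_levelSet hz.2⟩ = z :=
  (c.quotSec_eq hw hz.2).symm.trans ((c.quotHomeo hw).left_inv hz)

end RouthChart

/-- Near `w`, the projection extends to an open set of `TM` as `quotSec ∘ tangentProj`, because
nearby points of `N_μ` lie on the orbits of the section. The section of the quotient is `sec`
composed with `φ`. -/
theorem isQuotientManifold (hbundle : IsPrincipalBundle E EG n M G)
    (A : PrincipalConnection E EG M G)
    (hL : ContMDiff 𝓘(ℝ, E).tangent 𝓘(ℝ, ℝ) ∞ L)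
    (hinv : ∀ (g : G) (w : TangentBundle 𝓘(ℝ, E) M), L (tangentAct g w) = L w)
    (hreg : IsRegular L) (hgreg : IsGroupRegular EG G L)
    (hφ : IsLocalDiffeomorph (𝓡 n).tangent (𝓡 n).tangent ∞ (reducedProj hbundle L μ)) :
    IsQuotientManifold (n := n) L μ := by
  constructor
  · intro w
    obtain ⟨c⟩ := nonempty_routhChart_chartAt hbundle A hL hinv hreg hgreg w
    have hd := c.isPartialDiffeo_quotHomeo w.2 hφ
    have hmap := (c.quotHomeo w.2).map_source (c.mem_quotHomeo_source w.2)
    refine ⟨interior {w' | w' ∈ levelSet L μ →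
      ∃ g : G, tangentAct g w' = c.sec (tangentProj E n M G w')} ∩
      tangentProj E n M G ⁻¹' (c.quotHomeo w.2).target,
      fun w' => c.quotSec w.2 (tangentProj E n M G w'), ?_, ?_, ?_, ?_⟩
    · exact isOpen_interior.inter ((c.quotHomeo w.2).open_target.preimage
        (contMDiff_tangentProj hbundle).continuous)
    · exact ⟨mem_interior_iff_mem_nhds.2 c.eventually_sec, hmap⟩
    · exact hd.smooth_symm.comp (contMDiff_tangentProj hbundle).contMDiffOn fun w' hw' => hw'.2
    · intro w' hw'
      obtain ⟨g, hg⟩ := interior_subset (s := {w' | w' ∈ levelSet L μ →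
        ∃ g : G, tangentAct g w' = c.sec (tangentProj E n M G w')}) hw'.1 w'.2
      exact (c.quotSec_eq w.2 hw'.2.1).trans (levelProj_eq g hg).symm
  · intro w
    obtain ⟨c⟩ := nonempty_routhChart_chartAt hbundle A hL hinv hreg hgreg w
    refine ⟨(c.quotHomeo w.2).source, fun z => c.sec (reducedProj hbundle L μ z),
      (c.quotHomeo w.2).open_source, c.mem_quotHomeo_source w.2, ?_, c.sec_tangentProj,
      fun z hz => ⟨_, c.levelProj_sec w.2 hz⟩⟩
    exact c.contMDiffOn_sec.comp hφ.contMDiff.contMDiffOn fun z hz => hz.2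

/-! ### The reduced Routhian -/

/-- The reduced Routhian. -/
def reducedRouthian (A : PrincipalConnection E EG M G) {L : TangentBundle 𝓘(ℝ, E) M → ℝ}
    (hL : ContMDiff 𝓘(ℝ, E).tangent 𝓘(ℝ, ℝ) ∞ L)
    (hinv : ∀ (g : G) (w : TangentBundle 𝓘(ℝ, E) M), L (tangentAct g w) = L w)
    (μ : GroupLieAlgebra 𝓘(ℝ, EG) G →L[ℝ] ℝ) : LevelQuotient L μ → ℝ :=
  Quot.lift (fun w => routhian A L w.1) (by
    rintro w w' ⟨g, hg⟩
    rw [← hg, routhian_tangentAct hL hinv])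

theorem RouthChart.reducedRouthian_eq {eB : OpenPartialHomeomorph
      (MulAction.orbitRel.Quotient G M) (EuclideanSpace ℝ (Fin n))}
    {w : TangentBundle 𝓘(ℝ, E) M} (c : RouthChart A L μ eB w) (hw : w ∈ levelSet L μ)
    {z : LevelQuotient L μ} (hz : z ∈ (c.quotChart hw).source) :
    reducedRouthian A c.smooth c.invariant μ z
      = flatRouthian (L ∘ (natChart c.e c.adapted.diffeo).symm)
        (formCoord A c.e) μ c.q (c.quotChart hw z) := by
  refine Eq.trans ?_ (c.routhian_sec (c.reducedProj_mem_dom (hbundle := c.bundle) hw hz))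
  exact congrArg _ (c.levelProj_sec (hbundle := c.bundle) hw hz.1).symm

theorem RouthChart.reducedRouthian_symm {eB : OpenPartialHomeomorph
      (MulAction.orbitRel.Quotient G M) (EuclideanSpace ℝ (Fin n))}
    {w : TangentBundle 𝓘(ℝ, E) M} (c : RouthChart A L μ eB w) (hw : w ∈ levelSet L μ)
    {p : EuclideanSpace ℝ (Fin n) × EuclideanSpace ℝ (Fin n)} (hp : p ∈ (c.quotChart hw).target) :
    reducedRouthian A c.smooth c.invariant μ ((c.quotChart hw).symm p)
      = flatRouthian (L ∘ (natChart c.e c.adapted.diffeo).symm) (formCoord A c.e) μ c.q p := by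
  rw [c.reducedRouthian_eq hw ((c.quotChart hw).map_target hp), (c.quotChart hw).right_inv hp]

theorem contMDiff_reducedRouthian (hbundle : IsPrincipalBundle E EG n M G)
    (A : PrincipalConnection E EG M G)
    (hL : ContMDiff 𝓘(ℝ, E).tangent 𝓘(ℝ, ℝ) ∞ L)
    (hinv : ∀ (g : G) (w : TangentBundle 𝓘(ℝ, E) M), L (tangentAct g w) = L w)
    (hreg : IsRegular L) (hgreg : IsGroupRegular EG G L)
    (hφ : IsLocalDiffeomorph (𝓡 n).tangent (𝓡 n).tangent ∞ (reducedProj hbundle L μ)) :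
    ContMDiff (𝓡 n).tangent 𝓘(ℝ, ℝ) ∞ (reducedRouthian A hL hinv μ) := by
  intro z
  obtain ⟨w, rfl⟩ := Quot.exists_rep z
  obtain ⟨c⟩ := nonempty_routhChart_chartAt hbundle A hL hinv hreg hgreg w
  have hz : levelProj L μ w ∈ (c.quotChart w.2).source := c.mem_quotChart_source w.2
  refine (c.isPartialDiffeo_quotChart w.2 hφ).contMDiffAt_of_comp_symm hz ?_
  have h1 := c.slice.contDiffAt_flatRouthian c.flat
    (c.natCoord_mem (c.reducedProj_mem_dom (hbundle := hbundle) w.2 hz))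
  refine ContMDiffAt.congr_of_eventuallyEq h1.contMDiffAt ?_
  filter_upwards [(c.quotChart w.2).open_target.mem_nhds ((c.quotChart w.2).map_source hz)]
    with p hp using c.reducedRouthian_symm w.2 hp

end QuotientManifold

section ReducedField

variable {E : Type*} [NormedAddCommGroup E] [NormedSpace ℝ E] [FiniteDimensional ℝ E]
  {EG : Type*} [NormedAddCommGroup EG] [NormedSpace ℝ EG] [FiniteDimensional ℝ EG] {n : ℕ}
  {M : Type*} [TopologicalSpace M] [ChartedSpace E M] [IsManifold 𝓘(ℝ, E) ∞ M]
  {G : Type*} [TopologicalSpace G] [ChartedSpace EG G] [CommGroup G] [LieGroup 𝓘(ℝ, EG) ∞ G]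
  [MulAction G M] [ContMDiffSMul 𝓘(ℝ, EG) 𝓘(ℝ, E) ∞ G M]
  [ChartedSpace (EuclideanSpace ℝ (Fin n)) (MulAction.orbitRel.Quotient G M)]
  [IsManifold (𝓡 n) ∞ (MulAction.orbitRel.Quotient G M)]
  {L : TangentBundle 𝓘(ℝ, E) M → ℝ}
  {μ : GroupLieAlgebra 𝓘(ℝ, EG) G →L[ℝ] ℝ} {A : PrincipalConnection E EG M G}
  {hbundle : IsPrincipalBundle E EG n M G}
  {Γ : ∀ w : TangentBundle 𝓘(ℝ, E) M, TangentSpace 𝓘(ℝ, E).tangent w}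

/-! ### The reduced vector field -/

theorem mfderiv_fundamentalT {F : Type*} [NormedAddCommGroup F] [NormedSpace ℝ F]
    {H : Type*} [TopologicalSpace H] {J : ModelWithCorners ℝ F H}
    {N : Type*} [TopologicalSpace N] [ChartedSpace H N] {f : TangentBundle 𝓘(ℝ, E) M → N}
    {w : TangentBundle 𝓘(ℝ, E) M} (hf : MDifferentiableAt 𝓘(ℝ, E).tangent J f w)
    (hinv : ∀ g : G, f (tangentAct g w) = f w) (ξ : GroupLieAlgebra 𝓘(ℝ, EG) G) :
    (mfderiv 𝓘(ℝ, E).tangent J f w : E × E →L[ℝ] F) (fundamentalT EG G w ξ) = 0 := by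
  by_cases hd : MDifferentiableAt 𝓘(ℝ, EG) 𝓘(ℝ, E).tangent (fun g : G => tangentAct g w) 1
  · have h1 := mfderiv_comp_of_eq (I' := 𝓘(ℝ, E).tangent) hf hd (tangentAct_one w)
    have h2 : f ∘ (fun g : G => tangentAct g w) = fun _ => f w := funext hinv
    have h3 : mfderiv 𝓘(ℝ, EG) J (f ∘ fun g : G => tangentAct g w) 1 = 0 := by
      rw [h2]
      exact mfderiv_const
    have h4 := congrArg (fun T : EG →L[ℝ] F => T ξ) (h1.symm.trans h3)
    refine Eq.trans ?_ h4
    have h5 : ∀ w', w' = w → (mfderiv 𝓘(ℝ, E).tangent J f w : E × E →L[ℝ] F)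
        (fundamentalT EG G w ξ) = (mfderiv 𝓘(ℝ, E).tangent J f w' : E × E →L[ℝ] F)
          (fundamentalT EG G w ξ) := by
      rintro _ rfl
      rfl
    exact h5 _ (tangentAct_one w)
  -- If the orbit map into `TM` were not differentiable, `mfderiv` would be zero by convention and
  -- the claim would hold too; its differentiability need not be established.
  · have h1 : fundamentalT EG G w ξ = 0 := by
      rw [fundamentalT, mfderiv_zero_of_not_mdifferentiableAt hd]
      rfl
    exact (congrArg (mfderiv 𝓘(ℝ, E).tangent J f w : E × E →L[ℝ] F) h1).trans (map_zero _)

/-- The derivative of the projection `N_μ → T(M/G)` along an invariant field is constant on the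
orbits. -/
theorem mfderiv_tangentProj_tangentAct (hbundle : IsPrincipalBundle E EG n M G)
    (hΓinv : ∀ (g : G) (w : TangentBundle 𝓘(ℝ, E) M),
      mfderiv 𝓘(ℝ, E).tangent 𝓘(ℝ, E).tangent (tangentAct (E := E) (M := M) g) w (Γ w)
        = Γ (tangentAct g w)) (g : G) (w : TangentBundle 𝓘(ℝ, E) M) :
    (mfderiv 𝓘(ℝ, E).tangent (𝓡 n).tangent (tangentProj E n M G) (tangentAct g w) :
        E × E →L[ℝ] EuclideanSpace ℝ (Fin n) × EuclideanSpace ℝ (Fin n)) (Γ (tangentAct g w))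
      = (mfderiv 𝓘(ℝ, E).tangent (𝓡 n).tangent (tangentProj E n M G) w :
        E × E →L[ℝ] EuclideanSpace ℝ (Fin n) × EuclideanSpace ℝ (Fin n)) (Γ w) := by
  have h1 : tangentProj E n M G ∘ tangentAct g = tangentProj E n M G :=
    funext fun w => tangentProj_tangentAct hbundle g w
  have h2 := mfderiv_comp (I' := 𝓘(ℝ, E).tangent) w
    ((contMDiff_tangentProj hbundle).mdifferentiableAt (by simp))
    ((contMDiff_tangentAct (E := E) (M := M) EG g).mdifferentiableAt (x := w) (by simp))
  have h3 := congrArg (fun f : TangentBundle 𝓘(ℝ, E) M →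
    TangentBundle (𝓡 n) (MulAction.orbitRel.Quotient G M) =>
    (mfderiv 𝓘(ℝ, E).tangent (𝓡 n).tangent f w :
      E × E →L[ℝ] EuclideanSpace ℝ (Fin n) × EuclideanSpace ℝ (Fin n)) (Γ w)) h1
  have h4 := congrArg (fun T : E × E →L[ℝ] EuclideanSpace ℝ (Fin n) × EuclideanSpace ℝ (Fin n) =>
    T (Γ w)) h2
  refine Eq.trans ?_ (h4.symm.trans h3)
  exact congrArg (mfderiv 𝓘(ℝ, E).tangent (𝓡 n).tangent (tangentProj E n M G) (tangentAct g w) :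
        E × E →L[ℝ] EuclideanSpace ℝ (Fin n) × EuclideanSpace ℝ (Fin n)) (hΓinv g w).symm

variable [ChartedSpace (ModelProd (EuclideanSpace ℝ (Fin n)) (EuclideanSpace ℝ (Fin n)))
  (LevelQuotient L μ)]

/-- The reduced vector field on `N_μ / G`. -/
def reducedField (hbundle : IsPrincipalBundle E EG n M G) (μ : GroupLieAlgebra 𝓘(ℝ, EG) G →L[ℝ] ℝ)
    [ChartedSpace (ModelProd (EuclideanSpace ℝ (Fin n)) (EuclideanSpace ℝ (Fin n)))
      (LevelQuotient L μ)]
    (Γ : ∀ w : TangentBundle 𝓘(ℝ, E) M, TangentSpace 𝓘(ℝ, E).tangent w)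
    (z : LevelQuotient L μ) : TangentSpace (𝓡 n).tangent z :=
  -- The representative is arbitrary; by `mfderiv_tangentProj_tangentAct` the vector does not depend
  -- on it when `Γ` is invariant.
  (mfderiv (𝓡 n).tangent (𝓡 n).tangent (reducedProj hbundle L μ) z).inverse
    ((mfderiv 𝓘(ℝ, E).tangent (𝓡 n).tangent (tangentProj E n M G) (Quot.out z).1 :
      E × E →L[ℝ] EuclideanSpace ℝ (Fin n) × EuclideanSpace ℝ (Fin n)) (Γ (Quot.out z).1))

theorem mfderiv_reducedProj_reducedField
    (hφ : IsLocalDiffeomorph (𝓡 n).tangent (𝓡 n).tangent ∞ (reducedProj hbundle L μ))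
    (hΓinv : ∀ (g : G) (w : TangentBundle 𝓘(ℝ, E) M),
      mfderiv 𝓘(ℝ, E).tangent 𝓘(ℝ, E).tangent (tangentAct (E := E) (M := M) g) w (Γ w)
        = Γ (tangentAct g w)) (w : levelSet L μ) :
    (mfderiv (𝓡 n).tangent (𝓡 n).tangent (reducedProj hbundle L μ) (levelProj L μ w) :
        EuclideanSpace ℝ (Fin n) × EuclideanSpace ℝ (Fin n) →L[ℝ] _)
        (reducedField hbundle μ Γ (levelProj L μ w))
      = (mfderiv 𝓘(ℝ, E).tangent (𝓡 n).tangent (tangentProj E n M G) w.1 :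
        E × E →L[ℝ] EuclideanSpace ℝ (Fin n) × EuclideanSpace ℝ (Fin n)) (Γ w.1) := by
  obtain ⟨g, hg⟩ := levelProj_eq_iff.1 (Quot.out_eq (levelProj L μ w)).symm
  have h1 := mfderiv_tangentProj_tangentAct hbundle hΓinv g w.1
  rw [hg] at h1
  exact (mfderiv_inverse_mfderiv hφ (levelProj L μ w) _).trans h1

namespace RouthChart

variable {eB : OpenPartialHomeomorph (MulAction.orbitRel.Quotient G M) (EuclideanSpace ℝ (Fin n))}
  {w : TangentBundle 𝓘(ℝ, E) M}

/-- The acceleration of the Euler-Lagrange field, in adapted coordinates. -/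
def accel (c : RouthChart A L μ eB w) (p : E × E) : E :=
  (fibreHess (L ∘ (natChart c.e c.adapted.diffeo).symm) p).inverse
    (elForce (L ∘ (natChart c.e c.adapted.diffeo).symm) p)

/-- The reduced field in the coordinates `(x, v)`. -/
theorem mfderiv_quotChart_reducedField (c : RouthChart A L μ eB w) (hw : w ∈ levelSet L μ)
    (hφ : IsLocalDiffeomorph (𝓡 n).tangent (𝓡 n).tangent ∞ (reducedProj hbundle L μ))
    (hreg : IsRegular L) (hΓ : IsEulerLagrangeField L Γ)
    {z : LevelQuotient L μ} (hz : z ∈ (c.quotChart hw).source) :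
    (mfderiv (𝓡 n).tangent 𝓘(ℝ, EuclideanSpace ℝ (Fin n) × EuclideanSpace ℝ (Fin n))
      (c.quotChart hw) z : EuclideanSpace ℝ (Fin n) × EuclideanSpace ℝ (Fin n) →L[ℝ]
        EuclideanSpace ℝ (Fin n) × EuclideanSpace ℝ (Fin n)) (reducedField hbundle μ Γ z)
      = ((c.quotChart hw z).2, (c.K (c.accel (c.q (c.quotChart hw z)))).1) := by
  have hΓinv := hΓ.mfderiv_tangentAct EG c.smooth c.invariant hreg
  have hy : reducedProj hbundle L μ z ∈ c.dom := c.reducedProj_mem_dom hw hz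
  set w' : levelSet L μ := ⟨c.sec (reducedProj hbundle L μ z), c.sec_mem_levelSet hy⟩ with hw'
  have hzw : levelProj L μ w' = z := c.levelProj_sec hw hz.1
  have he : w'.1.proj ∈ c.e.source := c.sec_proj_mem hy
  have hq : natCoord c.e w'.1 = c.q (c.quotChart hw z) := c.natCoord_sec hy
  have hproj : tangentProj E n M G w'.1 = reducedProj hbundle L μ z := c.tangentProj_sec hy
  have hn : MDifferentiableAt (𝓡 n).tangent
      𝓘(ℝ, EuclideanSpace ℝ (Fin n) × EuclideanSpace ℝ (Fin n)) (natCoord eB)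
      (reducedProj hbundle L μ z) :=
    (isPartialDiffeo_natChart c.base).mdifferentiableAt hy.1
  have h1 := mfderiv_comp (I' := (𝓡 n).tangent) z hn
    (hφ.contMDiff.mdifferentiableAt (by simp))
  have h2 : (mfderiv (𝓡 n).tangent (𝓡 n).tangent (reducedProj hbundle L μ) z :
        EuclideanSpace ℝ (Fin n) × EuclideanSpace ℝ (Fin n) →L[ℝ] _) (reducedField hbundle μ Γ z)
      = (mfderiv 𝓘(ℝ, E).tangent (𝓡 n).tangent (tangentProj E n M G) w'.1 :
        E × E →L[ℝ] EuclideanSpace ℝ (Fin n) × EuclideanSpace ℝ (Fin n)) (Γ w'.1) := by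
    have h3 := mfderiv_reducedProj_reducedField hφ hΓinv w'
    rwa [hzw] at h3
  have h3 := mfderiv_comp_of_eq (I' := (𝓡 n).tangent) (x := w'.1) hn
    ((contMDiff_tangentProj hbundle).mdifferentiableAt (by simp)) hproj
  let T : E × E →L[ℝ] EuclideanSpace ℝ (Fin n) × EuclideanSpace ℝ (Fin n) :=
    ((ContinuousLinearMap.fst ℝ _ EG).comp (c.K : E →L[ℝ] _)).prodMap
      ((ContinuousLinearMap.fst ℝ _ EG).comp (c.K : E →L[ℝ] _))
  -- In adapted coordinates the projection is the linear map `T`, so the reduced field is the image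
  -- under `T` of the velocity and the acceleration.
  have h4 : natCoord eB ∘ tangentProj E n M G =ᶠ[𝓝 w'.1] T ∘ natCoord c.e := by
    filter_upwards [c.κ.open_source.mem_nhds he] with w'' h5
    exact c.natCoord_tangentProj h5
  have h5 : mfderiv 𝓘(ℝ, E).tangent 𝓘(ℝ, EuclideanSpace ℝ (Fin n) × EuclideanSpace ℝ (Fin n))
      (T ∘ natCoord c.e) w'.1 = _ :=
    mfderiv_comp (I' := 𝓘(ℝ, E × E)) w'.1 T.differentiableAt.mdifferentiableAt
      ((isPartialDiffeo_natChart c.adapted.diffeo).mdifferentiableAt he)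
  have h6 : mfderiv 𝓘(ℝ, E × E) 𝓘(ℝ, EuclideanSpace ℝ (Fin n) × EuclideanSpace ℝ (Fin n)) T
      (natCoord c.e w'.1) = T := by
    rw [mfderiv_eq_fderiv]
    exact T.fderiv
  have h7 := (isELVector_iff_accel c.smooth hreg c.adapted.diffeo he _).1
    (hΓ.isELVector c.smooth c.adapted.diffeo he)
  have h8 : (mfderiv 𝓘(ℝ, E).tangent 𝓘(ℝ, EuclideanSpace ℝ (Fin n) × EuclideanSpace ℝ (Fin n))
      (natCoord eB ∘ tangentProj E n M G) w'.1 : E × E →L[ℝ] _) (Γ w'.1)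
      = T ((natCoord c.e w'.1).2, c.accel (natCoord c.e w'.1)) := by
    refine (congrArg (fun S : E × E →L[ℝ] EuclideanSpace ℝ (Fin n) × EuclideanSpace ℝ (Fin n) =>
      S (Γ w'.1)) (h4.mfderiv_eq.trans h5)).trans ?_
    refine (congrArg (fun S : E × E →L[ℝ] EuclideanSpace ℝ (Fin n) × EuclideanSpace ℝ (Fin n) =>
      S (mfderiv 𝓘(ℝ, E).tangent 𝓘(ℝ, E × E) (natCoord c.e) w'.1 (Γ w'.1))) h6).trans ?_
    exact congrArg T h7
  have h9 := congrArg (fun S : E × E →L[ℝ] EuclideanSpace ℝ (Fin n) × EuclideanSpace ℝ (Fin n) =>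
      S (Γ w'.1)) h3
  have h10 := congrArg (fun S : EuclideanSpace ℝ (Fin n) × EuclideanSpace ℝ (Fin n) →L[ℝ]
    EuclideanSpace ℝ (Fin n) × EuclideanSpace ℝ (Fin n) => S (reducedField hbundle μ Γ z)) h1
  refine h10.trans ?_
  refine (congrArg (mfderiv (𝓡 n).tangent 𝓘(ℝ, EuclideanSpace ℝ (Fin n) ×
    EuclideanSpace ℝ (Fin n)) (natCoord eB) (reducedProj hbundle L μ z) :
    EuclideanSpace ℝ (Fin n) × EuclideanSpace ℝ (Fin n) →L[ℝ]
    EuclideanSpace ℝ (Fin n) × EuclideanSpace ℝ (Fin n)) h2).trans ?_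
  have h11 : ∀ y, y = reducedProj hbundle L μ z →
      (mfderiv (𝓡 n).tangent 𝓘(ℝ, EuclideanSpace ℝ (Fin n) ×
        EuclideanSpace ℝ (Fin n)) (natCoord eB) (reducedProj hbundle L μ z) :
        EuclideanSpace ℝ (Fin n) × EuclideanSpace ℝ (Fin n) →L[ℝ]
        EuclideanSpace ℝ (Fin n) × EuclideanSpace ℝ (Fin n)) =
      (mfderiv (𝓡 n).tangent 𝓘(ℝ, EuclideanSpace ℝ (Fin n) ×
        EuclideanSpace ℝ (Fin n)) (natCoord eB) y :
        EuclideanSpace ℝ (Fin n) × EuclideanSpace ℝ (Fin n) →L[ℝ]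
        EuclideanSpace ℝ (Fin n) × EuclideanSpace ℝ (Fin n)) := by
    rintro _ rfl
    rfl
  refine (congrArg (fun S : EuclideanSpace ℝ (Fin n) × EuclideanSpace ℝ (Fin n) →L[ℝ]
    EuclideanSpace ℝ (Fin n) × EuclideanSpace ℝ (Fin n) => S
      ((mfderiv 𝓘(ℝ, E).tangent (𝓡 n).tangent (tangentProj E n M G) w'.1 :
        E × E →L[ℝ] EuclideanSpace ℝ (Fin n) × EuclideanSpace ℝ (Fin n)) (Γ w'.1)))
      (h11 _ hproj)).trans ?_
  refine h9.symm.trans (h8.trans ?_)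
  rw [hq]
  exact Prod.ext (c.slice.velocity _ (c.natCoord_mem hy)) rfl

end RouthChart

theorem contMDiff_reducedField [IsManifold (𝓡 n).tangent ∞ (LevelQuotient L μ)]
    (A : PrincipalConnection E EG M G)
    (hL : ContMDiff 𝓘(ℝ, E).tangent 𝓘(ℝ, ℝ) ∞ L)
    (hinv : ∀ (g : G) (w : TangentBundle 𝓘(ℝ, E) M), L (tangentAct g w) = L w)
    (hreg : IsRegular L) (hgreg : IsGroupRegular EG G L)
    (hφ : IsLocalDiffeomorph (𝓡 n).tangent (𝓡 n).tangent ∞ (reducedProj hbundle L μ))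
    (hΓ : IsEulerLagrangeField L Γ) :
    ContMDiff (𝓡 n).tangent (𝓡 n).tangent.tangent ∞ (fun z => (⟨z, reducedField hbundle μ Γ z⟩ :
      TangentBundle (𝓡 n).tangent (LevelQuotient L μ))) := by
  have := FiniteDimensional.complete ℝ E
  intro z
  obtain ⟨w, rfl⟩ := Quot.exists_rep z
  obtain ⟨c⟩ := nonempty_routhChart_chartAt hbundle A hL hinv hreg hgreg w
  have hz : levelProj L μ w ∈ (c.quotChart w.2).source := c.mem_quotChart_source w.2
  have hy := c.reducedProj_mem_dom (hbundle := hbundle) w.2 hz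
  have hn : c.quotChart w.2 (levelProj L μ w) ∈ c.O := c.natCoord_mem hy
  refine (c.isPartialDiffeo_quotChart w.2 hφ).contMDiffAt_vectorField hz
    (vec := fun p => (p.2, (c.K (c.accel (c.q p))).1)) ?_ ?_
  · have h1 : ContDiffAt ℝ ∞ c.accel (c.q (c.quotChart w.2 (levelProj L μ w))) := by
      have h2 := isInvertible_fibreHess hL hreg c.adapted.diffeo (c.sec_proj_mem hy)
      have h3 := contDiffAt_lagrangian hL c.adapted.diffeo (c.sec_proj_mem hy)
      rw [c.natCoord_sec hy] at h2 h3
      exact contDiffAt_elAccel h3 h2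
    have h2 := h1.comp _ (c.slice.contDiffAt hn)
    exact contDiffAt_snd.prodMk (c.K.contDiff.contDiffAt.comp _ h2).fst
  · filter_upwards [(c.quotChart w.2).open_source.mem_nhds hz] with z' hz'
    exact c.mfderiv_quotChart_reducedField w.2 hφ hreg hΓ hz'

theorem mfderiv_proj_reducedField
    (A : PrincipalConnection E EG M G)
    (hL : ContMDiff 𝓘(ℝ, E).tangent 𝓘(ℝ, ℝ) ∞ L)
    (hinv : ∀ (g : G) (w : TangentBundle 𝓘(ℝ, E) M), L (tangentAct g w) = L w)
    (hreg : IsRegular L) (hgreg : IsGroupRegular EG G L)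
    (hφ : IsLocalDiffeomorph (𝓡 n).tangent (𝓡 n).tangent ∞ (reducedProj hbundle L μ))
    (hΓ : IsEulerLagrangeField L Γ) (z : LevelQuotient L μ) :
    mfderiv (𝓡 n).tangent (𝓡 n) (fun z' => (reducedProj hbundle L μ z').proj) z
      (reducedField hbundle μ Γ z) = (reducedProj hbundle L μ z).2 := by
  obtain ⟨w, rfl⟩ := Quot.exists_rep z
  obtain ⟨c⟩ := nonempty_routhChart_chartAt hbundle A hL hinv hreg hgreg w
  have hz : levelProj L μ w ∈ (c.quotChart w.2).source := c.mem_quotChart_source w.2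
  have hy := c.reducedProj_mem_dom (hbundle := hbundle) w.2 hz
  have hd := (c.isPartialDiffeo_quotChart w.2 hφ).mdifferentiableAt hz
  have hp : MDifferentiableAt (𝓡 n).tangent (𝓡 n)
      (fun z' => (reducedProj hbundle L μ z').proj) (levelProj L μ w) :=
    MDifferentiableAt.comp (I' := (𝓡 n).tangent) _ (mdifferentiableAt_proj _)
      (hφ.contMDiff.mdifferentiableAt (by simp))
  refine c.base.mfderiv_injective hy.1 ?_
  have h1 := mfderiv_comp (I' := 𝓡 n) (levelProj L μ w) (c.base.mdifferentiableAt hy.1) hp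
  have h2 := mfderiv_comp (I' := 𝓘(ℝ, EuclideanSpace ℝ (Fin n) × EuclideanSpace ℝ (Fin n)))
    (levelProj L μ w) (mdifferentiableAt_iff_differentiableAt.2
      (differentiableAt_fst (𝕜 := ℝ) (E := EuclideanSpace ℝ (Fin n))
        (F := EuclideanSpace ℝ (Fin n)))) hd
  have h3 := c.mfderiv_quotChart_reducedField w.2 hφ hreg hΓ hz
  have h4 := h1.symm.trans h2
  refine (congrArg (fun T : EuclideanSpace ℝ (Fin n) × EuclideanSpace ℝ (Fin n) →L[ℝ]
    EuclideanSpace ℝ (Fin n) => T (reducedField hbundle μ Γ (levelProj L μ w))) h4).trans ?_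
  have h5 : mfderiv 𝓘(ℝ, EuclideanSpace ℝ (Fin n) × EuclideanSpace ℝ (Fin n)) (𝓡 n) Prod.fst
      (c.quotChart w.2 (levelProj L μ w)) = ContinuousLinearMap.fst ℝ (EuclideanSpace ℝ (Fin n))
        (EuclideanSpace ℝ (Fin n)) := by
    rw [mfderiv_eq_fderiv]
    exact fderiv_fst
  refine (congrArg (fun T : EuclideanSpace ℝ (Fin n) × EuclideanSpace ℝ (Fin n) →L[ℝ]
    EuclideanSpace ℝ (Fin n) => T ((mfderiv (𝓡 n).tangent 𝓘(ℝ, EuclideanSpace ℝ (Fin n) ×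
      EuclideanSpace ℝ (Fin n)) (c.quotChart w.2) (levelProj L μ w) :
      EuclideanSpace ℝ (Fin n) × EuclideanSpace ℝ (Fin n) →L[ℝ]
        EuclideanSpace ℝ (Fin n) × EuclideanSpace ℝ (Fin n))
        (reducedField hbundle μ Γ (levelProj L μ w)))) h5).trans ?_
  exact congrArg Prod.fst h3

/-- For any local extension `F` of the projection, `φ ∘ F` and `tangentProj` agree on `N_μ`, hence
have the same derivative along vectors tangent to `N_μ`. Both `Γ` and the vertical vectors are
tangent, and the vertical ones are killed by `tangentProj`. As the derivative of `φ` is injective,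
this determines the image under `F`. -/
theorem reducesTo_reducedField
    (A : PrincipalConnection E EG M G)
    (hL : ContMDiff 𝓘(ℝ, E).tangent 𝓘(ℝ, ℝ) ∞ L)
    (hinv : ∀ (g : G) (w : TangentBundle 𝓘(ℝ, E) M), L (tangentAct g w) = L w)
    (hreg : IsRegular L) (hgreg : IsGroupRegular EG G L)
    (hφ : IsLocalDiffeomorph (𝓡 n).tangent (𝓡 n).tangent ∞ (reducedProj hbundle L μ))
    (hΓ : IsEulerLagrangeField L Γ)
    (ξ : TangentBundle 𝓘(ℝ, E) M → GroupLieAlgebra 𝓘(ℝ, EG) G) :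
    ReducesTo L μ (fun w => Γ w + fundamentalT EG G w (ξ w)) (reducedField hbundle μ Γ) := by
  intro w F hF hFw
  obtain ⟨c⟩ := nonempty_routhChart_chartAt hbundle A hL hinv hreg hgreg w
  have hFw' : F w.1 = levelProj L μ w := hFw.self_of_nhds
  have hpd : MDifferentiableAt 𝓘(ℝ, E).tangent (𝓡 n).tangent (tangentProj E n M G) w.1 :=
    (contMDiff_tangentProj hbundle).mdifferentiableAt (by simp)
  have hZ : ∀ η : GroupLieAlgebra 𝓘(ℝ, EG) G, dirDeriv 𝓘(ℝ, E).tangent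
      (fun w' => momentum EG G L w' η) w.1 (Γ w.1 + fundamentalT EG G w.1 (ξ w.1)) = 0 := by
    intro η
    refine (map_add (mfderiv 𝓘(ℝ, E).tangent 𝓘(ℝ, ℝ) (fun w' => momentum EG G L w' η) w.1)
      (Γ w.1) (fundamentalT EG G w.1 (ξ w.1))).trans ?_
    have h1 := hΓ.dirDeriv_momentum_eq_zero hbundle hL hinv w.1 η
    have h2 := mfderiv_fundamentalT (J := 𝓘(ℝ, ℝ)) (f := fun w' => momentum EG G L w' η)
      ((contMDiff_momentum hbundle hL η).mdifferentiableAt (x := w.1) (by simp))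
      (fun g : G => congrArg (fun p : GroupLieAlgebra 𝓘(ℝ, EG) G →L[ℝ] ℝ => p η)
        (momentum_tangentAct hL hinv g w.1)) (ξ w.1)
    exact (congrArg₂ (fun a b : ℝ => a + b) h1 h2).trans (add_zero 0)
  have hφF : MDifferentiableAt 𝓘(ℝ, E).tangent (𝓡 n).tangent
      (reducedProj hbundle L μ ∘ F) w.1 :=
    MDifferentiableAt.comp (I' := (𝓡 n).tangent) w.1
      (hφ.contMDiff.mdifferentiableAt (by simp)) hF
  have h1 := c.mfderiv_congr w.2 hZ hφF hpd (by
    rw [nhds_subtype, eventually_comap] at hFw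
    filter_upwards [hFw] with w' h2 hw'
    exact congrArg (reducedProj hbundle L μ) (h2 ⟨w', hw'⟩ rfl))
  refine mfderiv_injective_of_isLocalDiffeomorph hφ (F w.1) ?_
  have h2 := congrArg (fun T : E × E →L[ℝ] EuclideanSpace ℝ (Fin n) × EuclideanSpace ℝ (Fin n) =>
    T (Γ w.1 + fundamentalT EG G w.1 (ξ w.1))) (mfderiv_comp (I' := (𝓡 n).tangent) w.1
      (hφ.contMDiff.mdifferentiableAt (x := F w.1) (by simp)) hF)
  refine h2.symm.trans (h1.trans ?_)
  refine (map_add (mfderiv 𝓘(ℝ, E).tangent (𝓡 n).tangent (tangentProj E n M G) w.1)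
      (Γ w.1) (fundamentalT EG G w.1 (ξ w.1))).trans ?_
  have h3 := mfderiv_fundamentalT hpd (fun g : G => tangentProj_tangentAct hbundle g w.1) (ξ w.1)
  have h4 := mfderiv_reducedProj_reducedField hφ
    (hΓ.mfderiv_tangentAct EG hL hinv hreg) w
  rw [← hFw'] at h4
  refine Eq.trans ?_ h4.symm
  let Y : EuclideanSpace ℝ (Fin n) × EuclideanSpace ℝ (Fin n) :=
    (mfderiv 𝓘(ℝ, E).tangent (𝓡 n).tangent (tangentProj E n M G) w.1 :
      E × E →L[ℝ] EuclideanSpace ℝ (Fin n) × EuclideanSpace ℝ (Fin n)) (Γ w.1)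
  exact (congrArg (fun v => Y + v) h3).trans (add_zero Y)

end ReducedField

/-! ### Velocities of curves in local coordinates -/

section Curves

variable {F : Type*} [NormedAddCommGroup F] [NormedSpace ℝ F]
  {H : Type*} [TopologicalSpace H] {I : ModelWithCorners ℝ F H}
  {N : Type*} [TopologicalSpace N] [ChartedSpace H N]
  {V : Type*} [NormedAddCommGroup V] [NormedSpace ℝ V]

theorem hasDerivAt_of_hasMFDerivAt {f : N → V} {c : ℝ → N} {t : ℝ}
    (hf : MDifferentiableAt I 𝓘(ℝ, V) f (c t)) {T : ℝ →L[ℝ] F}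
    (hc : HasMFDerivAt 𝓘(ℝ, ℝ) I c t T) :
    HasDerivAt (fun τ => f (c τ)) ((mfderiv I 𝓘(ℝ, V) f (c t) : F →L[ℝ] V) (T 1)) t := by
  let S : ℝ →L[ℝ] V := (mfderiv I 𝓘(ℝ, V) f (c t) : F →L[ℝ] V).comp T
  have h1 : HasMFDerivAt 𝓘(ℝ, ℝ) 𝓘(ℝ, V) (fun τ => f (c τ)) t S := hf.hasMFDerivAt.comp t hc
  have h2 : HasFDerivAt (fun τ => f (c τ)) S t := hasMFDerivAt_iff_hasFDerivAt.1 h1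
  exact h2.hasDerivAt

theorem fderiv_apply_eq_zero_of_single {n : ℕ}
    {f : EuclideanSpace ℝ (Fin n) × EuclideanSpace ℝ (Fin n) → ℝ}
    {y Y : EuclideanSpace ℝ (Fin n) × EuclideanSpace ℝ (Fin n)} (hf : ContDiffAt ℝ ∞ f y)
    (h : ∀ i : Fin n, fderiv ℝ (fun p => fderiv ℝ f p (0, EuclideanSpace.single i (1 : ℝ))) y Y = 0)
    (k : EuclideanSpace ℝ (Fin n)) : fderiv ℝ (fun p => fderiv ℝ f p (0, k)) y Y = 0 := by
  rw [fderiv_fderiv_apply hf]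
  let T : EuclideanSpace ℝ (Fin n) →L[ℝ] ℝ :=
    (fderiv ℝ (fderiv ℝ f) y Y).comp (ContinuousLinearMap.inr ℝ _ _)
  have h1 : ∀ i : Fin n, T (EuclideanSpace.single i (1 : ℝ)) = 0 := by
    intro i
    have h2 := h i
    rwa [fderiv_fderiv_apply hf] at h2
  have h2 : T.toLinearMap = 0 := by
    refine (EuclideanSpace.basisFun (Fin n) ℝ).toBasis.ext fun i => ?_
    simpa using h1 i
  exact congrArg (fun S : EuclideanSpace ℝ (Fin n) →ₗ[ℝ] ℝ => S k) h2

end Curves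

section RouthEquations

variable {E : Type*} [NormedAddCommGroup E] [NormedSpace ℝ E] [FiniteDimensional ℝ E]
  {EG : Type*} [NormedAddCommGroup EG] [NormedSpace ℝ EG] [FiniteDimensional ℝ EG] {n : ℕ}
  {M : Type*} [TopologicalSpace M] [ChartedSpace E M] [IsManifold 𝓘(ℝ, E) ∞ M]
  {G : Type*} [TopologicalSpace G] [ChartedSpace EG G] [CommGroup G] [LieGroup 𝓘(ℝ, EG) ∞ G]
  [MulAction G M] [ContMDiffSMul 𝓘(ℝ, EG) 𝓘(ℝ, E) ∞ G M]
  [ChartedSpace (EuclideanSpace ℝ (Fin n)) (MulAction.orbitRel.Quotient G M)]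
  [IsManifold (𝓡 n) ∞ (MulAction.orbitRel.Quotient G M)]
  {L : TangentBundle 𝓘(ℝ, E) M → ℝ}
  {μ : GroupLieAlgebra 𝓘(ℝ, EG) G →L[ℝ] ℝ} {A : PrincipalConnection E EG M G}
  {hbundle : IsPrincipalBundle E EG n M G}
  {Γ : ∀ w : TangentBundle 𝓘(ℝ, E) M, TangentSpace 𝓘(ℝ, E).tangent w}

/-! ### Routh's equations -/

/-- A point of `N_μ / G` is represented over each point of the corresponding fibre of `M`. -/
theorem exists_levelProj_eq (hL : ContMDiff 𝓘(ℝ, E).tangent 𝓘(ℝ, ℝ) ∞ L)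
    (hinv : ∀ (g : G) (w : TangentBundle 𝓘(ℝ, E) M), L (tangentAct g w) = L w)
    (z : LevelQuotient L μ) {m : M} (hm : orbitProj M G m = (reducedProj hbundle L μ z).proj) :
    ∃ w : levelSet L μ, w.1.proj = m ∧ levelProj L μ w = z := by
  obtain ⟨w, rfl⟩ := Quot.exists_rep z
  obtain ⟨g, hg⟩ := exists_smul_eq_of_orbitProj_eq (m := m) (m' := w.1.proj) hm
  exact ⟨⟨tangentAct g w.1, tangentAct_mem_levelSet hL hinv g w.2⟩, hg, (levelProj_eq g rfl).symm⟩

variable [ChartedSpace (ModelProd (EuclideanSpace ℝ (Fin n)) (EuclideanSpace ℝ (Fin n)))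
  (LevelQuotient L μ)]

namespace RouthChart

variable {eB : OpenPartialHomeomorph (MulAction.orbitRel.Quotient G M) (EuclideanSpace ℝ (Fin n))}
  {w : TangentBundle 𝓘(ℝ, E) M}

/-- The Routhian in adapted coordinates. -/
def localRouthian (c : RouthChart A L μ eB w) :
    EuclideanSpace ℝ (Fin n) × EuclideanSpace ℝ (Fin n) → ℝ :=
  flatRouthian (L ∘ (natChart c.e c.adapted.diffeo).symm) (formCoord A c.e) μ c.q

theorem quotChart_mem (c : RouthChart A L μ eB w) (hw : w ∈ levelSet L μ)
    {z : LevelQuotient L μ} (hz : z ∈ (c.quotChart hw).source) : c.quotChart hw z ∈ c.O :=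
  c.natCoord_mem (c.reducedProj_mem_dom (hbundle := c.bundle) hw hz)

theorem q_quotChart (c : RouthChart A L μ eB w) (hw : w ∈ levelSet L μ) :
    c.q (c.quotChart hw (levelProj L μ ⟨w, hw⟩)) = natCoord c.e w :=
  (congrArg c.q (c.natCoord_tangentProj c.mem)).trans c.slice.apply_mem

theorem coordDeriv_reducedRouthian (c : RouthChart A L μ eB w) (hw : w ∈ levelSet L μ)
    (hφ : IsLocalDiffeomorph (𝓡 n).tangent (𝓡 n).tangent ∞ (reducedProj hbundle L μ))
    (hR : ContMDiff (𝓡 n).tangent 𝓘(ℝ, ℝ) ∞ (reducedRouthian A c.smooth c.invariant μ))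
    {z : LevelQuotient L μ} (hz : z ∈ (c.quotChart hw).source)
    (a : EuclideanSpace ℝ (Fin n) × EuclideanSpace ℝ (Fin n)) :
    coordDeriv (𝓡 n).tangent (fun z => natCoord eB (reducedProj hbundle L μ z))
      (reducedRouthian A c.smooth c.invariant μ) a z
      = fderiv ℝ c.localRouthian (c.quotChart hw z) a := by
  refine ((c.isPartialDiffeo_quotChart hw hφ).coordDeriv_eq hz
    (hR.mdifferentiableAt (by simp)) a).trans ?_
  refine congrArg (fun T : EuclideanSpace ℝ (Fin n) × EuclideanSpace ℝ (Fin n) →L[ℝ] ℝ => T a)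
    (Filter.EventuallyEq.fderiv_eq ?_)
  filter_upwards [(c.quotChart hw).open_target.mem_nhds ((c.quotChart hw).map_source hz)] with p hp
  exact c.reducedRouthian_symm hw hp

/-- Routh's equations for the reduced field. -/
theorem routh_equation (c : RouthChart A L μ eB w) (hw : w ∈ levelSet L μ)
    (hreg : IsRegular L) (hΓ : IsEulerLagrangeField L Γ) (i : Fin n) :
    fderiv ℝ (fun p => fderiv ℝ c.localRouthian p (0, EuclideanSpace.single i (1 : ℝ)))
        (c.quotChart hw (levelProj L μ ⟨w, hw⟩))
        ((c.quotChart hw (levelProj L μ ⟨w, hw⟩)).2,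
          (c.K (c.accel (c.q (c.quotChart hw (levelProj L μ ⟨w, hw⟩))))).1)
      - fderiv ℝ c.localRouthian (c.quotChart hw (levelProj L μ ⟨w, hw⟩))
          (EuclideanSpace.single i (1 : ℝ), 0)
      = - ∑ j : Fin n, μ (curvature A eB i j w.proj) *
          (c.quotChart hw (levelProj L μ ⟨w, hw⟩)).2 j := by
  have hy := c.quotChart_mem hw (c.mem_quotChart_source hw)
  have hq := c.q_quotChart hw
  have hEL : ∀ k, elExpr (L ∘ (natChart c.e c.adapted.diffeo).symm)
      (c.q (c.quotChart hw (levelProj L μ ⟨w, hw⟩)))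
      ((c.q (c.quotChart hw (levelProj L μ ⟨w, hw⟩))).2,
        c.accel (c.q (c.quotChart hw (levelProj L μ ⟨w, hw⟩)))) k = 0 := by
    have h1 := hΓ.isELVector c.smooth c.adapted.diffeo c.mem
    have h2 := (isELVector_iff_accel c.smooth hreg c.adapted.diffeo c.mem _).1 h1
    obtain ⟨a, h3, h4⟩ := h1
    have h5 : a = c.accel (natCoord c.e w) := congrArg Prod.snd (h3.symm.trans h2)
    rw [hq, ← h5]
    exact h4
  refine (c.slice.routh_equation c.flat hy hEL _).trans ?_
  have h6 : (c.q (c.quotChart hw (levelProj L μ ⟨w, hw⟩))).1 = c.e w.proj := congrArg Prod.fst hq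
  rw [h6]
  exact (sum_curvature c.adapted c.bundle c.base c.flat c.mem i μ _).symm

end RouthChart

/-- Along an integral curve, the time derivative of `∂R/∂v` is its derivative along the reduced
field, to which `RouthChart.routh_equation` applies at each instant. -/
theorem isRouthSolution_of_isMIntegralCurveOn
    (hL : ContMDiff 𝓘(ℝ, E).tangent 𝓘(ℝ, ℝ) ∞ L)
    (hinv : ∀ (g : G) (w : TangentBundle 𝓘(ℝ, E) M), L (tangentAct g w) = L w)
    (hreg : IsRegular L) (hgreg : IsGroupRegular EG G L)
    (hφ : IsLocalDiffeomorph (𝓡 n).tangent (𝓡 n).tangent ∞ (reducedProj hbundle L μ))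
    (hΓ : IsEulerLagrangeField L Γ) {γ : ℝ → LevelQuotient L μ} {s : Set ℝ} (hs : IsOpen s)
    (hγ : IsMIntegralCurveOn γ (reducedField hbundle μ Γ) s) :
    IsRouthSolution L μ A (reducedProj hbundle L μ) (reducedRouthian A hL hinv μ) γ s := by
  have hR := contMDiff_reducedRouthian hbundle A hL hinv hreg hgreg hφ
  -- Openness of `s` turns derivatives within `s` into derivatives.
  have hd : ∀ t ∈ s, HasMFDerivAt 𝓘(ℝ, ℝ) (𝓡 n).tangent γ t
      ((1 : ℝ →L[ℝ] ℝ).smulRight (reducedField hbundle μ Γ (γ t))) :=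
    fun t ht => (hγ t ht).hasMFDerivAt (hs.mem_nhds ht)
  refine ⟨fun t ht => (hd t ht).mdifferentiableAt, fun t ht => ?_, fun t ht e he hte i m hm => ?_⟩
  · have hp : MDifferentiableAt (𝓡 n).tangent (𝓡 n)
        (fun z' => (reducedProj hbundle L μ z').proj) (γ t) :=
      MDifferentiableAt.comp (I' := (𝓡 n).tangent) _ (mdifferentiableAt_proj _)
        (hφ.contMDiff.mdifferentiableAt (by simp))
    have h1 := hp.hasMFDerivAt.comp t (hd t ht)
    have h2 := mfderiv_proj_reducedField A hL hinv hreg hgreg hφ hΓ (γ t)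
    refine h1.congr_mfderiv (ContinuousLinearMap.ext_ring ?_)
    refine Eq.trans ?_ (h2.trans (one_smul ℝ _).symm)
    exact congrArg (mfderiv (𝓡 n).tangent (𝓡 n) (fun z' => (reducedProj hbundle L μ z').proj) (γ t))
      (one_smul ℝ _)
  -- The curvature is evaluated at the given point `m` of the fibre, so the representative of `γ t`
  -- is taken over `m`.
  · obtain ⟨w, rfl, hwz⟩ := exists_levelProj_eq hL hinv (γ t) hm
    have heB := isPartialDiffeo_of_mem_maximalAtlas he
    obtain ⟨c⟩ := nonempty_routhChart (eB := e) hbundle A hL hinv hreg hgreg heB w.2 (hm ▸ hte)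
    have hz : γ t ∈ (c.quotChart w.2).source := hwz ▸ c.mem_quotChart_source w.2
    have h1 := hasDerivAt_of_hasMFDerivAt
      ((c.isPartialDiffeo_quotChart w.2 hφ).mdifferentiableAt hz) (hd t ht)
    have h2 := c.mfderiv_quotChart_reducedField w.2 hφ hreg hΓ hz
    have hO := c.quotChart_mem w.2 hz
    have h3 : HasDerivAt (fun τ => c.quotChart w.2 (γ τ)) ((c.quotChart w.2 (γ t)).2,
        (c.K (c.accel (c.q (c.quotChart w.2 (γ t))))).1) t := by
      refine h1.congr_deriv (Eq.trans ?_ h2)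
      exact congrArg (mfderiv (𝓡 n).tangent 𝓘(ℝ, EuclideanSpace ℝ (Fin n) ×
        EuclideanSpace ℝ (Fin n)) (c.quotChart w.2) (γ t)) (one_smul ℝ _)
    have h4 := ((contDiffAt_fderiv_apply (c.slice.contDiffAt_flatRouthian c.flat hO)
      (0, EuclideanSpace.single i (1 : ℝ))).differentiableAt (by simp)).hasFDerivAt.comp_hasDerivAt
        t h3
    refine ⟨_, h4.congr_of_eventuallyEq ?_, ?_⟩
    · filter_upwards [(hd t ht).continuousAt.eventually
        ((c.quotChart w.2).open_source.mem_nhds hz)] with τ hτ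
      exact c.coordDeriv_reducedRouthian w.2 hφ hR hτ _
    · refine (congrArg₂ (fun a b : ℝ => a - b) rfl
        (c.coordDeriv_reducedRouthian w.2 hφ hR hz _)).trans ?_
      have h5 := c.routh_equation w.2 hreg hΓ i
      have hwz' : levelProj L μ ⟨w.1, w.2⟩ = γ t := hwz
      rw [hwz'] at h5
      exact h5

/-- Only the preferred chart at the point is needed. The condition `v = dx/dt` fixes the first
component of the velocity of the curve; Routh's equations fix the second, the reduced Routhian being
regular. -/
theorem isMIntegralCurveOn_of_isRouthSolution
    (hL : ContMDiff 𝓘(ℝ, E).tangent 𝓘(ℝ, ℝ) ∞ L)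
    (hinv : ∀ (g : G) (w : TangentBundle 𝓘(ℝ, E) M), L (tangentAct g w) = L w)
    (hreg : IsRegular L) (hgreg : IsGroupRegular EG G L)
    (hφ : IsLocalDiffeomorph (𝓡 n).tangent (𝓡 n).tangent ∞ (reducedProj hbundle L μ))
    (hΓ : IsEulerLagrangeField L Γ) {γ : ℝ → LevelQuotient L μ} {s : Set ℝ}
    (hγ : IsRouthSolution L μ A (reducedProj hbundle L μ) (reducedRouthian A hL hinv μ) γ s) :
    IsMIntegralCurveOn γ (reducedField hbundle μ Γ) s := by
  have hR := contMDiff_reducedRouthian hbundle A hL hinv hreg hgreg hφ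
  intro t ht
  have hd := (hγ.differentiable t ht).hasMFDerivAt
  set C : ℝ →L[ℝ] EuclideanSpace ℝ (Fin n) × EuclideanSpace ℝ (Fin n) :=
    mfderiv 𝓘(ℝ, ℝ) (𝓡 n).tangent γ t with hC
  obtain ⟨m, hm⟩ := Quotient.exists_rep (reducedProj hbundle L μ (γ t)).proj
  obtain ⟨w, rfl, hwz⟩ := exists_levelProj_eq hL hinv (γ t) (m := m) hm
  have hwz' : levelProj L μ ⟨w.1, w.2⟩ = γ t := hwz
  obtain ⟨c⟩ := nonempty_routhChart_chartAt hbundle A hL hinv hreg hgreg w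
  have hz : γ t ∈ (c.quotChart w.2).source := hwz ▸ c.mem_quotChart_source w.2
  have hO := c.quotChart_mem w.2 hz
  have hdom := c.reducedProj_mem_dom (hbundle := hbundle) w.2 hz
  have h2 := c.mfderiv_quotChart_reducedField w.2 hφ hreg hΓ hz
  have h1 := hasDerivAt_of_hasMFDerivAt
    ((c.isPartialDiffeo_quotChart w.2 hφ).mdifferentiableAt hz) hd
  set Y : EuclideanSpace ℝ (Fin n) × EuclideanSpace ℝ (Fin n) :=
    (mfderiv (𝓡 n).tangent 𝓘(ℝ, EuclideanSpace ℝ (Fin n) × EuclideanSpace ℝ (Fin n))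
      (c.quotChart w.2) (γ t) : EuclideanSpace ℝ (Fin n) × EuclideanSpace ℝ (Fin n) →L[ℝ] _) (C 1)
    with hY
  have hY1 : Y.1 = (c.quotChart w.2 (γ t)).2 := by
    have h3 := hasDerivAt_of_hasMFDerivAt (c.base.mdifferentiableAt hdom.1) (hγ.velocity t ht)
    refine HasDerivAt.unique (hasFDerivAt_fst.comp_hasDerivAt t h1) (h3.congr_deriv ?_)
    exact congrArg (mfderiv (𝓡 n) (𝓡 n) _ (reducedProj hbundle L μ (γ t)).proj) (one_smul ℝ _)
  -- The velocity of the curve and the reduced field satisfy the same equation and have the same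
  -- first component. Their difference `(0, ·)` is therefore in the kernel of the fibre Hessian of
  -- the reduced Routhian.
  have hY2 : Y.2 - (c.K (c.accel (c.q (c.quotChart w.2 (γ t))))).1 = 0 := by
    refine c.slice.eq_zero_of_fderiv_fderiv c.flat hO (fderiv_apply_eq_zero_of_single
      (c.slice.contDiffAt_flatRouthian c.flat hO) fun i => ?_)
    obtain ⟨a, ha, hai⟩ := hγ.routh t ht _ (IsManifold.chart_mem_maximalAtlas _) hdom.1 i w.1.proj hm
    have h4 := ((contDiffAt_fderiv_apply (c.slice.contDiffAt_flatRouthian c.flat hO)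
      (0, EuclideanSpace.single i (1 : ℝ))).differentiableAt (by simp)).hasFDerivAt.comp_hasDerivAt
        t h1
    have h5 := ha.unique (h4.congr_of_eventuallyEq (by
      filter_upwards [hd.continuousAt.eventually
        ((c.quotChart w.2).open_source.mem_nhds hz)] with τ hτ
      exact c.coordDeriv_reducedRouthian w.2 hφ hR hτ _))
    have h6 := c.routh_equation w.2 hreg hΓ i
    rw [hwz'] at h6
    have h7 := (congrArg (fun b : ℝ => a - b)
      (c.coordDeriv_reducedRouthian w.2 hφ hR hz _)).symm.trans hai
    have h8 := sub_left_inj.1 (h7.trans h6.symm)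
    have h9 := h5.symm.trans h8
    have h10 : ((0, Y.2 - (c.K (c.accel (c.q (c.quotChart w.2 (γ t))))).1) :
        EuclideanSpace ℝ (Fin n) × EuclideanSpace ℝ (Fin n))
        = Y - ((c.quotChart w.2 (γ t)).2, (c.K (c.accel (c.q (c.quotChart w.2 (γ t))))).1) :=
      Prod.ext (by simp [hY1]) rfl
    rw [h10, map_sub]
    exact sub_eq_zero.2 h9
  have hYr : Y = ((c.quotChart w.2 (γ t)).2, (c.K (c.accel (c.q (c.quotChart w.2 (γ t))))).1) :=
    Prod.ext hY1 (sub_eq_zero.1 hY2)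
  have hCr : C 1 = reducedField hbundle μ Γ (γ t) :=
    (c.isPartialDiffeo_quotChart w.2 hφ).mfderiv_injective hz (hYr.trans h2.symm)
  have hCC : C = (1 : ℝ →L[ℝ] ℝ).smulRight
      (reducedField hbundle μ Γ (γ t) : EuclideanSpace ℝ (Fin n) × EuclideanSpace ℝ (Fin n)) :=
    ContinuousLinearMap.ext_ring (hCr.trans (one_smul ℝ _).symm)
  exact (hCC ▸ hd).hasMFDerivWithinAt

end RouthEquations

end Routh
end

/-! ### The reduction theorem. -/

theorem mainTheorem7
    {E : Type*} [NormedAddCommGroup E] [NormedSpace ℝ E] [FiniteDimensional ℝ E]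
    {EG : Type*} [NormedAddCommGroup EG] [NormedSpace ℝ EG] [FiniteDimensional ℝ EG] {n : ℕ}
    {M : Type*} [TopologicalSpace M] [T2Space M] [SecondCountableTopology M]
    [ChartedSpace E M] [IsManifold 𝓘(ℝ, E) ∞ M]
    {G : Type*} [TopologicalSpace G] [ChartedSpace EG G] [CommGroup G]
    [LieGroup 𝓘(ℝ, EG) ∞ G] [ConnectedSpace G]
    [MulAction G M] [ContMDiffSMul 𝓘(ℝ, EG) 𝓘(ℝ, E) ∞ G M] [ProperSMul G M]
    (hfree : ∀ (g : G) (m : M), g • m = m → g = 1)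
    [ChartedSpace (EuclideanSpace ℝ (Fin n)) (MulAction.orbitRel.Quotient G M)]
    [IsManifold (𝓡 n) ∞ (MulAction.orbitRel.Quotient G M)]
    (hbundle : Routh.IsPrincipalBundle E EG n M G)
    (A : Routh.PrincipalConnection E EG M G)
    (L : TangentBundle 𝓘(ℝ, E) M → ℝ)
    (hL : ContMDiff 𝓘(ℝ, E).tangent 𝓘(ℝ, ℝ) ∞ L)
    (hinv : ∀ (g : G) (w : TangentBundle 𝓘(ℝ, E) M), L (Routh.tangentAct g w) = L w)
    (hreg : Routh.IsRegular L) (hgreg : Routh.IsGroupRegular EG G L)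
    (μ : GroupLieAlgebra 𝓘(ℝ, EG) G →L[ℝ] ℝ) :
    -- the Euler-Lagrange field exists and is unique
    (∃! Γ : ∀ w : TangentBundle 𝓘(ℝ, E) M, TangentSpace 𝓘(ℝ, E).tangent w,
      Routh.IsEulerLagrangeField L Γ) ∧
    -- `N_μ` is a regular level set (the momenta are smooth, their differentials independent), invariant under the whole of `G`
    (∀ ξ : GroupLieAlgebra 𝓘(ℝ, EG) G, ContMDiff 𝓘(ℝ, E).tangent 𝓘(ℝ, ℝ) ∞
      (fun w => Routh.momentum EG G L w ξ)) ∧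
    (∀ w ∈ Routh.levelSet L μ, ∀ ξ : GroupLieAlgebra 𝓘(ℝ, EG) G,
      (∀ Z : TangentSpace 𝓘(ℝ, E).tangent w, Routh.dirDeriv 𝓘(ℝ, E).tangent
        (fun w' => Routh.momentum EG G L w' ξ) w Z = 0) → ξ = 0) ∧
    (∀ (g : G), ∀ w ∈ Routh.levelSet L μ, Routh.tangentAct g w ∈ Routh.levelSet L μ) ∧
    -- the quotient manifold `N_μ / G`
    ∃ (_ : ChartedSpace (ModelProd (EuclideanSpace ℝ (Fin n)) (EuclideanSpace ℝ (Fin n)))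
        (Routh.LevelQuotient L μ))
      (_ : IsManifold (𝓡 n).tangent ∞ (Routh.LevelQuotient L μ))
      (φ : Routh.LevelQuotient L μ →
        TangentBundle (𝓡 n) (MulAction.orbitRel.Quotient G M)),
      Routh.IsQuotientManifold (n := n) L μ ∧
      -- the identification of `N_μ / G` with `T(M/G)`, induced by the tangent of `M → M / G`
      (∀ w : Routh.levelSet L μ, φ (Routh.levelProj L μ w) =
        tangentMap 𝓘(ℝ, E) (𝓡 n) (Routh.orbitProj M G) w.1) ∧
      IsLocalDiffeomorph (𝓡 n).tangent (𝓡 n).tangent ∞ φ ∧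
      ((∀ (m : M) (u : TangentSpace 𝓘(ℝ, E) m), ∃! ξ : GroupLieAlgebra 𝓘(ℝ, EG) G,
          (⟨m, u + Routh.fundamental EG G m ξ⟩ : TangentBundle 𝓘(ℝ, E) M)
            ∈ Routh.levelSet L μ) →
        ∃ Φ : Diffeomorph (𝓡 n).tangent (𝓡 n).tangent (Routh.LevelQuotient L μ)
          (TangentBundle (𝓡 n) (MulAction.orbitRel.Quotient G M)) ∞, ⇑Φ = φ) ∧
      -- the reduced Routhian
      ∃ R : Routh.LevelQuotient L μ → ℝ,
        ContMDiff (𝓡 n).tangent 𝓘(ℝ, ℝ) ∞ R ∧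
        (∀ w : Routh.levelSet L μ, R (Routh.levelProj L μ w) = Routh.routhian A L w.1) ∧
        ∀ Γ : (∀ w : TangentBundle 𝓘(ℝ, E) M, TangentSpace 𝓘(ℝ, E).tangent w),
          Routh.IsEulerLagrangeField L Γ →
          -- `Γ` is tangent to `N_μ` and invariant
          (∀ w ∈ Routh.levelSet L μ, ∀ ξ : GroupLieAlgebra 𝓘(ℝ, EG) G,
            Routh.dirDeriv 𝓘(ℝ, E).tangent
              (fun w' => Routh.momentum EG G L w' ξ) w (Γ w) = 0) ∧
          (∀ (g : G) (w : TangentBundle 𝓘(ℝ, E) M),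
            mfderiv 𝓘(ℝ, E).tangent 𝓘(ℝ, E).tangent
              (Routh.tangentAct (E := E) (M := M) g) w (Γ w) = Γ (Routh.tangentAct g w)) ∧
          -- the reduced vector field
          ∃ Γr : ∀ z : Routh.LevelQuotient L μ, TangentSpace (𝓡 n).tangent z,
            ContMDiff (𝓡 n).tangent (𝓡 n).tangent.tangent ∞
              (fun z => (⟨z, Γr z⟩ :
                TangentBundle (𝓡 n).tangent (Routh.LevelQuotient L μ))) ∧
            -- both `Γ` and every field that differs from it by a vertical field reduce to `Γr`
            (∀ ξ : TangentBundle 𝓘(ℝ, E) M → GroupLieAlgebra 𝓘(ℝ, EG) G,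
              Routh.ReducesTo L μ (fun w => Γ w + Routh.fundamentalT EG G w (ξ w)) Γr) ∧
            -- `Γr` is a second-order differential equation field
            (∀ z : Routh.LevelQuotient L μ,
              mfderiv (𝓡 n).tangent (𝓡 n) (fun z' => (φ z').proj) z (Γr z) = (φ z).2) ∧
            -- its integral curves are the solutions of Routh's equations
            ∀ (c : ℝ → Routh.LevelQuotient L μ) (a b : ℝ),
              IsMIntegralCurveOn c Γr (Ioo a b) ↔
                Routh.IsRouthSolution L μ A φ R c (Ioo a b) := by
  refine ⟨Routh.existsUnique_isEulerLagrangeField hL hreg,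
    Routh.contMDiff_momentum hbundle hL,
    fun w _ ξ h => Routh.eq_zero_of_dirDeriv_momentum hbundle hL hgreg w ξ h,
    fun g w hw => Routh.tangentAct_mem_levelSet hL hinv g hw, ?_⟩
  obtain ⟨hc, hm, hφ⟩ :=
    Routh.exists_isLocalDiffeomorph_reducedProj (μ := μ) hbundle A hL hinv hreg hgreg
  refine ⟨hc, hm, Routh.reducedProj hbundle L μ,
    Routh.isQuotientManifold hbundle A hL hinv hreg hgreg hφ, fun w => rfl, hφ,
    fun h => Routh.exists_diffeomorph_of_bijective hφ
      (Routh.bijective_reducedProj hbundle hL hinv h),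
    Routh.reducedRouthian A hL hinv μ,
    Routh.contMDiff_reducedRouthian hbundle A hL hinv hreg hgreg hφ, fun w => rfl,
    fun Γ hΓ => ⟨fun w _ ξ => hΓ.dirDeriv_momentum_eq_zero hbundle hL hinv w ξ,
      hΓ.mfderiv_tangentAct EG hL hinv hreg, Routh.reducedField hbundle μ Γ,
      Routh.contMDiff_reducedField A hL hinv hreg hgreg hφ hΓ,
      Routh.reducesTo_reducedField A hL hinv hreg hgreg hφ hΓ,
      Routh.mfderiv_proj_reducedField A hL hinv hreg hgreg hφ hΓ, fun c a b =>
      ⟨Routh.isRouthSolution_of_isMIntegralCurveOn hL hinv hreg hgreg hφ hΓ isOpen_Ioo,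
        Routh.isMIntegralCurveOn_of_isRouthSolution hL hinv hreg hgreg hφ hΓ⟩⟩⟩
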